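/- Conventions. A schema is a finite set of relation symbols with positive arities; a database \(D\) over it is a finite set of atoms \(R(c_1,\dots,c_r)\) over constants, and the elements of \(D\) are the constants mentioned in it. A conjunctive query \(q(\bar x)=\exists\bar y\,(R_1(\bar x_1)\wedge\dots\wedge R_m(\bar x_m))\), \(m\ge 1\), contains no constants; \(\bar x\) is the tuple of its free variables, possibly with repetitions, all free variables occur in its atoms, and all other variables in its atoms are existentially quantified. \(q(D)\) is the set of tuples \(h(\bar x)\), for \(h\) a homomorphism from the set of atoms of \(q\) to \(D\). \(\mathsf{TW}(k)\) is the class of conjunctive queries for which the graph on the existentially quantified variables, with an edge between distinct variables that occur together in an atom, has treewidth at most \(k\) (queries without existentially quantified variables are included). For \(n\)-ary relations \(S^+,S^-\) over the elements of \(D\), a \(\mathsf{TW}(k)\)-explanation for \(S^+\) and \(S^-\) over \(D\) is a query \(q\in\mathsf{TW}(k)\) with \(n\) free positions such that \(S^+\subseteq q(D)\) and \(q(D)\cap S^-=\emptyset\). \(\prod_{\bar a\in S^+}(D,\bar a)\) is the direct product of the copies of \(D\) indexed by \(S^+\), over the same schema (an atom is in it iff all its coordinate projections are in \(D\)), together with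 the \(n\)-tuple whose coordinate at \(\bar a\) is \(\bar a\). We write \((D,\bar a)\to_{k+1}(D',\bar b)\) if the duplicator wins the existential \((k+1)\)-pebble game: the spoiler first places \(k+1\) pebbles on elements of \(D\), in each further round he moves one of them to an element of \(D\); the duplicator answers each time with his corresponding pebbles on elements of \(D'\), and he must be able to go on forever such that after each round, with \(\bar c,\bar d\) the tuples of pebbled elements, \((\bar c,\bar a)\mapsto(\bar d,\bar b)\) is a well-defined partial homomorphism from \(D\) to \(D'\). Theorem. Fix \(k\ge 1\). There is an algorithm (a deterministic multi-stack Turing machine) and a polynomial \(p\) such that, on every input consisting of a schema, a database \(D\) over it, an \(n\ge 0\), and two finite \(n\)-ary relations \(S^+\) and \(S^-\) over the elements of \(D\) (constants and relation symbols written in binary, arities in unary), encoded by a word of length \(\ell\), the algorithm halts after at most \(2^{p(\ell)}\) steps and 1. it decides whether there is a \(\mathsf{TW}(k)\)-explanation for \(S^+\) and \(S^-\) over \(D\), and 2. if there is one, it outputs (a list without repetitions of the tuples of) a set that equals \(q(D)\) for some \(\mathsf{TW}(k)\)-explanation \(q\) for \(S^+\) and \(S^-\) over \(D\), and that consists exactly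 of the \(n\)-tuples \(\bar b\) of elements of \(D\) with \(\prod_{\bar a\in S^+}(D,\bar a)\to_{k+1}(D,\bar b)\). -/

import Mathlib

namespace QBE

/-! ### Schemas, databases, homomorphisms, products -/

/-- A schema: a finite set of relation symbols, each one with a positive arity. -/
structure Schema where
  numRel : ℕ
  arity : Fin numRel → ℕ
  arity_pos : ∀ R, 0 < arity R

/-- An atom `R(c₁, …, c_r)` over the schema `σ` with entries in `C`. -/
structure Atom (σ : Schema) (C : Type) where
  rel : Fin σ.numRel
  args : Fin (σ.arity rel) → C

/-- The image `R(h(c₁), …, h(c_r))` of the atom `R(c₁, …, c_r)`. -/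
def Atom.map {σ : Schema} {C C' : Type} (h : C → C') (A : Atom σ C) : Atom σ C' :=
  ⟨A.rel, fun i => h (A.args i)⟩

/-- The elements mentioned in a database (a set of atoms). -/
def adom {σ : Schema} {C : Type} (D : Set (Atom σ C)) : Set C :=
  {c | ∃ A ∈ D, ∃ i, A.args i = c}

/-- The direct product of a family of databases: its elements are families of elements, and it
contains the atoms all of whose coordinate projections lie in the respective factors. -/
def prodDB {σ : Schema} {C ι : Type} (D : ι → Set (Atom σ C)) : Set (Atom σ (ι → C)) :=
  {A | ∀ i, A.map (fun f => f i) ∈ D i}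

/-- The direct product of a family of `n`-ary tuples. -/
def prodTuple {C ι : Type} {n : ℕ} (a : ι → Fin n → C) : Fin n → ι → C :=
  fun j i => a i j

/-! ### Conjunctive queries -/

/-- A conjunctive query with an `n`-ary tuple `head` of free variables (possibly with
repetitions): a nonempty finite set of atoms over variables, without constants. Free variables
occur in the atoms; all other variables that occur in the atoms are existentially quantified. -/
structure CQ (σ : Schema) (n : ℕ) where
  atoms : Set (Atom σ ℕ)
  atoms_finite : atoms.Finite
  atoms_nonempty : atoms.Nonempty
  head : Fin n → ℕ
  head_mem : ∀ i, head i ∈ adom atoms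

namespace CQ

variable {σ : Schema} {n : ℕ}

/-- The evaluation `q(D)`: all tuples `h(x̄)` for `h` a homomorphism from the canonical database
of `q` to `D`. -/
def eval {C : Type} (q : CQ σ n) (D : Set (Atom σ C)) : Set (Fin n → C) :=
  {b | ∃ h : ℕ → C, (∀ A ∈ q.atoms, A.map h ∈ D) ∧ b = fun i => h (q.head i)}

/-- The existentially quantified variables. -/
def exVars (q : CQ σ n) : Set ℕ :=
  adom q.atoms \ Set.range q.head

/-- The Gaifman graph of the existentially quantified variables. -/
def gaifman (q : CQ σ n) : SimpleGraph q.exVars where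
  Adj u v := u ≠ v ∧ ∃ A ∈ q.atoms, (∃ i, A.args i = u) ∧ (∃ i, A.args i = v)
  symm := ⟨fun _ _ h => ⟨h.1.symm, h.2.imp fun _ hA => ⟨hA.1, hA.2.2, hA.2.1⟩⟩⟩
  loopless := ⟨fun _ h => h.1 rfl⟩

end CQ

/-- A tree decomposition of `G`. Bags may be empty, so that the graph without vertices has a tree
decomposition too; on other graphs this does not change the treewidth. -/
structure TreeDecomposition {V : Type} (G : SimpleGraph V) where
  node : Type
  node_finite : Finite node
  tree : SimpleGraph node
  isTree : tree.IsTree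
  bag : node → Finset V
  vertex_connected : ∀ v, (tree.induce {t | v ∈ bag t}).Connected
  edge_covered : ∀ u v, G.Adj u v → ∃ t, u ∈ bag t ∧ v ∈ bag t

/-- `G` has treewidth at most `k`. -/
def TreewidthLE {V : Type} (G : SimpleGraph V) (k : ℕ) : Prop :=
  ∃ T : TreeDecomposition G, ∀ t, (T.bag t).card ≤ k + 1

/-- The class `TW(k)` of conjunctive queries of treewidth at most `k`. -/
def TW (k : ℕ) {σ : Schema} {n : ℕ} : Set (CQ σ n) :=
  {q | TreewidthLE q.gaifman k}

/-- `q` is a `TW(k)`-explanation for `S⁺ = pos` and `S⁻ = neg` over `D`. -/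
def IsTWExplanation (k : ℕ) {σ : Schema} {n : ℕ} {C : Type} (D : Set (Atom σ C))
    (pos neg : Set (Fin n → C)) (q : CQ σ n) : Prop :=
  q ∈ TW k ∧ pos ⊆ q.eval D ∧ q.eval D ∩ neg = ∅

/-! ### The existential pebble game -/

/-- The correspondence `s i ↦ t i` is a (well-defined) partial homomorphism from `D` to `D'`. -/
def IsPartialHom {σ : Schema} {C C' ι : Type} (D : Set (Atom σ C)) (D' : Set (Atom σ C'))
    (s : ι → C) (t : ι → C') : Prop :=
  (∀ i j, s i = s j → t i = t j) ∧
    ∀ (R : Fin σ.numRel) (f : Fin (σ.arity R) → ι),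
      (⟨R, fun i => s (f i)⟩ : Atom σ C) ∈ D → (⟨R, fun i => t (f i)⟩ : Atom σ C') ∈ D'

/-- `(D, a) →_k (D', b)`: the duplicator wins the existential `k`-pebble game. A winning strategy
is a set `W` of positions (pairs of the tuples of elements that the spoiler's and the duplicator's
pebbles cover) in which the duplicator is not lost, such that he can answer every first round by a
position in `W` and, from a position in `W`, every move of one pebble by a position in `W`. -/
def PebbleWin (k : ℕ) {σ : Schema} {C C' : Type} {n : ℕ} (D : Set (Atom σ C)) (a : Fin n → C)
    (D' : Set (Atom σ C')) (b : Fin n → C') : Prop :=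
  ∃ W : Set ((Fin k → C) × (Fin k → C')),
    (∀ p ∈ W, IsPartialHom D D' (Sum.elim p.1 a) (Sum.elim p.2 b)) ∧
    (∀ c : Fin k → C, (∀ i, c i ∈ adom D) →
      ∃ d : Fin k → C', (∀ i, d i ∈ adom D') ∧ (c, d) ∈ W) ∧
    (∀ p ∈ W, ∀ i, ∀ c ∈ adom D, ∃ d ∈ adom D',
      (Function.update p.1 i c, Function.update p.2 i d) ∈ W)

/-! ### Instances and their encoding as words -/

/-- An input: a schema, a database `D` over it, an arity `n`, and two `n`-ary relations `S⁺`, `S⁻`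
over the elements of `D`. Finite sets are given by listing their members in any order; constants
are natural numbers. -/
structure Instance where
  schema : Schema
  db : List (Atom schema ℕ)
  n : ℕ
  posList : List (Fin n → ℕ)
  negList : List (Fin n → ℕ)
  pos_over : ∀ a ∈ posList, ∀ i, a i ∈ adom {A | A ∈ db}
  neg_over : ∀ a ∈ negList, ∀ i, a i ∈ adom {A | A ∈ db}

namespace Instance

/-- The database `D` of an instance. -/
def D (I : Instance) : Set (Atom I.schema ℕ) := {A | A ∈ I.db}

/-- The set `S⁺` of positive examples. -/
def pos (I : Instance) : Set (Fin I.n → ℕ) := {a | a ∈ I.posList}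

/-- The set `S⁻` of negative examples. -/
def neg (I : Instance) : Set (Fin I.n → ℕ) := {a | a ∈ I.negList}

/-- The `n`-ary tuples `b` over `D` such that `∏_{a ∈ S⁺} (D, a) →_{k+1} (D, b)`. -/
def pebbleTuples (k : ℕ) (I : Instance) : Set (Fin I.n → ℕ) :=
  {b | (∀ i, b i ∈ adom I.D) ∧
    PebbleWin (k + 1) (prodDB fun _ : I.pos => I.D) (prodTuple fun a : I.pos => a.1) I.D b}

end Instance

/-- The alphabet of the words that encode inputs and outputs. -/
inductive Sym
  | zero | one | comma | lpar | rpar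
  deriving DecidableEq

instance : Fintype Sym :=
  ⟨{Sym.zero, Sym.one, Sym.comma, Sym.lpar, Sym.rpar}, fun x => by cases x <;> decide⟩

/-- A natural number in binary (least significant bit first), with an end mark. -/
def encNat (m : ℕ) : List Sym :=
  m.bits.map (fun b => cond b Sym.one Sym.zero) ++ [Sym.comma]

/-- An arity, in unary, with an end mark. -/
def encArity (m : ℕ) : List Sym :=
  List.replicate m Sym.one ++ [Sym.comma]

/-- A list, given an encoding of its entries. -/
def encList {α : Type} (f : α → List Sym) (l : List α) : List Sym :=
  Sym.lpar :: (l.flatMap f ++ [Sym.rpar])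

def encTuple {n : ℕ} (a : Fin n → ℕ) : List Sym :=
  encList encNat (List.ofFn a)

def encAtom {σ : Schema} (A : Atom σ ℕ) : List Sym :=
  encNat A.rel ++ encTuple A.args

def Instance.encode (I : Instance) : List Sym :=
  encList encArity (List.ofFn I.schema.arity) ++ encList encAtom I.db ++ encArity I.n ++
    encList encTuple I.posList ++ encList encTuple I.negList

/-- An output is either the answer no, or the answer yes with a list of `n`-ary tuples. -/
def encOutput {n : ℕ} : Option (List (Fin n → ℕ)) → List Sym
  | none => [Sym.zero]
  | some L => Sym.one :: encList encTuple L

/-- The (multi-stack Turing) machine `M`, with all stack alphabets finite, halts on the input word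
`w` with the output word `w'` after at most `t` steps. -/
def OutputsWithin (M : Turing.TM2ComputableAux Sym Sym) (w w' : List Sym) (t : ℕ) : Prop :=
  (∀ s, Finite (M.tm.Γ s)) ∧
    Nonempty (Turing.TM2OutputsInTime M.tm (w.map M.inputAlphabet.invFun)
      (some (w'.map M.outputAlphabet.invFun)) t)

end QBE

namespace QBE

open Turing Function

/-! A homomorphism into a product is a family of homomorphisms, so a query `q` returns all of `S⁺`
over `D` exactly if it holds at the distinguished tuple `a` of the product `P` of the pairs in `S⁺`
(`CQ.prodTuple_mem_eval`). It remains to compare queries of treewidth `k` with the game on `k + 1`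
pebbles, in two directions.

If `q` holds at `a` in `P` and the duplicator wins from `(P, a)` to `(D, b)`, then `q` holds at `b`:
the spoiler walks down a tree decomposition of `q` with his pebbles on the images of the current
bag, and the answers fit together to a homomorphism (`eval_of_pebbleWin`). Conversely, `P` is
unravelled along all histories of at most `M` placements of the pebbles. The tree of histories is a
tree decomposition, so the unravelling is a query in `TW(k)`. It holds at `a`, and a homomorphism
from it to `D` that sends the head to `b` tells the duplicator how to survive until the histories
get too long. There are only finitely many positions, so for large `M` this suffices to win
(`exists_query`). This query returns exactly the tuples for which the duplicator wins, and every
explanation returns at least these. Hence only the negative examples among them can prevent an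
explanation.

There is one proviso: a query has an atom, and its free variables occur in atoms. The existential
variables of an atom form a clique and lie in one bag (`CQ.exists_bag`), so the image of the atom
has at most `k + 1` elements outside of `a`. The condition `Covered` asks for such atoms in `P`; it
is necessary (`covered_of_eval`), and it makes the unravelling a query.

For the algorithm, the product and the set of candidate tuples have exponential size. As `k` is
fixed, the positions of one game are polynomially many in the size of the product, and the repeated
removal of lost positions decides the game (`wins_iff`). The time bound is obtained from a calculus
of polynomial-time functions on binary trees (`Poly`), closed under composition, case distinction
and folds with bounded accumulators. Instances get a formal size of about `2 ^ (ℓ * ℓ)`, for `ℓ` the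
length of the input word, so that polynomial in the size means exponential in `ℓ`
(`Poly.exists_machine`). The programs behind `Poly` are compiled to stack machines by
`Prog.simulates`. -/

/-! ### Structured programs over stacks -/

/-- The stacks of the structured programs. -/
inductive Reg
  | main | save | hold | buf | cnt | out
  deriving DecidableEq

instance : Fintype Reg :=
  ⟨{Reg.main, Reg.save, Reg.hold, Reg.buf, Reg.cnt, Reg.out}, fun x => by cases x <;> decide⟩

/-- The contents of all stacks. -/
abbrev Store := Reg → List Sym

/-- Structured programs. -/
inductive Prog
  | skip
  | push (k : Reg) (x : Sym)
  | pop (k : Reg) (f : Option Sym → Prog)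
  | seq (p q : Prog)
  | loop (k : Reg) (c : Option Sym → Bool) (p : Prog)

/-- Big-step semantics; the last argument counts the loop tests. -/
inductive Run : Prog → Store → Store → ℕ → Prop
  | skip (s) : Run .skip s s 0
  | push (k x s) : Run (.push k x) s (update s k (x :: s k)) 0
  | pop {k f s s' t} (h : Run (f (s k).head?) (update s k (s k).tail) s' t) :
      Run (.pop k f) s s' t
  | seq {p q s s' s'' t t'} (h : Run p s s' t) (h' : Run q s' s'' t') :
      Run (.seq p q) s s'' (t + t')
  | done {k c p s} (h : c (s k).head? = false) : Run (.loop k c p) s s 1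
  | step {k c p s s' s'' t t'} (h : c (s k).head? = true) (h' : Run p s s' t)
      (h'' : Run (.loop k c p) s' s'' t') : Run (.loop k c p) s s'' (1 + t + t')

/-! ### Compilation of structured programs to stack machines -/

namespace Prog

/-- The loops of a program, which are the labels of the machine. -/
def Lab : Prog → Type
  | skip => Empty
  | push _ _ => Empty
  | pop _ f => Σ o, Lab (f o)
  | seq p q => Lab p ⊕ Lab q
  | loop _ _ p => Option (Lab p)

instance finite_lab : ∀ p : Prog, Finite p.Lab
  | skip => inferInstanceAs (Finite Empty)
  | push _ _ => inferInstanceAs (Finite Empty)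
  | pop _ f => by
      have := fun o => finite_lab (f o)
      exact inferInstanceAs (Finite (Σ o, Lab (f o)))
  | seq p q => by
      have := finite_lab p
      have := finite_lab q
      exact inferInstanceAs (Finite (Lab p ⊕ Lab q))
  | loop _ _ p => by
      have := finite_lab p
      exact inferInstanceAs (Finite (Option (Lab p)))

/-- Statements of the compiled machine: the local variable holds the symbol read last. -/
abbrev MStmt (Λ : Type) := TM2.Stmt (fun _ : Reg => Sym) Λ (Option Sym)

open TM2.Stmt in
/-- Branch on the value of the local variable. -/
def cases {Λ : Type} (f : Option Sym → MStmt Λ) : MStmt Λ :=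
  branch (fun o => decide (o = none)) (f none) <|
  branch (fun o => decide (o = some Sym.zero)) (f (some Sym.zero)) <|
  branch (fun o => decide (o = some Sym.one)) (f (some Sym.one)) <|
  branch (fun o => decide (o = some Sym.comma)) (f (some Sym.comma)) <|
  branch (fun o => decide (o = some Sym.lpar)) (f (some Sym.lpar)) (f (some Sym.rpar))

theorem stepAux_cases {Λ : Type} (f : Option Sym → MStmt Λ) (o : Option Sym) (s : Store) :
    TM2.stepAux (cases f) o s = TM2.stepAux (f o) o s := by
  rcases o with _ | x
  · simp [cases]
  · cases x <;> simp [cases]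

/-- The statement that runs the program and goes on with `q`. -/
def comp {Λ : Type} : (p : Prog) → (p.Lab → Λ) → MStmt Λ → MStmt Λ
  | skip, _, q => q
  | push k x, _, q => TM2.Stmt.push k (fun _ => x) q
  | pop k f, e, q => TM2.Stmt.pop k (fun _ o => o)
      (cases fun o => comp (f o) (fun l => e ⟨o, l⟩) q)
  | seq p p', e, q => comp p (fun l => e (Sum.inl l)) (comp p' (fun l => e (Sum.inr l)) q)
  -- The continuation is absent here: control jumps to the label of the loop, and `code` puts the
  -- continuation there, behind the failed test.
  | loop _ _ _, e, _ => TM2.Stmt.goto fun _ => e none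

/-- The statement at a label of the program. -/
def code {Λ : Type} : (p : Prog) → (p.Lab → Λ) → MStmt Λ → p.Lab → MStmt Λ
  | skip, _, _, l => Empty.elim l
  | push _ _, _, _, l => Empty.elim l
  | pop _ f, e, q, ⟨o, l⟩ => code (f o) (fun l => e ⟨o, l⟩) q l
  | seq p p', e, q, Sum.inl l =>
      code p (fun l => e (Sum.inl l)) (comp p' (fun l => e (Sum.inr l)) q) l
  | seq _ p', e, q, Sum.inr l => code p' (fun l => e (Sum.inr l)) q l
  | loop k c p, e, q, none => TM2.Stmt.peek k (fun _ o => o)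
      (TM2.Stmt.branch c (comp p (fun l => e (some l)) (TM2.Stmt.goto fun _ => e none)) q)
  | loop _ _ p, e, _, some l =>
      code p (fun l => e (some l)) (TM2.Stmt.goto fun _ => e none) l

/-- `a` reaches `b` in exactly `t` steps. -/
def Steps {α : Type} (f : α → Option α) (a b : α) (t : ℕ) : Prop :=
  (flip bind f)^[t] (some a) = some b

theorem Steps.trans {α : Type} {f : α → Option α} {a b c : α} {t t' : ℕ} (h : Steps f a b t)
    (h' : Steps f b c t') : Steps f a c (t + t') := by
  unfold Steps at *
  rw [Nat.add_comm, iterate_add_apply, h, h']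

theorem Steps.single {α : Type} {f : α → Option α} {a b : α} (h : f a = some b) :
    Steps f a b 1 := by
  simpa [Steps, flip] using h

/-- A machine step executes a whole statement up to the next jump, and all jumps lead to loop tests;
therefore the steps are exactly the loop tests. The embedding `e` of the labels and the continuation
`q` vary in the induction, since a subprogram sits at other labels and in front of another
continuation. -/
theorem simulates {Λ : Type} (M : Λ → MStmt Λ) {p : Prog} {s s' : Store} {t : ℕ}
    (h : Run p s s' t) : ∀ (e : p.Lab → Λ) (q : MStmt Λ), (∀ l, M (e l) = code p e q l) →
    ∀ v, ∃ v', Steps (TM2.step M) (TM2.stepAux (comp p e q) v s) (TM2.stepAux q v' s') t := by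
  induction h with
  | skip s => exact fun e q _ v => ⟨v, rfl⟩
  | push k x s => exact fun e q _ v => ⟨v, rfl⟩
  | @pop k f s s' t h ih =>
    intro e q hM v
    obtain ⟨v', h'⟩ := ih (fun l => e ⟨_, l⟩) q (fun l => hM ⟨_, l⟩) (s k).head?
    refine ⟨v', ?_⟩
    simpa only [comp, TM2.stepAux, stepAux_cases] using h'
  | seq h h' ih ih' =>
    intro e q hM v
    obtain ⟨v₁, h₁⟩ := ih (fun l => e (Sum.inl l)) _ (fun l => hM (Sum.inl l)) v
    obtain ⟨v₂, h₂⟩ := ih' (fun l => e (Sum.inr l)) q (fun l => hM (Sum.inr l)) v₁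
    exact ⟨v₂, h₁.trans h₂⟩
  | @done k c p s h =>
    intro e q hM v
    refine ⟨(s k).head?, Steps.single ?_⟩
    simp only [comp, TM2.stepAux, TM2.step, hM none, code, h, cond_false]
  | @step k c p s s' s'' t t' h h' h'' ih ih' =>
    intro e q hM v
    obtain ⟨v₁, h₁⟩ := ih (fun l => e (some l)) _ (fun l => hM (some l)) (s k).head?
    obtain ⟨v₂, h₂⟩ := ih' e q hM v₁
    refine ⟨v₂, ((Steps.single ?_).trans h₁).trans h₂⟩
    simp only [comp, TM2.stepAux, TM2.step, hM none, code, h, cond_true]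

/-- The compiled machine, with input stack `main` and output stack `out`. -/
noncomputable def machine (p : Prog) : TM2ComputableAux Sym Sym where
  tm :=
    { K := Reg
      k₀ := Reg.main
      k₁ := Reg.out
      Γ := fun _ => Sym
      Λ := Option p.Lab
      main := none
      ΛFin := Fintype.ofFinite _
      σ := Option Sym
      initialState := none
      Γk₀Fin := inferInstanceAs (Fintype Sym)
      -- The final `load` restores the initial value of the local variable, as the halting
      -- configuration `haltList` demands.
      m := fun l => l.elim (comp p some (TM2.Stmt.load (fun _ => none) TM2.Stmt.halt))
        (code p some (TM2.Stmt.load (fun _ => none) TM2.Stmt.halt)) }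
  inputAlphabet := Equiv.refl _
  outputAlphabet := Equiv.refl _

/-- The step in addition to the `t` loop tests leads from the start label to the first jump. -/
theorem machine_outputsWithin {p : Prog} {w w' : List Sym} {t T : ℕ}
    (h : Run p (update (fun _ => []) Reg.main w) (update (fun _ => []) Reg.out w') t)
    (ht : t + 1 ≤ T) : OutputsWithin p.machine w w' T := by
  refine ⟨fun _ => inferInstanceAs (Finite Sym), ⟨⟨⟨1 + t, ?_⟩, (Nat.add_comm 1 t).trans_le ht⟩⟩⟩
  obtain ⟨v', h'⟩ := simulates p.machine.tm.m h some
    (TM2.Stmt.load (fun _ => none) TM2.Stmt.halt) (fun l => rfl) none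
  have hw : w.map p.machine.inputAlphabet.invFun = w := List.map_id w
  have hw' : w'.map p.machine.outputAlphabet.invFun = w' := List.map_id w'
  have h0 : (initList p.machine.tm (w.map p.machine.inputAlphabet.invFun) : p.machine.tm.Cfg) =
      (⟨some none, none, update (fun _ => []) Reg.main w⟩ :
        TM2.Cfg (fun _ : Reg => Sym) (Option p.Lab) (Option Sym)) := by
    rw [hw]
    unfold initList
    congr 1
    funext k
    by_cases hk : k = Reg.main
    · subst hk
      exact (dif_pos rfl).trans (update_self (β := fun _ => List Sym) Reg.main w _).symm
    · exact (dif_neg hk).trans (update_of_ne (β := fun _ => List Sym) hk _ (fun _ => [])).symm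
  have h1 : (haltList p.machine.tm (w'.map p.machine.outputAlphabet.invFun) :
      p.machine.tm.Cfg) = (⟨none, none, update (fun _ => []) Reg.out w'⟩ :
        TM2.Cfg (fun _ : Reg => Sym) (Option p.Lab) (Option Sym)) := by
    rw [hw']
    unfold haltList
    congr 1
    funext k
    by_cases hk : k = Reg.out
    · subst hk
      exact (dif_pos rfl).trans (update_self (β := fun _ => List Sym) Reg.out w' _).symm
    · exact (dif_neg hk).trans (update_of_ne (β := fun _ => List Sym) hk _ (fun _ => [])).symm
  change (flip bind _)^[1 + t] (some (initList _ _)) = some (haltList _ _)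
  rw [h0, h1]
  exact (Steps.single (f := TM2.step p.machine.tm.m) rfl).trans h'

end Prog

end QBE

namespace QBE

open Function

/-! ### Binary trees and their words -/

/-- Binary trees, the values on which the programs operate; a tree is also the list of its left
subtrees. -/
inductive V
  | nil
  | cons (a b : V)
  deriving DecidableEq

namespace V

/-- The prefix code of a tree. -/
def word : V → List Sym
  | nil => [Sym.zero]
  | cons a b => Sym.one :: (a.word ++ b.word)

/-- The first symbol tells a leaf from a node, so a tree can be read off the front of a stack
whatever lies below it. -/
theorem word_append_inj : ∀ {a b : V} {r r' : List Sym}, a.word ++ r = b.word ++ r' →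
    a = b ∧ r = r'
  | nil, nil, r, r', h => by simpa [word] using h
  | nil, cons _ _, r, r', h => by simp [word] at h
  | cons _ _, nil, r, r', h => by simp [word] at h
  | cons a a', cons b b', r, r', h => by
    simp only [word, List.cons_append, List.append_assoc, List.cons.injEq, true_and] at h
    obtain ⟨rfl, h'⟩ := word_append_inj h
    obtain ⟨rfl, rfl⟩ := word_append_inj h'
    exact ⟨rfl, rfl⟩

theorem word_inj {a b : V} : a.word = b.word ↔ a = b :=
  ⟨fun h => (word_append_inj (r := []) (r' := []) (by simpa using h)).1, fun h => h ▸ rfl⟩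

/-- The length of the word of a tree. -/
def len (v : V) : ℕ := v.word.length

@[simp] theorem len_nil : len nil = 1 := rfl

@[simp] theorem len_cons (a b : V) : len (cons a b) = len a + len b + 1 := by
  simp [len, word]

end V

/-! ### Basic programs -/

/-- `p` runs from `s` to `s'` with at most `T` loop tests. -/
def Runs (p : Prog) (s s' : Store) (T : ℕ) : Prop := ∃ t ≤ T, Run p s s' t

namespace Runs

variable {p q : Prog} {s s' s'' : Store} {T T' : ℕ}

theorem mono (h : Runs p s s' T) (hT : T ≤ T') : Runs p s s' T' :=
  h.imp fun _ ht => ⟨ht.1.trans hT, ht.2⟩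

theorem skip : Runs .skip s s 0 := ⟨0, le_rfl, .skip s⟩

theorem push {k x} (h : update s k (x :: s k) = s') : Runs (.push k x) s s' 0 :=
  ⟨0, le_rfl, h ▸ .push k x s⟩

theorem pop {k f} (h : Runs (f (s k).head?) (update s k (s k).tail) s' T) :
    Runs (.pop k f) s s' T :=
  h.imp fun _ ht => ⟨ht.1, .pop ht.2⟩

theorem seq (h : Runs p s s' T) (h' : Runs q s' s'' T') : Runs (.seq p q) s s'' (T + T') := by
  obtain ⟨t, ht, h⟩ := h
  obtain ⟨t', ht', h'⟩ := h'
  exact ⟨t + t', by omega, h.seq h'⟩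

theorem done {k c} (h : c (s k).head? = false) : Runs (.loop k c p) s s 1 :=
  ⟨1, le_rfl, .done h⟩

theorem done_of_eq {k c} (h : c (s k).head? = false) (h' : s' = s) :
    Runs (.loop k c p) s s' 1 :=
  h'.symm ▸ .done h

theorem step {k c} (h : c (s k).head? = true) (h' : Runs p s s' T)
    (h'' : Runs (.loop k c p) s' s'' T') : Runs (.loop k c p) s s'' (1 + T + T') := by
  obtain ⟨t, ht, h'⟩ := h'
  obtain ⟨t', ht', h''⟩ := h''
  exact ⟨1 + t + t', by omega, .step h h' h''⟩

end Runs

/-- The store with the given contents of the six stacks. -/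
def st (m sv h b c o : List Sym) : Store
  | .main => m
  | .save => sv
  | .hold => h
  | .buf => b
  | .cnt => c
  | .out => o

section st

variable (m sv h b c o x : List Sym)

@[simp] theorem st_main : st m sv h b c o .main = m := rfl
@[simp] theorem st_save : st m sv h b c o .save = sv := rfl
@[simp] theorem st_hold : st m sv h b c o .hold = h := rfl
@[simp] theorem st_buf : st m sv h b c o .buf = b := rfl
@[simp] theorem st_cnt : st m sv h b c o .cnt = c := rfl
@[simp] theorem st_out : st m sv h b c o .out = o := rfl

@[simp] theorem update_st_main : update (st m sv h b c o) .main x = st x sv h b c o := by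
  funext k; cases k <;> rfl
@[simp] theorem update_st_save : update (st m sv h b c o) .save x = st m x h b c o := by
  funext k; cases k <;> rfl
@[simp] theorem update_st_hold : update (st m sv h b c o) .hold x = st m sv x b c o := by
  funext k; cases k <;> rfl
@[simp] theorem update_st_buf : update (st m sv h b c o) .buf x = st m sv h x c o := by
  funext k; cases k <;> rfl
@[simp] theorem update_st_cnt : update (st m sv h b c o) .cnt x = st m sv h b x o := by
  funext k; cases k <;> rfl
@[simp] theorem update_st_out : update (st m sv h b c o) .out x = st m sv h b c x := by
  funext k; cases k <;> rfl

end st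

namespace Prog

/-- Sequential composition of a list of programs. -/
def seqs : List Prog → Prog
  | [] => skip
  | p :: l => seq p (seqs l)

/-- Move the top value of `k`, reversed, to the stack `buf`. -/
def take (k : Reg) : Prog :=
  -- The stack `cnt` holds one mark for each subtree still to be read: a leaf uses up a mark, and a
  -- node turns one mark into two.
  seq (push .cnt .one) <| loop .cnt Option.isSome <| pop .cnt fun _ => pop k fun o =>
    if o = some .one then seq (push .buf .one) (seq (push .cnt .one) (push .cnt .one))
    else push .buf .zero

/-- Move the whole stack `buf` onto the stack `k`. -/
def flush (k : Reg) : Prog :=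
  loop .buf Option.isSome <| pop .buf fun o => push k (o.getD .zero)

/-- Move the whole stack `buf` onto the stacks `k` and `k'`. -/
def flush₂ (k k' : Reg) : Prog :=
  loop .buf Option.isSome <| pop .buf fun o => seq (push k (o.getD .zero)) (push k' (o.getD .zero))

end Prog

open Prog

/-- The form with a continuation is chosen because a node needs both induction hypotheses within one
and the same loop: whatever the loop does once `v` has been consumed, it also does with `v` still in
front, at the price of one test per symbol. -/
theorem runs_take_loop (k : Reg) (hb : k ≠ .buf) (hc : k ≠ .cnt) (s s' : Store) (v : V) (T : ℕ) :
    ∀ x y z, Runs (loop .cnt Option.isSome <| pop .cnt fun _ => pop k fun o =>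
      if o = some .one then seq (push .buf .one) (seq (push .cnt .one) (push .cnt .one))
      else push .buf .zero)
      (update (update (update s k x) .buf (v.word.reverse ++ y)) .cnt z) s' T →
    Runs (loop .cnt Option.isSome <| pop .cnt fun _ => pop k fun o =>
      if o = some .one then seq (push .buf .one) (seq (push .cnt .one) (push .cnt .one))
      else push .buf .zero)
      (update (update (update s k (v.word ++ x)) .buf y) .cnt (.one :: z)) s' (T + v.len) := by
  induction v generalizing T with
  | nil =>
    intro x y z h
    refine (Runs.step (by simp) (Runs.pop (Runs.pop (s' := update (update (update s k x) .buf
      (V.nil.word.reverse ++ y)) .cnt z) (T := 0) ?_)) h).mono (by simp; omega)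
    simp only [ne_eq, hb, not_false_eq_true, hc, update_of_ne, update_self,
      List.head?_cons, List.tail_cons, V.word, List.cons_append, List.nil_append]
    refine Runs.push ?_
    funext j
    by_cases hj : j = k <;> by_cases hj₁ : j = .buf <;> by_cases hj₂ : j = .cnt <;>
      simp_all [update_apply]
  | cons a b iha ihb =>
    intro x y z h
    have h1 := ihb T x (a.word.reverse ++ .one :: y) z (by simpa [V.word] using h)
    have h2 := iha _ _ _ _ h1
    refine (Runs.step (by simp) (Runs.pop (Runs.pop (T := 0 + (0 + 0)) ?_)) h2).mono
      (by simp; omega)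
    simp only [ne_eq, hb, not_false_eq_true, hc, update_of_ne, update_self,
      List.head?_cons, List.tail_cons, V.word, List.cons_append]
    refine Runs.seq (Runs.push rfl) (Runs.seq (Runs.push rfl) (Runs.push ?_))
    funext j
    cases j <;> cases k <;> simp_all

theorem runs_take {k : Reg} (hb : k ≠ .buf) (hc : k ≠ .cnt) {s s' : Store} {v : V}
    {r : List Sym} (h : s k = v.word ++ r) (h0 : s .cnt = [])
    (h' : update (update s k r) .buf (v.word.reverse ++ s .buf) = s') :
    Runs (take k) s s' (v.len + 1) := by
  subst h'
  refine ((Runs.push rfl).seq (T' := v.len + 1) ?_).mono (by omega)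
  have := runs_take_loop k hb hc s (update (update s k r) .buf (v.word.reverse ++ s .buf)) v 1
    r (s .buf) (s .cnt) ?_
  · rw [Nat.add_comm]
    convert this using 1
    funext j
    cases j <;> simp [update_apply] <;> rintro rfl <;> simp_all
  · convert Runs.done ?_ using 1
    · funext j
      by_cases hj : j = k <;> by_cases hj₁ : j = .buf <;> by_cases hj₂ : j = .cnt <;>
      simp_all
    · simp [h0]

theorem runs_flush {k : Reg} (hb : k ≠ .buf) {s s' : Store} {b : List Sym} (h : s .buf = b)
    (h' : update (update s .buf []) k (b.reverse ++ s k) = s') :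
    Runs (flush k) s s' (b.length + 1) := by
  induction b generalizing s with
  | nil =>
    subst h'
    refine Runs.done_of_eq (by simp [h]) ?_
    funext j
    by_cases hj : j = k <;> by_cases hj' : j = .buf <;> simp_all [update_apply]
  | cons x b ih =>
    refine (Runs.step (by simp [h]) (Runs.pop (Runs.push rfl)) (ih ?_ ?_)).mono
      (Nat.add_comm _ _).le
    · simp [h, hb.symm]
    · subst h'
      funext j
      by_cases hj : j = k <;> by_cases hj' : j = .buf <;> simp_all

theorem runs_flush₂ {k k' : Reg} (hb : k ≠ .buf) (hb' : k' ≠ .buf) (hk : k ≠ k') {s s' : Store}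
    {b : List Sym} (h : s .buf = b)
    (h' : update (update (update s .buf []) k (b.reverse ++ s k)) k' (b.reverse ++ s k') = s') :
    Runs (flush₂ k k') s s' (b.length + 1) := by
  induction b generalizing s with
  | nil =>
    subst h'
    refine Runs.done_of_eq (by simp [h]) ?_
    funext j
    by_cases hj : j = k <;> by_cases hj₁ : j = k' <;> by_cases hj₂ : j = .buf <;>
      simp_all [update_apply]
  | cons x b ih =>
    refine (Runs.step (by simp [h]) (Runs.pop (Runs.seq (Runs.push rfl) (Runs.push rfl)))
      (ih ?_ ?_)).mono (Nat.add_comm _ _).le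
    · simp [h, hb.symm, hb'.symm]
    · subst h'
      funext j
      by_cases hj : j = k <;> by_cases hj₁ : j = k' <;> by_cases hj₂ : j = .buf <;>
        simp_all [update_apply]

namespace Prog

/-- Remove all symbols from the stack `k`. -/
def clear (k : Reg) : Prog := loop k Option.isSome <| pop k fun _ => skip

/-- Move the top value of `k` to `k'`. -/
def move (k k' : Reg) : Prog := seq (take k) (flush k')

/-- Copy the top value of `main` to `k`. -/
def copy (k : Reg) : Prog := seq (take .main) (flush₂ .main k)

/-- Remove the top value of `main`. -/
def drop : Prog := seq (take .main) (clear .buf)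

/-- Push a word. -/
def pushWord (k : Reg) : List Sym → Prog
  | [] => skip
  | x :: w => seq (pushWord k w) (push k x)

end Prog

theorem runs_clear {k : Reg} {s s' : Store} {b : List Sym} (h : s k = b)
    (h' : update s k [] = s') : Runs (clear k) s s' (b.length + 1) := by
  induction b generalizing s with
  | nil =>
    subst h'
    exact Runs.done_of_eq (by simp [h]) (by rw [← h, update_eq_self])
  | cons x b ih =>
    exact (Runs.step (by simp [h]) (Runs.pop Runs.skip) (ih (by simp [h]) (by simpa))).mono
      (Nat.add_comm _ _).le

section

variable (v : V) (m sv h o : List Sym)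

theorem runs_move_main_save :
    Runs (move .main .save) (st (v.word ++ m) sv h [] [] o) (st m (v.word ++ sv) h [] [] o)
      (2 * v.len + 2) :=
  ((runs_take (by decide) (by decide) rfl rfl rfl).seq (runs_flush (by decide) rfl
    (by simp))).mono (by simp [V.len]; omega)

theorem runs_move_main_hold :
    Runs (move .main .hold) (st (v.word ++ m) sv h [] [] o) (st m sv (v.word ++ h) [] [] o)
      (2 * v.len + 2) :=
  ((runs_take (by decide) (by decide) rfl rfl rfl).seq (runs_flush (by decide) rfl
    (by simp))).mono (by simp [V.len]; omega)

theorem runs_move_save_main :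
    Runs (move .save .main) (st m (v.word ++ sv) h [] [] o) (st (v.word ++ m) sv h [] [] o)
      (2 * v.len + 2) :=
  ((runs_take (by decide) (by decide) rfl rfl rfl).seq (runs_flush (by decide) rfl
    (by simp))).mono (by simp [V.len]; omega)

theorem runs_move_hold_main :
    Runs (move .hold .main) (st m sv (v.word ++ h) [] [] o) (st (v.word ++ m) sv h [] [] o)
      (2 * v.len + 2) :=
  ((runs_take (by decide) (by decide) rfl rfl rfl).seq (runs_flush (by decide) rfl
    (by simp))).mono (by simp [V.len]; omega)

theorem runs_copy_save :
    Runs (copy .save) (st (v.word ++ m) sv h [] [] o)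
      (st (v.word ++ m) (v.word ++ sv) h [] [] o) (2 * v.len + 2) :=
  ((runs_take (by decide) (by decide) rfl rfl rfl).seq (runs_flush₂ (by decide) (by decide)
    (by decide) rfl (by simp))).mono (by simp [V.len]; omega)

theorem runs_copy_hold :
    Runs (copy .hold) (st (v.word ++ m) sv h [] [] o)
      (st (v.word ++ m) sv (v.word ++ h) [] [] o) (2 * v.len + 2) :=
  ((runs_take (by decide) (by decide) rfl rfl rfl).seq (runs_flush₂ (by decide) (by decide)
    (by decide) rfl (by simp))).mono (by simp [V.len]; omega)

theorem runs_drop :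
    Runs drop (st (v.word ++ m) sv h [] [] o) (st m sv h [] [] o) (2 * v.len + 2) :=
  ((runs_take (by decide) (by decide) rfl rfl rfl).seq (runs_clear rfl
    (by simp))).mono (by simp [V.len]; omega)

theorem runs_pushWord (w b c : List Sym) :
    Runs (pushWord .main w) (st m sv h b c o) (st (w ++ m) sv h b c o) 0 := by
  induction w with
  | nil => exact Runs.skip
  | cons x w ih => exact ih.seq (Runs.push (by simp))

end

/-! ### Equality of values -/

namespace Prog

/-- Compare the stacks `out` and `cnt`, removing their contents; there is a symbol on `buf` at the
end if and only if they differ. -/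
def compare : Prog :=
  seq (loop .out Option.isSome <| pop .out fun o => pop .cnt fun o' =>
    if o = o' then skip else push .buf .one) <|
  loop .cnt Option.isSome <| pop .cnt fun _ => push .buf .one

/-- Replace the two top values by the truth value of their equality. -/
def equal : Prog :=
  seqs [take .main, flush .out, take .main, flush .cnt, compare,
    pop .buf fun o => if o = none then pushWord .main (V.cons .nil .nil).word
      else pushWord .main V.nil.word, clear .buf]

end Prog

/-- Only the emptiness of `b'` carries information, so its contents stay existential; its length is
bounded because it must be cleared later. -/
theorem runs_compare_cnt (m sv h : List Sym) : ∀ y b, ∃ b', (b' = [] ↔ b = [] ∧ y = []) ∧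
    b'.length ≤ b.length + y.length ∧
    Runs (loop .cnt Option.isSome <| pop .cnt fun _ => push .buf .one)
      (st m sv h b y []) (st m sv h b' [] []) (y.length + 1)
  | [], b => ⟨b, by simp, by simp, (Runs.done rfl).mono (by simp)⟩
  | x :: y, b => by
    obtain ⟨b', hb, hl, hr⟩ := runs_compare_cnt m sv h y (.one :: b)
    refine ⟨b', by simpa using hb, by simp at *; omega, (Runs.step rfl (Runs.pop (Runs.push rfl))
      (by simpa using hr)).mono (by simp; omega)⟩

theorem runs_compare (m sv h : List Sym) : ∀ x y b, ∃ b', (b' = [] ↔ b = [] ∧ x = y) ∧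
    b'.length ≤ b.length + x.length + y.length ∧
    Runs compare (st m sv h b y x) (st m sv h b' [] []) (x.length + y.length + 2)
  | [], y, b => by
    obtain ⟨b', hb, hl, hr⟩ := runs_compare_cnt m sv h y b
    exact ⟨b', by simpa [eq_comm] using hb, by simpa using hl,
      ((Runs.done rfl).seq hr).mono (by simp; omega)⟩
  | c :: x, y, b => by
    -- If `y` is used up, `pop` reads `none`, which differs from `some c` and leaves a mark;
    -- `y.tail` covers this case as well.
    obtain ⟨b', hb, hl, t, ht, hr⟩ := runs_compare m sv h x y.tail
      (if some c = y.head? then b else .one :: b)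
    refine ⟨b', ?_, ?_, t + 1, ?_, ?_⟩
    · rw [hb]
      cases y <;> simp
      split_ifs <;> simp_all
    · have : (if some c = y.head? then b else .one :: b).length ≤ b.length + 1 := by
        split_ifs <;> simp
      simp at *; omega
    · have := List.length_tail (l := y)
      simp; omega
    · cases hr with
      | seq h₁ h₂ =>
        rw [Nat.add_right_comm, Nat.add_comm _ 1]
        refine Run.seq (Run.step (t := 0) (s' := st m sv h
          (if some c = y.head? then b else .one :: b) y.tail x) rfl (Run.pop (Run.pop ?_)) h₁) h₂
        simp only [st_out, update_st_out, st_cnt, update_st_cnt, List.head?_cons, List.tail_cons]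
        split_ifs
        · exact Run.skip _
        · exact (update_st_buf m sv h b y.tail x (.one :: b)) ▸ Run.push _ _ _

theorem runs_equal (v w : V) (m sv h : List Sym) :
    Runs equal (st (v.word ++ (w.word ++ m)) sv h [] [] [])
      (st ((if v = w then V.cons .nil .nil else .nil).word ++ m) sv h [] [] [])
      (4 * (v.len + w.len) + 10) := by
  obtain ⟨b, hb, hl, hr⟩ := runs_compare m sv h v.word w.word []
  have h1 := runs_take (k := .main) (v := v) (r := w.word ++ m) (s := st (v.word ++ (w.word ++ m))
    sv h [] [] []) (by decide) (by decide) rfl rfl rfl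
  have h2 := runs_flush (k := .out) (by decide) (s := st (w.word ++ m) sv h v.word.reverse [] [])
    rfl rfl
  have h3 := runs_take (k := .main) (v := w) (r := m) (s := st (w.word ++ m) sv h [] [] v.word)
    (by decide) (by decide) rfl rfl rfl
  have h4 := runs_flush (k := .cnt) (by decide) (s := st m sv h w.word.reverse [] v.word) rfl rfl
  have h5 : Runs (pop .buf fun o => if o = none then pushWord .main (V.cons .nil .nil).word
      else pushWord .main V.nil.word) (st m sv h b [] []) (st ((if v = w then V.cons .nil .nil
      else .nil).word ++ m) sv h b.tail [] []) 0 := by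
    refine Runs.pop ?_
    rw [V.word_inj] at hb
    cases b with
    | nil =>
      have : v = w := by simpa using hb
      simpa [this] using runs_pushWord _ _ _ _ _ _ _
    | cons x b =>
      have : v ≠ w := by simpa using hb
      simpa [this] using runs_pushWord _ _ _ _ _ _ _
  have h6 := runs_clear (k := .buf) (s := st ((if v = w then V.cons .nil .nil
      else .nil).word ++ m) sv h b.tail [] []) rfl rfl
  simp only [st_buf, st_out, st_cnt, List.append_nil, update_st_main, update_st_buf,
      update_st_out, update_st_cnt, List.reverse_reverse] at h1 h2 h3 h4 h6
  refine (h1.seq (h2.seq (h3.seq (h4.seq (hr.seq (h5.seq (h6.seq Runs.skip))))))).mono ?_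
  simp [V.len] at *
  omega

end QBE

namespace QBE

open Function Prog

/-! ### Data types and functions of polynomially bounded cost -/

/-- Types whose members are encoded by trees. The size may exceed the length of the code. -/
class Data (α : Type) where
  enc : α → V
  size : α → ℕ
  len_le : ∀ a, (enc a).len ≤ size a

/-- Types whose encoding is injective, with the length of the code as the size. -/
class InjData (α : Type) [Data α] : Prop where
  inj : Injective (Data.enc : α → V)
  size_eq : ∀ a : α, Data.size a = (Data.enc a).len

open Data (enc size len_le)

instance : Data V := ⟨id, V.len, fun _ => le_rfl⟩

instance : InjData V := ⟨injective_id, fun _ => rfl⟩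

@[simp] theorem enc_V (v : V) : enc v = v := rfl

@[simp] theorem size_V (v : V) : size v = v.len := rfl

instance : Data Bool :=
  ⟨fun b => if b then .cons .nil .nil else .nil, fun b => if b then 3 else 1,
    by rintro (_ | _) <;> simp⟩

instance : InjData Bool :=
  ⟨by rintro (_ | _) (_ | _) <;> simp [enc], by rintro (_ | _) <;> simp [enc, size]⟩

theorem enc_bool (b : Bool) : enc b = if b then V.cons .nil .nil else .nil := rfl

theorem size_bool_le (b : Bool) : size b ≤ 3 := by cases b <;> simp [size]

section

variable {α β : Type} [Data α] [Data β]

instance : Data (α × β) :=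
  ⟨fun p => .cons (enc p.1) (enc p.2), fun p => size p.1 + size p.2 + 1, fun p => by
    have := len_le p.1
    have := len_le p.2
    simp only [V.len_cons]; omega⟩

@[simp] theorem enc_pair (p : α × β) : enc p = .cons (enc p.1) (enc p.2) := rfl

@[simp] theorem size_pair (p : α × β) : size p = size p.1 + size p.2 + 1 := rfl

instance [InjData α] [InjData β] : InjData (α × β) :=
  ⟨fun p q h => by
    simp only [enc_pair, V.cons.injEq] at h
    exact Prod.ext (InjData.inj h.1) (InjData.inj h.2),
    fun p => by simp [InjData.size_eq]⟩

instance : Data (List α) :=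
  ⟨List.foldr (fun a v => .cons (enc a) v) .nil, List.foldr (fun a s => size a + s + 1) 1, by
    intro l
    induction l with
    | nil => simp
    | cons a l ih =>
      have := len_le a
      simp only [List.foldr_cons, V.len_cons]; omega⟩

@[simp] theorem enc_list_nil : enc ([] : List α) = .nil := rfl

@[simp] theorem enc_list_cons (a : α) (l : List α) : enc (a :: l) = .cons (enc a) (enc l) := rfl

@[simp] theorem size_list_nil : size ([] : List α) = 1 := rfl

@[simp] theorem size_list_cons (a : α) (l : List α) : size (a :: l) = size a + size l + 1 := rfl

instance [InjData α] : InjData (List α) :=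
  ⟨by
    intro l
    induction l with
    | nil => intro l' h; cases l' <;> simp_all
    | cons a l ih =>
      intro l' h
      cases l' with
      | nil => simp at h
      | cons b l' =>
        simp only [enc_list_cons, V.cons.injEq] at h
        rw [InjData.inj h.1, ih h.2],
    fun l => by induction l <;> simp_all [InjData.size_eq]⟩

theorem size_append (l l' : List α) : size (l ++ l') + 1 = size l + size l' := by
  induction l with
  | nil => simp; omega
  | cons a l ih => simp; omega

theorem length_lt_size (l : List α) : l.length < size l := by
  induction l with
  | nil => simp
  | cons a l ih => simp; omega

theorem size_le_of_mem {l : List α} {a : α} (h : a ∈ l) : size a ≤ size l := by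
  induction l with
  | nil => simp at h
  | cons b l ih =>
    rcases List.mem_cons.1 h with rfl | h
    · simp; omega
    · have := ih h; simp; omega

theorem size_le_of_sublist {l l' : List α} (h : l.Sublist l') : size l ≤ size l' := by
  induction h with
  | slnil => simp
  | cons a _ ih => simp; omega
  | cons_cons a _ ih => simp; omega

theorem size_reverse (l : List α) : size l.reverse = size l := by
  induction l with
  | nil => rfl
  | cons a l ih =>
    have := size_append l.reverse [a]
    simp at *; omega

theorem size_le_of_forall {l : List α} {B : ℕ} (h : ∀ a ∈ l, size a ≤ B) :
    size l ≤ l.length * (B + 1) + 1 := by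
  induction l with
  | nil => simp
  | cons a l ih =>
    have := ih fun b hb => h b (List.mem_cons_of_mem _ hb)
    have := h a List.mem_cons_self
    simp [Nat.add_mul]; omega

end

/-! ### Polynomial bounds and the functions computable within them -/

/-- `t` is bounded by a polynomial in the size of the argument. -/
def PolyBound {α : Type} [Data α] (t : α → ℕ) : Prop := ∃ c, ∀ a, t a ≤ (size a + 2) ^ c

namespace PolyBound

variable {α β : Type} [Data α] [Data β] {t t' : α → ℕ}

theorem mono (h : PolyBound t) (h' : ∀ a, t' a ≤ t a) : PolyBound t' :=
  h.imp fun _ hc a => (h' a).trans (hc a)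

theorem const (n : ℕ) : PolyBound fun _ : α => n :=
  ⟨n, fun a => (Nat.lt_two_pow_self).le.trans (Nat.pow_le_pow_left (by omega) n)⟩

theorem size : PolyBound fun a : α => size a := ⟨1, fun a => by simp⟩

/-- The base `size a + 2` is at least `2`, so raising the exponent by one absorbs the sum. -/
theorem add (h : PolyBound t) (h' : PolyBound t') : PolyBound fun a => t a + t' a := by
  obtain ⟨c, hc⟩ := h
  obtain ⟨d, hd⟩ := h'
  refine ⟨max c d + 1, fun a => ?_⟩
  have h1 := Nat.pow_le_pow_right (n := Data.size a + 2) (by omega) (le_max_left c d)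
  have h2 := Nat.pow_le_pow_right (n := Data.size a + 2) (by omega) (le_max_right c d)
  have h3 := Nat.mul_le_mul_left ((Data.size a + 2) ^ max c d) (show 2 ≤ Data.size a + 2 by omega)
  have := hc a
  have := hd a
  dsimp only
  rw [pow_succ]
  omega

theorem mul (h : PolyBound t) (h' : PolyBound t') : PolyBound fun a => t a * t' a := by
  obtain ⟨c, hc⟩ := h
  obtain ⟨d, hd⟩ := h'
  exact ⟨c + d, fun a => by rw [pow_add]; exact Nat.mul_le_mul (hc a) (hd a)⟩

theorem pow (h : PolyBound t) (n : ℕ) : PolyBound fun a => t a ^ n := by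
  obtain ⟨c, hc⟩ := h
  exact ⟨c * n, fun a => by rw [pow_mul]; exact Nat.pow_le_pow_left (hc a) n⟩

theorem comp {t : β → ℕ} {f : α → β} (h : PolyBound t) (h' : PolyBound fun a => Data.size (f a)) :
    PolyBound fun a => t (f a) := by
  obtain ⟨c, hc⟩ := h
  exact ((h'.add (.const 2)).pow c).mono fun a => hc (f a)

end PolyBound

theorem Runs.pop_main {f x m sv h b c o s' T} (h' : Runs (f (some x)) (st m sv h b c o) s' T) :
    Runs (.pop .main f) (st (x :: m) sv h b c o) s' T :=
  Runs.pop (by simpa using h')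

/-- The program `p` replaces the top value `a` by `f a`, in time `T a`. -/
def Computes {α β : Type} [Data α] [Data β] (p : Prog) (f : α → β) (T : α → ℕ) : Prop :=
  -- What lies below on `main`, `save` and `hold` is preserved, and the other stacks are empty
  -- before and after; for this reason such programs can be nested freely.
  ∀ a m sv h, Runs p (st ((enc a).word ++ m) sv h [] [] [])
    (st ((enc (f a)).word ++ m) sv h [] [] []) (T a)

/-- `f` can be computed in polynomial time, and the size of the result is polynomial. -/
@[fun_prop]
structure Poly {α β : Type} [Data α] [Data β] (f : α → β) : Prop where
  computes : ∃ p T, Computes p f T ∧ PolyBound T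
  size : PolyBound fun a => size (f a)

namespace Poly

variable {α β γ δ : Type} [Data α] [Data β] [Data γ] [Data δ]

theorem of_eq {f g : α → β} (h : Poly f) (h' : ∀ a, f a = g a) : Poly g :=
  (funext h') ▸ h

theorem len (f : α → β) (h : Poly f) : PolyBound fun a => (enc (f a)).len :=
  h.size.mono fun a => len_le (f a)

/-- A function that does not change the code. -/
theorem of_enc {f : α → β} (h : ∀ a, enc (f a) = enc a) (hs : PolyBound fun a => Data.size (f a)) :
    Poly f :=
  ⟨⟨.skip, fun _ => 0, fun a m sv k => by rw [h]; exact Runs.skip, .const 0⟩, hs⟩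

/-- Only the code of the result matters. -/
theorem of_enc_comp [InjData β] {f : α → β} {g : α → V} (hg : Poly g)
    (h : ∀ a, Data.enc (f a) = g a) : Poly f := by
  obtain ⟨⟨p, T, hp, hT⟩, hs⟩ := hg
  refine ⟨⟨p, T, fun a m sv k => ?_, hT⟩, hs.mono fun a => ?_⟩
  · rw [h]
    exact hp a m sv k
  · rw [InjData.size_eq, h]
    rfl

@[fun_prop]
theorem id : Poly fun a : α => a := of_enc (fun _ => rfl) .size

@[fun_prop]
theorem const (b : β) : Poly fun _ : α => b :=
  ⟨⟨.seq drop (pushWord .main (enc b).word), fun a => 2 * Data.size a + 2, fun a m sv h =>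
    ((runs_drop _ _ _ _ _).seq (runs_pushWord _ _ _ _ _ _ _)).mono (by
      have := len_le a
      dsimp only; omega),
    ((PolyBound.const 2).mul .size).add (.const 2)⟩, .const _⟩

@[fun_prop]
theorem comp {g : β → γ} {f : α → β} (hg : Poly g) (hf : Poly f) : Poly fun a => g (f a) := by
  obtain ⟨⟨p, T, hp, hT⟩, hs⟩ := hf
  obtain ⟨⟨q, T', hq, hT'⟩, hs'⟩ := hg
  exact ⟨⟨.seq p q, fun a => T a + T' (f a), fun a m sv h =>
    (hp a m sv h).seq (hq (f a) m sv h), hT.add (hT'.comp hs)⟩, hs'.comp hs⟩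

@[fun_prop]
theorem fst : Poly (Prod.fst : α × β → α) :=
  ⟨⟨.seq (.pop .main fun _ => .skip) (.seq (move .main .save) (.seq drop (move .save .main))),
    fun a => 6 * Data.size a + 6, fun a m sv h => by
      simp only [enc_pair, V.word, List.cons_append, List.append_assoc]
      refine ((Runs.pop_main Runs.skip).seq ((runs_move_main_save _ _ _ _ _).seq
        ((runs_drop _ _ _ _ _).seq (runs_move_save_main _ _ _ _ _)))).mono ?_
      have := len_le a.1
      have := len_le a.2
      simp; omega,
    ((PolyBound.const 6).mul .size).add (.const 6)⟩,
    PolyBound.size.mono fun a => by simp; omega⟩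

@[fun_prop]
theorem snd : Poly (Prod.snd : α × β → β) :=
  ⟨⟨.seq (.pop .main fun _ => .skip) drop,
    fun a => 2 * Data.size a + 2, fun a m sv h => by
      simp only [enc_pair, V.word, List.cons_append, List.append_assoc]
      refine ((Runs.pop_main Runs.skip).seq (runs_drop _ _ _ _ _)).mono ?_
      have := len_le a.1
      simp; omega,
    ((PolyBound.const 2).mul .size).add (.const 2)⟩,
    PolyBound.size.mono fun a => by simp; omega⟩

/-- Duplicate the top value, and replace the upper copy by `f a`. -/
theorem exists_dup {f : α → β} (hf : Poly f) : ∃ p T, PolyBound T ∧ ∀ a m sv h,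
    Runs p (st ((enc a).word ++ m) sv h [] [] [])
      (st ((enc (f a)).word ++ ((enc a).word ++ m)) sv h [] [] []) (T a) := by
  obtain ⟨⟨p, T, hp, hT⟩, hs⟩ := hf
  refine ⟨.seq (copy .save) (.seq (move .save .main) p), fun a => 4 * Data.size a + 4 + T a,
    (((PolyBound.const 4).mul .size).add (.const 4)).add hT, fun a m sv h => ?_⟩
  refine ((runs_copy_save _ _ _ _ _).seq ((runs_move_save_main _ _ _ _ _).seq
    (hp a _ _ _))).mono ?_
  have := len_le a
  dsimp only; omega

@[fun_prop]
theorem pair {f : α → β} {g : α → γ} (hf : Poly f) (hg : Poly g) : Poly fun a => (f a, g a) := by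
  have hs := hf.len
  obtain ⟨p, T, hT, hp⟩ := hf.exists_dup
  obtain ⟨q, T', hq, hT'⟩ := hg.computes
  refine ⟨⟨.seq p (.seq (move .main .save) (.seq q (.seq (move .save .main) (.push .main .one)))),
    fun a => T a + T' a + 4 * (enc (f a)).len + 4, fun a m sv h => ?_,
    ((hT.add hT').add ((PolyBound.const 4).mul hs)).add (.const 4)⟩,
    (hf.size.add hg.size).add (.const 1)⟩
  simp only [enc_pair, V.word, List.cons_append, List.append_assoc]
  refine ((hp _ _ _ _).seq ((runs_move_main_save _ _ _ _ _).seq ((hq _ _ _ _).seq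
    ((runs_move_save_main _ _ _ _ _).seq (Runs.push ?_))))).mono ?_
  · simp
  · omega

/-- The encoding itself. -/
@[fun_prop]
theorem enc : Poly (Data.enc : α → V) := of_enc (fun _ => rfl) (.mono .size len_le)

@[fun_prop]
theorem cons {f : α → β} {g : α → List β} (hf : Poly f) (hg : Poly g) :
    Poly fun a => f a :: g a :=
  (of_enc (f := fun p : β × List β => p.1 :: p.2) (fun _ => rfl) .size).comp (hf.pair hg)

@[fun_prop]
theorem ite {c : α → Bool} {f g : α → β} (hc : Poly c) (hf : Poly f) (hg : Poly g) :
    Poly fun a => if c a then f a else g a := by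
  obtain ⟨p, T, hT, hp⟩ := hc.exists_dup
  obtain ⟨⟨q₁, T₁, hq₁, hT₁⟩, hs₁⟩ := hf
  obtain ⟨⟨q₂, T₂, hq₂, hT₂⟩, hs₂⟩ := hg
  -- The code of `true` consists of three symbols and that of `false` of a single zero, hence the
  -- two further pops in the first branch.
  refine ⟨⟨.seq p (.pop .main fun o => if o = some .one then
    .pop .main fun _ => .pop .main fun _ => q₁ else q₂), fun a => T a + (T₁ a + T₂ a),
    fun a m sv h => ((hp a _ _ _).seq (T' := T₁ a + T₂ a) ?_), hT.add (hT₁.add hT₂)⟩,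
    (hs₁.add hs₂).mono fun a => by split_ifs <;> omega⟩
  cases hca : c a
  · simpa [hca, enc_bool, V.word] using Runs.pop_main (f := fun o => if o = some .one then
      .pop .main fun _ => .pop .main fun _ => q₁ else q₂) (x := .zero)
      ((hq₂ a m sv h).mono (Nat.le_add_left _ (T₁ a)))
  · simpa [hca, enc_bool, V.word] using Runs.pop_main (f := fun o => if o = some .one then
      .pop .main fun _ => .pop .main fun _ => q₁ else q₂) (x := .one)
      (Runs.pop_main (x := .zero) (Runs.pop_main (x := .zero) ((hq₁ a m sv h).mono (Nat.le_add_right _ (T₂ a)))))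

/-- Case distinction on a list. -/
theorem listCases {l : α → List β} {f : α → γ} {g : α × (β × List β) → γ} {F : α → γ}
    (hl : Poly l) (hf : Poly f) (hg : Poly g) (h₁ : ∀ a, l a = [] → F a = f a)
    (h₂ : ∀ a b l', l a = b :: l' → F a = g (a, (b, l'))) : Poly F := by
  have hsl := hl.size
  have hll := hl.len
  obtain ⟨p, T, hT, hp⟩ := hl.exists_dup
  obtain ⟨⟨q₁, T₁, hq₁, hT₁⟩, hs₁⟩ := hf
  obtain ⟨⟨q₂, T₂, hq₂, ⟨c, hT₂⟩⟩, ⟨d, hs₂⟩⟩ := hg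
  have hb : ∀ n, PolyBound fun a : α => (Data.size a + Data.size (l a) + 3) ^ n := fun n =>
    ((PolyBound.size.add hsl).add (.const 3)).pow n
  have h0 : ∀ {a b l'}, l a = b :: l' → ∀ n, (Data.size (a, (b, l')) + 2) ^ n =
      (Data.size a + Data.size (l a) + 3) ^ n := by
    intro a b l' hla n
    rw [hla]
    congr 1
  -- A nonempty list has the same code as the pair of its head and tail. Thus it is enough to push
  -- the symbol back, to swap the list with `a` and to push one more symbol: the stack then reads as
  -- the code of `(a, (b, l'))`.
  refine ⟨⟨.seq p (.pop .main fun o => if o = some .one then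
    .seq (.push .main .one) (.seq (move .main .save) (.seq (move .main .hold)
      (.seq (move .save .main) (.seq (move .hold .main) (.seq (.push .main .one) q₂))))) else q₁),
    fun a => T a + (T₁ a + (Data.size a + Data.size (l a) + 3) ^ c +
      (4 * (Data.enc (l a)).len + 4 * Data.size a + 8)),
    fun a m sv h => ((hp a _ _ _).seq ?_), ?_⟩, (hs₁.add (hb d)).mono fun a => ?_⟩
  · cases hla : l a with
    | nil => exact Runs.pop_main (by simpa [h₁ a hla] using (hq₁ a m sv h).mono (by omega))
    | cons b l' =>
      have e₁ : Runs (.push .main .one) (st ((Data.enc b).word ++ (Data.enc l').word ++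
          ((Data.enc a).word ++ m)) sv h [] [] []) (st ((Data.enc (l a)).word ++
          ((Data.enc a).word ++ m)) sv h [] [] []) 0 :=
        Runs.push (by simp [hla, V.word])
      have e₂ : Runs q₂ (st (Sym.one :: ((Data.enc a).word ++ ((Data.enc (l a)).word ++ m)))
          sv h [] [] []) (st ((Data.enc (F a)).word ++ m) sv h [] [] []) (T₂ (a, (b, l'))) := by
        rw [h₂ a b l' hla]
        simpa [hla, V.word] using hq₂ (a, (b, l')) m sv h
      refine Runs.pop_main ((e₁.seq ((runs_move_main_save _ _ _ _ _).seq
        ((runs_move_main_hold _ _ _ _ _).seq ((runs_move_save_main _ _ _ _ _).seq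
        ((runs_move_hold_main _ _ _ _ _).seq ((Runs.push (update_st_main ..)).seq
        e₂)))))).mono ?_)
      have h1 := hT₂ (a, (b, l'))
      rw [h0 hla] at h1
      have := len_le a
      rw [← hla]
      omega
  · exact hT.add ((hT₁.add (hb c)).add ((((PolyBound.const 4).mul hll).add
      ((PolyBound.const 4).mul .size)).add (.const 8)))
  · cases hla : l a with
    | nil => rw [h₁ a hla]; omega
    | cons b l' =>
      have h1 : Data.size (g (a, (b, l'))) ≤ _ := hs₂ (a, (b, l'))
      rw [h0 hla] at h1
      rw [h₂ a b l' hla, ← hla]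
      omega

@[fun_prop]
theorem eq [InjData β] {f g : α → β} (hf : Poly f) (hg : Poly g) [∀ a, Decidable (f a = g a)] :
    Poly fun a => decide (f a = g a) := by
  have hs₁ := hf.size
  have hs₂ := hg.size
  obtain ⟨⟨p, T, hp, hT⟩, hs⟩ := hf.pair hg
  refine ⟨⟨.seq p (.seq (.pop .main fun _ => .skip) equal), fun a => T a +
    (4 * (Data.size (f a) + Data.size (g a)) + 10), fun a m sv h => ((hp a m sv h).seq ?_),
    hT.add (((PolyBound.const 4).mul (hs₁.add hs₂)).add (.const 10))⟩,
    (PolyBound.const 3).mono fun a => size_bool_le _⟩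
  simp only [enc_pair, V.word, List.cons_append, List.append_assoc]
  refine ((Runs.pop_main Runs.skip).seq (s'' := st ((Data.enc (decide (f a = g a))).word ++ m)
    sv h [] [] []) (T' := 4 * ((Data.enc (f a)).len + (Data.enc (g a)).len) + 10) ?_).mono ?_
  · have := runs_equal (Data.enc (f a)) (Data.enc (g a)) m sv h
    simpa [enc_bool, InjData.inj.eq_iff] using this
  · have := len_le (f a)
    have := len_le (g a)
    omega

section foldl

/-- The body of the loop that computes a fold. -/
def foldBody (q : Prog) : Prog :=
  .pop .main fun _ => .seq (move .main .save) (.seq (move .main .hold) (.seq (move .save .main)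
    (.seq (.push .main .one) (.seq (move .main .save) (.seq (copy .hold) (.seq (move .save .main)
    (.seq (move .hold .main) (.seq (.push .main .one) (.seq q (move .hold .main))))))))))

/-- Between rounds the stack reads: remaining list, accumulator, parameter. While `q` works, the
remaining list waits on `hold`, and `q` gets a copy of the parameter so that the next round still
has it. -/
theorem runs_foldBody {q : Prog} {g : α → γ → β → γ} {T : α × (β × γ) → ℕ}
    (hq : Computes q (fun p : α × (β × γ) => g p.1 p.2.2 p.2.1) T) (a : α) (b : β) (c : γ)
    (l : List β) (m sv h : List Sym) :
    Runs (foldBody q) (st ((Data.enc (b :: l)).word ++ ((Data.enc c).word ++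
      ((Data.enc a).word ++ m))) sv h [] [] []) (st ((Data.enc l).word ++
      ((Data.enc (g a c b)).word ++ ((Data.enc a).word ++ m))) sv h [] [] [])
      (T (a, (b, c)) + 8 * (Data.size a + Data.size b + Data.size c + Data.size l + 3)) := by
  have e₁ := hq (a, (b, c)) ((Data.enc a).word ++ m) sv ((Data.enc l).word ++ h)
  have e₂ := runs_move_main_save (Data.enc (b, c)) ((Data.enc a).word ++ m) sv
    ((Data.enc l).word ++ h) []
  have e₃ := runs_move_save_main (Data.enc (b, c)) ((Data.enc a).word ++ m) sv
    ((Data.enc a).word ++ ((Data.enc l).word ++ h)) []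
  simp only [enc_pair, V.word, List.cons_append, List.append_assoc, enc_list_cons] at e₁ e₂ e₃ ⊢
  refine Runs.pop_main (((runs_move_main_save _ _ _ _ _).seq
    ((runs_move_main_hold _ _ _ _ _).seq ((runs_move_save_main _ _ _ _ _).seq
    ((Runs.push (update_st_main ..)).seq (e₂.seq ((runs_copy_hold _ _ _ _ _).seq (e₃.seq
    ((runs_move_hold_main _ _ _ _ _).seq ((Runs.push (update_st_main ..)).seq
    (e₁.seq (runs_move_hold_main _ _ _ _ _))))))))))).mono ?_)
  have := len_le a
  have := len_le b
  have := len_le c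
  have := len_le l
  simp only [V.len_cons]
  omega

/-- A polynomial growth in each round may add up to exponential growth, therefore a polynomial bound
`t` for all intermediate accumulators is part of the assumptions. With it every round is polynomial,
and there are at most as many rounds as the list has entries. -/
theorem foldl {l : α → List β} {c₀ : α → γ} {g : α → γ → β → γ} {t : α → ℕ} (hl : Poly l)
    (h₀ : Poly c₀) (hg : Poly fun p : α × (β × γ) => g p.1 p.2.2 p.2.1) (ht : PolyBound t)
    (hb : ∀ a l₁ l₂, l a = l₁ ++ l₂ → Data.size (l₁.foldl (g a) (c₀ a)) ≤ t a) :
    Poly fun a => (l a).foldl (g a) (c₀ a) := by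
  have hsl := hl.size
  obtain ⟨p₁, T₁, hT₁, hp₁⟩ := hl.exists_dup
  obtain ⟨p₂, T₂, hT₂, hp₂⟩ := h₀.exists_dup
  obtain ⟨⟨q, T, hq, ⟨d, hT⟩⟩, -⟩ := hg
  -- `M a` bounds one round: the cost of `q` at the largest triple that can occur, and the moves of
  -- `runs_foldBody`.
  set M : α → ℕ := fun a => (Data.size a + (Data.size (l a) + t a + 1) + 1 + 2) ^ d +
    8 * (Data.size a + Data.size (l a) + t a + Data.size (l a) + 3) with hM
  have hloop : ∀ a m sv h l₂ l₁, l a = l₁ ++ l₂ →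
      Runs (.loop .main (fun o => o = some .one) (foldBody q))
        (st ((Data.enc l₂).word ++ ((Data.enc (l₁.foldl (g a) (c₀ a))).word ++
          ((Data.enc a).word ++ m))) sv h [] [] [])
        (st (Sym.zero :: ((Data.enc ((l a).foldl (g a) (c₀ a))).word ++
          ((Data.enc a).word ++ m))) sv h [] [] []) (l₂.length * (M a + 1) + 1) := by
    intro a m sv h l₂
    induction l₂ with
    | nil =>
      intro l₁ hl₁
      rw [List.append_nil] at hl₁
      rw [hl₁]
      exact (Runs.done rfl).mono (by simp)
    | cons b l₂ ih =>
      intro l₁ hl₁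
      have h1 : l a = (l₁ ++ [b]) ++ l₂ := by simp [hl₁]
      have e := ih (l₁ ++ [b]) h1
      simp only [List.foldl_append, List.foldl_cons, List.foldl_nil] at e
      refine (Runs.step rfl (runs_foldBody hq a b _ l₂ m sv h) e).mono ?_
      have h2 := hb a l₁ (b :: l₂) hl₁
      have h3 : Data.size b ≤ Data.size (l a) := size_le_of_mem (by simp [hl₁])
      have h4 : Data.size l₂ ≤ Data.size (l a) := size_le_of_sublist (by simp [h1])
      have h5 := hT (a, (b, l₁.foldl (g a) (c₀ a)))
      have h6 := h5.trans (Nat.pow_le_pow_left (m := Data.size a + (Data.size (l a) + t a + 1) +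
        1 + 2) (by simp only [size_pair]; omega) d)
      simp only [List.length_cons, hM, Nat.add_mul]
      omega
  have hMb : PolyBound M := ((((PolyBound.size.add ((hsl.add ht).add (.const 1))).add
    (.const 1)).add (.const 2)).pow d).add ((PolyBound.const 8).mul
      ((((PolyBound.size.add hsl).add ht).add hsl).add (.const 3)))
  refine ⟨⟨.seq p₁ (.seq (move .main .save) (.seq p₂ (.seq (move .save .main)
    (.seq (.loop .main (fun o => o = some .one) (foldBody q)) (.seq (.pop .main fun _ => .skip)
    (.seq (move .main .save) (.seq drop (move .save .main)))))))),
    fun a => T₁ a + T₂ a + (Data.size (l a) * (M a + 1) + 1) +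
      (4 * Data.size (l a) + 4 * t a + 2 * Data.size a + 10), fun a m sv h => ?_,
    ((hT₁.add hT₂).add ((hsl.mul (hMb.add (.const 1))).add (.const 1))).add
      (((((PolyBound.const 4).mul hsl).add ((PolyBound.const 4).mul ht)).add
        ((PolyBound.const 2).mul .size)).add (.const 10))⟩, ht.mono fun a => hb a (l a) [] (by simp)⟩
  refine ((hp₁ _ _ _ _).seq ((runs_move_main_save _ _ _ _ _).seq ((hp₂ _ _ _ _).seq
    ((runs_move_save_main _ _ _ _ _).seq ((hloop a m sv h (l a) [] rfl).seq
    ((Runs.pop_main Runs.skip).seq ((runs_move_main_save _ _ _ _ _).seq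
    ((runs_drop _ _ _ _ _).seq (runs_move_save_main _ _ _ _ _))))))))).mono ?_
  have h1 := len_le a
  have h2 := len_le (l a)
  have h3 := (len_le _).trans (hb a (l a) [] (by simp))
  have h4 := Nat.mul_le_mul_right (M a + 1) (length_lt_size (l a)).le
  dsimp only
  omega

end foldl

end Poly

end QBE

namespace QBE

open Function

namespace Poly

variable {α β γ δ : Type} [Data α] [Data β] [Data γ] [Data δ]

/-! ### Boolean operations -/

@[fun_prop]
theorem not {c : α → Bool} (hc : Poly c) : Poly fun a => !c a :=
  (hc.ite (const false) (const true)).of_eq fun a => by cases c a <;> rfl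

@[fun_prop]
theorem and {c d : α → Bool} (hc : Poly c) (hd : Poly d) : Poly fun a => c a && d a :=
  (hc.ite hd (const false)).of_eq fun a => by cases c a <;> rfl

@[fun_prop]
theorem or {c d : α → Bool} (hc : Poly c) (hd : Poly d) : Poly fun a => c a || d a :=
  (hc.ite (const true) hd).of_eq fun a => by cases c a <;> rfl

theorem iteProp {c : α → Prop} [DecidablePred c] {f g : α → β} (hc : Poly fun a => decide (c a))
    (hf : Poly f) (hg : Poly g) : Poly fun a => if c a then f a else g a :=
  (hc.ite hf hg).of_eq fun a => by simp

/-! ### Lists -/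

@[fun_prop]
theorem headD {l : α → List β} {f : α → β} (hl : Poly l) (hf : Poly f) :
    Poly fun a => (l a).headD (f a) :=
  listCases hl hf (fst.comp snd) (fun a h => by simp [h]) (fun a b l' h => by simp [h])

@[fun_prop]
theorem tail {l : α → List β} (hl : Poly l) : Poly fun a => (l a).tail :=
  listCases hl (const []) (snd.comp snd) (fun a h => by simp [h]) (fun a b l' h => by simp [h])

@[fun_prop]
theorem reverse {l : α → List β} (hl : Poly l) : Poly fun a => (l a).reverse := by
  have hs := hl.size
  refine (foldl (g := fun _ acc b => b :: acc) hl (const ([] : List β))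
    ((fst.comp snd).cons (snd.comp snd)) hs fun a l₁ l₂ h => ?_).of_eq fun a => ?_
  · rw [List.foldl_flip_cons_eq_append', List.append_nil, size_reverse, h]
    exact size_le_of_sublist (List.sublist_append_left _ _)
  · rw [List.foldl_flip_cons_eq_append', List.append_nil]

@[fun_prop]
theorem append {l l' : α → List β} (hl : Poly l) (hl' : Poly l') :
    Poly fun a => l a ++ l' a := by
  refine (foldl (g := fun _ acc b => b :: acc) hl.reverse hl'
    ((fst.comp snd).cons (snd.comp snd)) (hl.size.add hl'.size) fun a l₁ l₂ h => ?_).of_eq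
    fun a => ?_
  · have h1 := size_append l₁.reverse (l' a)
    have h2 := size_le_of_sublist (List.sublist_append_left l₁ l₂)
    rw [← h, size_reverse] at h2
    rw [size_reverse] at h1
    rw [List.foldl_flip_cons_eq_append']
    omega
  · rw [List.foldl_flip_cons_eq_append', List.reverse_reverse]

@[fun_prop]
theorem map {l : α → List β} {f : α → β → γ} (hl : Poly l)
    (hf : Poly fun p : α × β => f p.1 p.2) : Poly fun a => (l a).map (f a) := by
  obtain ⟨c, hc⟩ := hf.size
  have h : ∀ a (l' : List β), l'.foldl (fun acc b => f a b :: acc) [] = (l'.map (f a)).reverse :=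
    fun a l' => by
      induction l' using List.reverseRecOn with
      | nil => rfl
      | append_singleton l' b ih => simp [ih]
  refine (reverse (foldl (g := fun a acc b => f a b :: acc)
    (t := fun a => Data.size (l a) * ((Data.size a + Data.size (l a) + 1 + 2) ^ c + 1) + 1)
    hl (const ([] : List γ)) ((hf.comp (fst.pair (fst.comp snd))).cons (snd.comp snd))
    ?_ fun a l₁ l₂ h' => ?_)).of_eq fun a => ?_
  · have hs := hl.size
    exact ((hs.mul (((((PolyBound.size.add hs).add (.const 1)).add (.const 2)).pow c).add
      (.const 1))).add (.const 1))
  · rw [h, size_reverse]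
    refine (size_le_of_forall (B := (Data.size a + Data.size (l a) + 1 + 2) ^ c) ?_).trans ?_
    · intro x hx
      obtain ⟨b, hb, rfl⟩ := List.mem_map.1 hx
      refine (hc (a, b)).trans (Nat.pow_le_pow_left ?_ c)
      have : Data.size b ≤ Data.size (l a) := size_le_of_mem (by simp [h', hb])
      simp only [size_pair]; omega
    · have h1 := length_lt_size (l a)
      have h2 : l₁.length ≤ (l a).length := by simp [h']
      have := Nat.mul_le_mul_right ((Data.size a + Data.size (l a) + 1 + 2) ^ c + 1)
        (h2.trans h1.le)
      simp only [List.length_map]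
      omega
  · rw [h, List.reverse_reverse]

@[fun_prop]
theorem flatten {l : α → List (List β)} (hl : Poly l) : Poly fun a => (l a).flatten := by
  have h : ∀ l' : List (List β), l'.foldl (fun acc b => acc ++ b) [] = l'.flatten := fun l' => by
    induction l' using List.reverseRecOn with
    | nil => rfl
    | append_singleton l' b ih => simp [ih]
  have h' : ∀ l' : List (List β), Data.size l'.flatten ≤ Data.size l' := fun l' => by
    induction l' with
    | nil => simp
    | cons b l' ih =>
      have := size_append b l'.flatten
      simp only [List.flatten_cons, size_list_cons]; omega
  refine (foldl (g := fun _ acc b => acc ++ b) hl (const []) ((snd.comp snd).append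
    (fst.comp snd)) hl.size fun a l₁ l₂ hl₁ => ?_).of_eq fun a => h _
  rw [h, hl₁]
  exact (h' l₁).trans (size_le_of_sublist (List.sublist_append_left _ _))

@[fun_prop]
theorem flatMap {l : α → List β} {f : α → β → List γ} (hl : Poly l)
    (hf : Poly fun p : α × β => f p.1 p.2) : Poly fun a => (l a).flatMap (f a) :=
  (hl.map hf).flatten.of_eq fun _ => rfl

@[fun_prop]
theorem filter {l : α → List β} {c : α → β → Bool} (hl : Poly l)
    (hc : Poly fun p : α × β => c p.1 p.2) : Poly fun a => (l a).filter (c a) :=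
  (hl.flatMap (f := fun a b => if c a b then [b] else []) (hc.ite (snd.cons (const []))
    (const []))).of_eq fun a => by
      induction l a with
      | nil => rfl
      | cons b l ih => rw [List.flatMap_cons, ih, List.filter_cons]; split_ifs <;> rfl

@[fun_prop]
theorem any {l : α → List β} {c : α → β → Bool} (hl : Poly l)
    (hc : Poly fun p : α × β => c p.1 p.2) : Poly fun a => (l a).any (c a) := by
  have h : ∀ a (l' : List β), l'.foldl (fun acc b => acc || c a b) false = l'.any (c a) :=
    fun a l' => by
      induction l' using List.reverseRecOn with
      | nil => rfl
      | append_singleton l' b ih => simp [ih]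
  exact (foldl (g := fun a acc b => acc || c a b) hl (const false)
    ((snd.comp snd).or (hc.comp (fst.pair (fst.comp snd)))) (.const 3)
    fun a l₁ l₂ _ => size_bool_le _).of_eq fun a => h a _

@[fun_prop]
theorem all {l : α → List β} {c : α → β → Bool} (hl : Poly l)
    (hc : Poly fun p : α × β => c p.1 p.2) : Poly fun a => (l a).all (c a) :=
  (hl.any (c := fun a b => !c a b) hc.not).not.of_eq fun a => by simp [List.not_any_eq_all_not]

@[fun_prop]
theorem mem [InjData β] {f : α → β} {l : α → List β} [∀ a, Decidable (f a ∈ l a)]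
    (hf : Poly f) (hl : Poly l) : Poly fun a => decide (f a ∈ l a) := by
  classical
  exact (hl.any (c := fun a b => decide (f a = b)) ((hf.comp fst).eq snd)).of_eq fun a => by
    rw [Bool.eq_iff_iff]; simp

@[fun_prop]
theorem zip {l : α → List β} {l' : α → List γ} (hl : Poly l) (hl' : Poly l') :
    Poly fun a => (l a).zip (l' a) := by
  -- The state consists of the pairs found so far, in reverse order, and the rest of the second
  -- list.
  let g : α → List (β × γ) × List γ → β → List (β × γ) × List γ := fun _ s b =>
    match s.2 with
    | [] => (s.1, [])
    | c :: r => ((b, c) :: s.1, r)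
  have h : ∀ a (m : List β) (m' : List γ), m.foldl (g a) ([], m') =
      ((m.zip m').reverse, m'.drop m.length) := fun a m m' => by
    induction m using List.reverseRecOn with
    | nil => simp
    | append_singleton m b ih =>
      rw [List.foldl_append, ih]
      simp only [g, List.foldl_cons, List.foldl_nil]
      rcases hd : m'.drop m.length with _ | ⟨c, r⟩
      · have h1 := List.drop_eq_nil_iff.1 hd
        rw [List.length_append, List.drop_eq_nil_iff.2 (by simp; omega)]
        simp only [Prod.mk.injEq, List.reverse_inj, and_true]
        clear hd ih
        induction m generalizing m' with
        | nil => simp [List.length_eq_zero_iff.1 (Nat.le_zero.1 h1)]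
        | cons c m ihm => cases m' <;> simp_all
      · have h1 : m' = m'.take m.length ++ c :: r := by rw [← hd, List.take_append_drop]
        have h2 : m.length ≤ m'.length := by
          by_contra h2
          rw [List.drop_eq_nil_iff.2 (by omega)] at hd
          cases hd
        have h3 : (m'.take m.length).length = m.length := by simp [h2]
        generalize m'.take m.length = n at *
        subst h1
        rw [List.zip_append h3.symm]
        simp [← h3, List.drop_append]
        conv_lhs => rw [← List.append_nil m]
        rw [List.zip_append h3.symm]
        simp
  have hg : Poly fun p : α × (β × (List (β × γ) × List γ)) => g p.1 p.2.2 p.2.1 := by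
    refine listCases (l := fun p => p.2.2.2) (snd.comp (snd.comp snd))
      ((fst.comp (snd.comp snd)).pair (const [])) (g := fun p => ((p.1.2.1, p.2.1) :: p.1.2.2.1,
        p.2.2)) ?_ ?_ ?_
    · exact ((((fst.comp snd).comp fst).pair (fst.comp snd)).cons
        ((fst.comp (snd.comp snd)).comp fst)).pair (snd.comp snd)
    · rintro ⟨a, b, s, s'⟩ h
      simp only at h
      simp [g, h]
    · rintro ⟨a, b, s, s'⟩ c l' h
      simp only at h
      simp [g, h]
  refine (reverse (fst.comp (foldl (t := fun a => (Data.size (l a) + Data.size (l' a) + 1) *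
    (Data.size (l a) + Data.size (l' a) + 1 + 1) + 1 + Data.size (l' a) + 1) hl
    ((const []).pair hl') hg ?_ ?_))).of_eq ?_
  · have h1 := hl.size
    have h2 := hl'.size
    exact (((((h1.add h2).add (.const 1)).mul (((h1.add h2).add (.const 1)).add (.const 1))).add
      (.const 1)).add h2).add (.const 1)
  · intro a l₁ l₂ h'
    rw [h a, size_pair, size_reverse]
    have h1 : Data.size ((l' a).drop l₁.length) ≤ Data.size (l' a) :=
      size_le_of_sublist (List.drop_sublist _ _)
    have h2 : Data.size (l₁.zip (l' a)) ≤ (l₁.zip (l' a)).length *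
        (Data.size (l a) + Data.size (l' a) + 1 + 1) + 1 := size_le_of_forall fun p hp => by
      have h3 : Data.size p.1 ≤ Data.size (l a) :=
        size_le_of_mem (by simp [h', (List.of_mem_zip hp).1])
      have h4 : Data.size p.2 ≤ Data.size (l' a) := size_le_of_mem (List.of_mem_zip hp).2
      simp only [size_pair]; omega
    have h5 : (l₁.zip (l' a)).length ≤ Data.size (l a) + Data.size (l' a) + 1 := by
      have := length_lt_size (l' a)
      simp; omega
    have h6 := Nat.mul_le_mul_right (Data.size (l a) + Data.size (l' a) + 1 + 1) h5
    dsimp only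
    omega
  · intro a
    rw [h a, List.reverse_reverse]

@[fun_prop]
theorem zipWith {l : α → List β} {l' : α → List γ} {f : β → γ → δ}
    (hf : Poly fun p : β × γ => f p.1 p.2) (hl : Poly l) (hl' : Poly l') :
    Poly fun a => (l a).zipWith f (l' a) :=
  ((hl.zip hl').map (f := fun _ p => f p.1 p.2) (hf.comp snd)).of_eq fun a => by
    rw [List.zip, List.map_zipWith]

@[fun_prop]
theorem set {l : α → List β} {f : α → β} (hf : Poly f) (i : ℕ) (hl : Poly l) :
    Poly fun a => (l a).set i (f a) := by
  induction i generalizing l with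
  | zero =>
    exact listCases hl (const []) (g := fun p => f p.1 :: p.2.2) ((hf.comp fst).cons (snd.comp snd))
      (fun a h => by simp [h]) (fun a b l' h => by simp [h])
  | succ i ih =>
    have h := ih hl.tail
    exact listCases (g := fun p => p.2.1 :: (l p.1).tail.set i (f p.1)) hl (const [])
      ((fst.comp snd).cons (h.comp fst)) (fun a h => by simp [h]) (fun a b l' h => by simp [h])

/-- The index is not data: for fixed `k` the conjunction unfolds into `k` separate programs. -/
theorem forall_lt {c : ℕ → α → Bool} (hc : ∀ i, Poly (c i)) (k : ℕ) :
    Poly fun a => (List.range k).all fun i => c i a := by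
  induction k with
  | zero => exact const true
  | succ k ih =>
    exact (ih.and (hc k)).of_eq fun a => by simp [List.range_succ]

end Poly

/-! ### Enumeration of tuples -/

/-- All lists of length `n` over `l`. -/
def tuples {β : Type} : ℕ → List β → List (List β)
  | 0, _ => [[]]
  | n + 1, l => l.flatMap fun b => (tuples n l).map fun t => b :: t

theorem mem_tuples {β : Type} {n : ℕ} {l t : List β} :
    t ∈ tuples n l ↔ t.length = n ∧ ∀ b ∈ t, b ∈ l := by
  induction n generalizing t with
  | zero =>
    simp only [tuples, List.mem_singleton]
    constructor
    · rintro rfl; simp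
    · exact fun h => List.length_eq_zero_iff.1 h.1
  | succ n ih =>
    cases t with
    | nil => simp [tuples]
    | cons b t => simp [tuples, ih]; tauto

theorem nodup_tuples {β : Type} {l : List β} (hl : l.Nodup) (n : ℕ) : (tuples n l).Nodup := by
  induction n with
  | zero => simp [tuples]
  | succ n ih =>
    rw [tuples, List.nodup_flatMap]
    refine ⟨fun b _ => ih.map fun t t' h => (List.cons.inj h).2, hl.imp fun h t ht ht' => ?_⟩
    simp only [List.mem_map] at ht ht'
    obtain ⟨t, -, rfl⟩ := ht
    obtain ⟨t', -, h'⟩ := ht'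
    exact h (List.cons.inj h').1.symm

theorem length_tuples {β : Type} (l : List β) (n : ℕ) : (tuples n l).length = l.length ^ n := by
  induction n with
  | zero => rfl
  | succ n ih => simp [tuples, ih, pow_succ, mul_comm]

namespace Poly

variable {α β γ δ : Type} [Data α] [Data β] [Data γ] [Data δ]

@[fun_prop]
theorem tuples_const {l : α → List β} (hl : Poly l) (n : ℕ) : Poly fun a => tuples n (l a) := by
  induction n with
  | zero => exact const [[]]
  | succ n ih =>
    exact hl.flatMap (f := fun a b => (tuples n (l a)).map fun t => b :: t)
      ((ih.comp fst).map (f := fun p t => p.2 :: t) ((snd.comp fst).cons snd))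

/-- Lists of non-constant length, provided that there are not too many of them. -/
theorem tuples_length {l : α → List β} {u : α → List γ} (hl : Poly l) (hu : Poly u)
    (h : PolyBound fun a => ((l a).length + 1) ^ (u a).length) :
    Poly fun a => tuples (u a).length (l a) := by
  have h1 : ∀ a (v : List γ), v.foldl (fun acc _ => (l a).flatMap fun b =>
      acc.map fun t => b :: t) [[]] = tuples v.length (l a) := fun a v => by
    induction v using List.reverseRecOn with
    | nil => rfl
    | append_singleton v b ih =>
      rw [List.foldl_append, ih]
      simp [tuples]
  have hs := hl.size
  have hs' := hu.size
  refine (foldl (t := fun a => ((l a).length + 1) ^ (u a).length * (Data.size (u a) *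
    (Data.size (l a) + 1) + 1 + 1) + 1) (g := fun a acc _ => (l a).flatMap fun b =>
      acc.map fun t => b :: t) hu (const [[]])
    ((hl.comp fst).flatMap (α := α × (γ × List (List β)))
      (f := fun p b => p.2.2.map fun t => b :: t) (map ((snd.comp snd).comp fst) (f := fun p t => p.2 :: t) ((snd.comp fst).cons snd))) ?_ ?_).of_eq
      fun a => h1 a _
  · exact (h.mul (((hs'.mul (hs.add (.const 1))).add (.const 1)).add (.const 1))).add (.const 1)
  · intro a l₁ l₂ hl₁
    rw [h1]
    have hlen : l₁.length ≤ (u a).length := by simp [hl₁]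
    have h2 := length_lt_size (u a)
    refine (size_le_of_forall (B := Data.size (u a) * (Data.size (l a) + 1) + 1) ?_).trans ?_
    · intro t ht
      obtain ⟨ht, ht'⟩ := mem_tuples.1 ht
      refine (size_le_of_forall (B := Data.size (l a)) fun b hb =>
        size_le_of_mem (ht' b hb)).trans ?_
      have := Nat.mul_le_mul_right (Data.size (l a) + 1) (show t.length ≤ Data.size (u a) by omega)
      omega
    · rw [length_tuples]
      have h3 : (l a).length ^ l₁.length ≤ ((l a).length + 1) ^ (u a).length :=
        (Nat.pow_le_pow_left (Nat.le_succ _) _).trans (Nat.pow_le_pow_right (Nat.succ_pos _) hlen)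
      have := Nat.mul_le_mul_right (Data.size (u a) * (Data.size (l a) + 1) + 1 + 1) h3
      omega

end Poly

end QBE

namespace QBE

open Function

/-! ### The pebble game as an iteration -/

/-- If a decreasing sequence of finite sets is constant once two successive members are equal, it
is constant from the cardinality of the first set on. -/
theorem stationary {X : Type} {S : ℕ → Set X} (hfin : (S 0).Finite) (hanti : Antitone S)
    (hS : ∀ m, S m = S (m + 1) → S (m + 1) = S (m + 2)) {N : ℕ} (hN : (S 0).ncard ≤ N) :
    S (N + 1) = S N := by
  by_contra hne
  have hlt : ∀ m ≤ N, S m ≠ S (m + 1) := by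
    intro m hm heq
    obtain ⟨j, rfl⟩ := Nat.exists_eq_add_of_le hm
    have : ∀ j, S (m + j) = S (m + j + 1) := fun j => by
      induction j with
      | zero => exact heq
      | succ j ih => exact hS _ ih
    exact hne (this j).symm
  have hc : ∀ m ≤ N + 1, (S m).ncard + m ≤ (S 0).ncard := by
    intro m hm
    induction m with
    | zero => simp
    | succ m ih =>
      have h1 := ih (by omega)
      have h2 : (S (m + 1)).ncard < (S m).ncard :=
        Set.ncard_lt_ncard ((hanti (Nat.le_succ m)).ssubset_of_ne (hlt m (by omega)).symm)
          (hfin.subset (hanti (Nat.zero_le m)))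
      omega
  have := hc (N + 1) le_rfl
  omega

section

variable (k : ℕ) {σ : Schema} {C C' : Type} {n : ℕ} (D : Set (Atom σ C)) (a : Fin n → C)
  (D' : Set (Atom σ C')) (b : Fin n → C')

/-- The positions from which the duplicator survives the given number of rounds. -/
def stage : ℕ → Set ((Fin k → C) × (Fin k → C'))
  | 0 => {p | (∀ i, p.1 i ∈ adom D) ∧ (∀ i, p.2 i ∈ adom D') ∧
      IsPartialHom D D' (Sum.elim p.1 a) (Sum.elim p.2 b)}
  | m + 1 => {p | p ∈ stage m ∧ ∀ i, ∀ c ∈ adom D, ∃ d ∈ adom D',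
      (update p.1 i c, update p.2 i d) ∈ stage m}

theorem stage_antitone : Antitone (stage k D a D' b) :=
  antitone_nat_of_succ_le fun _ _ h => h.1

variable {k D a D' b}

theorem stage_zero_subset : stage k D a D' b 0 ⊆
    (Set.univ.pi fun _ => adom D) ×ˢ (Set.univ.pi fun _ => adom D') :=
  fun _ hp => ⟨fun i _ => hp.1 i, fun i _ => hp.2.1 i⟩

theorem finite_positions (hD : (adom D).Finite) (hD' : (adom D').Finite) :
    ((Set.univ.pi fun _ : Fin k => adom D) ×ˢ
      (Set.univ.pi fun _ : Fin k => adom D')).Finite :=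
  (Set.Finite.pi fun _ => hD).prod (Set.Finite.pi fun _ => hD')

/-- A stage that equals its successor is closed under the moves of the spoiler, so it is a winning
strategy. -/
theorem pebbleWin_of_stage {N : ℕ} (hN : stage k D a D' b (N + 1) = stage k D a D' b N)
    (h : ∀ c : Fin k → C, (∀ i, c i ∈ adom D) → ∃ d, (c, d) ∈ stage k D a D' b N) :
    PebbleWin k D a D' b := by
  have h0 := stage_antitone k D a D' b (Nat.zero_le N)
  refine ⟨stage k D a D' b N, fun p hp => (h0 hp).2.2, fun c hc => ?_, fun p hp => ?_⟩
  · obtain ⟨d, hd⟩ := h c hc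
    exact ⟨d, (h0 hd).2.1, hd⟩
  · rw [← hN] at hp
    exact hp.2

/-- The part of a strategy that lies over the elements of the databases is contained in every stage.
The restriction to this part is needed because `PebbleWin` does not confine `W` to these elements.
-/
theorem PebbleWin.exists_stage (h : PebbleWin k D a D' b) (N : ℕ) (c : Fin k → C)
    (hc : ∀ i, c i ∈ adom D) : ∃ d, (c, d) ∈ stage k D a D' b N := by
  obtain ⟨W, h₁, h₂, h₃⟩ := h
  have key : ∀ m, ∀ p ∈ W, (∀ i, p.1 i ∈ adom D) → (∀ i, p.2 i ∈ adom D') →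
      p ∈ stage k D a D' b m := by
    intro m
    induction m with
    | zero => exact fun p hp hc hd => ⟨hc, hd, h₁ p hp⟩
    | succ m ih =>
      refine fun p hp hc hd => ⟨ih p hp hc hd, fun i c hc' => ?_⟩
      obtain ⟨d, hd', hW⟩ := h₃ p hp i c hc'
      refine ⟨d, hd', ih _ hW (fun j => ?_) fun j => ?_⟩ <;>
      · by_cases hj : j = i
        · subst hj; simpa
        · simpa [hj] using by solve_by_elim
  obtain ⟨d, hd, hW⟩ := h₂ c hc
  exact ⟨d, key N _ hW hc hd⟩

theorem stage_stationary (hfin : (stage k D a D' b 0).Finite) {N : ℕ}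
    (hN : (stage k D a D' b 0).ncard ≤ N) :
    stage k D a D' b (N + 1) = stage k D a D' b N :=
  stationary hfin (stage_antitone k D a D' b) (fun m h => by
    ext p
    change _ ∧ _ ↔ _ ∧ _
    rw [h]) hN

theorem pebbleWin_iff_stage (hfin : (stage k D a D' b 0).Finite) {N : ℕ}
    (hN : (stage k D a D' b 0).ncard ≤ N) : PebbleWin k D a D' b ↔
      ∀ c : Fin k → C, (∀ i, c i ∈ adom D) → ∃ d, (c, d) ∈ stage k D a D' b N :=
  ⟨fun h => h.exists_stage N, pebbleWin_of_stage (stage_stationary hfin hN)⟩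

end

end QBE

namespace QBE

open Function

/-! ### Rooted trees -/

/-- A parent function and a depth function for a tree with a root. -/
structure Rooting {N : Type} (T : SimpleGraph N) (r : N) where
  par : N → N
  depth : N → ℕ
  depth_root : depth r = 0
  depth_eq : ∀ t, t ≠ r → depth t = depth (par t) + 1
  adj_par : ∀ s t, T.Adj s t → (s ≠ r ∧ t = par s) ∨ (t ≠ r ∧ s = par t)

/-- The depth is the distance from `r`. A node other than `r` has a neighbour that is closer by one,
and only one: two of them would give two paths from `r`. -/
theorem exists_rooting {N : Type} {T : SimpleGraph N} (hT : T.IsTree) (r : N) :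
    Nonempty (Rooting T r) := by
  have hpar : ∀ t, ∃ p, t ≠ r → T.Adj p t ∧ T.dist r t = T.dist r p + 1 := by
    intro t
    by_cases ht : t = r
    · exact ⟨t, fun h => (h ht).elim⟩
    · obtain ⟨w, hw⟩ := hT.connected.exists_walk_length_eq_dist t r
      cases w with
      | nil => exact (ht rfl).elim
      | cons h p =>
        rename_i v
        refine ⟨v, fun _ => ⟨h.symm, ?_⟩⟩
        have h1 := T.dist_le p
        have h2 := hT.dist_eq_dist_add_one_of_adj r h
        rw [SimpleGraph.Walk.length_cons] at hw
        rw [T.dist_comm (u := t)] at hw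
        rw [T.dist_comm (u := v)] at h1
        omega
  choose par hp using hpar
  have huniq : ∀ s t, T.Adj s t → T.dist r t = T.dist r s + 1 → s = par t := by
    intro s t hst hd
    have ht : t ≠ r := by rintro rfl; simp at hd
    have key : ∀ x, ∀ hx : T.Adj x t, T.dist r t = T.dist r x + 1 →
        ∃ w : T.Walk r x, (w.concat hx).IsPath := by
      intro x hx hdx
      obtain ⟨w, hw⟩ := hT.connected.exists_walk_length_eq_dist r x
      exact ⟨w, SimpleGraph.Walk.isPath_of_length_eq_dist _ (by
        rw [SimpleGraph.Walk.length_concat, hw, hdx])⟩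
    obtain ⟨w, hw⟩ := key s hst hd
    obtain ⟨w', hw'⟩ := key (par t) (hp t ht).1 (hp t ht).2
    have := (hT.isAcyclic.subsingleton_path r t).elim ⟨_, hw⟩ ⟨_, hw'⟩
    have h := congrArg (fun p : T.Path r t => p.1.penultimate) this
    simpa using h
  refine ⟨⟨par, T.dist r, by simp, fun t ht => (hp t ht).2, fun s t hst => ?_⟩⟩
  rcases hT.dist_eq_dist_add_one_of_adj r hst with h | h
  · exact Or.inl ⟨by rintro rfl; simp at h, huniq t s hst.symm h⟩
  · exact Or.inr ⟨by rintro rfl; simp at h, huniq s t hst h⟩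

namespace Rooting

variable {N : Type} {T : SimpleGraph N} {r : N} (ρ : Rooting T r)

/-- Choosing states along the tree. -/
theorem exists_states {S : Type} {inv : N → S → Prop} {con : N → S → S → Prop}
    (h₀ : ∃ s, inv r s) (h : ∀ t ≠ r, ∀ s, inv (ρ.par t) s → ∃ s', inv t s' ∧ con t s s') :
    ∃ F : N → S, (∀ t, inv t (F t)) ∧ ∀ t ≠ r, con t (F (ρ.par t)) (F t) := by
  classical
  obtain ⟨s₀, hs₀⟩ := h₀
  have h' : ∀ t s, ∃ s', t ≠ r → inv (ρ.par t) s → inv t s' ∧ con t s s' := fun t s => by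
    by_cases h1 : t ≠ r ∧ inv (ρ.par t) s
    · exact (h t h1.1 s h1.2).imp fun _ hs _ _ => hs
    · exact ⟨s₀, fun h2 h3 => (h1 ⟨h2, h3⟩).elim⟩
  choose f hf using h'
  -- The recursion runs on the depth; `G n` is meaningful only at nodes of depth `n`.
  let G : ℕ → N → S := fun n => n.rec (fun _ => s₀) fun _ g t => if t = r then s₀ else
    f t (g (ρ.par t))
  have hG : ∀ n t, ρ.depth t = n → t = r → G n t = s₀ := by
    intro n t _ ht
    cases n
    · rfl
    · exact if_pos ht
  have hG' : ∀ t ≠ r, G (ρ.depth t) t = f t (G (ρ.depth (ρ.par t)) (ρ.par t)) := by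
    intro t ht
    rw [ρ.depth_eq t ht]
    exact if_neg ht
  have hinv : ∀ n t, ρ.depth t = n → inv t (G (ρ.depth t) t) := by
    intro n
    induction n with
    | zero =>
      intro t ht
      have : t = r := by
        by_contra h1
        have := ρ.depth_eq t h1
        omega
      rw [hG _ t rfl this, this]
      exact hs₀
    | succ n ih =>
      intro t ht
      by_cases h1 : t = r
      · rw [hG _ t rfl h1, h1]
        exact hs₀
      · rw [hG' t h1]
        exact (hf t _ h1 (ih _ (by have := ρ.depth_eq t h1; omega))).1
  refine ⟨fun t => G (ρ.depth t) t, fun t => hinv _ t rfl, fun t ht => ?_⟩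
  dsimp only
  rw [hG' t ht]
  exact (hf t _ ht (hinv _ _ rfl)).2

/-- A connected set that contains a node but not its parent lies below the node. -/
theorem below {X : Set N} (hX : (T.induce X).Preconnected) {t : N} (ht : t ∈ X)
    (hp : t ≠ r → ρ.par t ∉ X) : ∀ x ∈ X, ∃ i, ρ.par^[i] x = t ∧ ρ.depth x = ρ.depth t + i := by
  intro x hx
  obtain ⟨w⟩ := hX ⟨x, hx⟩ ⟨t, ht⟩
  suffices ∀ (u v : X), (T.induce X).Walk u v → v.1 = t →
      ∃ i, ρ.par^[i] u.1 = t ∧ ρ.depth u.1 = ρ.depth t + i from this _ _ w rfl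
  intro u v w
  induction w with
  | nil => rintro rfl; exact ⟨0, rfl, rfl⟩
  | @cons u z v h w ih =>
    intro hv
    obtain ⟨i, hi, hd⟩ := ih hv
    rcases ρ.adj_par u.1 z.1 h with ⟨h1, h2⟩ | ⟨h1, h2⟩
    · refine ⟨i + 1, ?_, ?_⟩
      · rw [iterate_succ_apply, ← h2, hi]
      · rw [ρ.depth_eq _ h1, ← h2, hd]; rfl
    · cases i with
      -- Here `z` is `t`, so that `u` would be the parent of `t`, which is not in `X`.
      | zero =>
        rw [iterate_zero, id] at hi
        rw [hi] at h1 h2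
        exact (hp h1 (h2 ▸ u.2)).elim
      | succ i =>
        refine ⟨i, ?_, ?_⟩
        · rw [h2, ← iterate_succ_apply, hi]
        · have := ρ.depth_eq _ h1
          rw [← h2] at this
          omega

/-- Subtrees that meet pairwise have a common node. -/
theorem helly (ρ : Rooting T r) {ι : Type} (S : Finset ι) (hS : S.Nonempty) (X : ι → Set N)
    (hX : ∀ v, (T.induce (X v)).Preconnected) (hXX : ∀ u ∈ S, ∀ v ∈ S, (X u ∩ X v).Nonempty) :
    ∃ t, ∀ v ∈ S, t ∈ X v := by
  classical
  have hmin : ∀ v, ∃ m, v ∈ S → m ∈ X v ∧ ∀ t ∈ X v, ρ.depth m ≤ ρ.depth t := by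
    intro v
    by_cases hv : v ∈ S
    · obtain ⟨t, ht, -⟩ := hXX v hv v hv
      have hne : (ρ.depth '' X v).Nonempty := ⟨_, t, ht, rfl⟩
      obtain ⟨m, hm, hm'⟩ := Nat.sInf_mem hne
      exact ⟨m, fun _ => ⟨hm, fun t ht => hm' ▸ Nat.sInf_le ⟨t, ht, rfl⟩⟩⟩
    · exact ⟨r, fun h => (hv h).elim⟩
  choose m hm using hmin
  -- Among the topmost nodes of the subtrees a deepest one, `m v`, is common to all. Indeed, from a
  -- common node of `X u` and `X v` one can climb to `m v` without leaving `X u`, because `m u` is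
  -- not deeper than `m v`.
  obtain ⟨v, hv, hmax⟩ := S.exists_max_image (fun v => ρ.depth (m v)) hS
  have hclosed : ∀ u ∈ S, ∀ t ∈ X u, ρ.depth (m u) < ρ.depth t → ρ.par t ∈ X u := by
    intro u hu t ht hd
    by_contra hp
    obtain ⟨i, -, hi⟩ := ρ.below (hX u) ht (fun _ => hp) _ (hm u hu).1
    omega
  have hbelow := ρ.below (hX v) (hm v hv).1 (fun hr hp => by
    have h1 := (hm v hv).2 _ hp
    have := ρ.depth_eq _ hr
    omega)
  refine ⟨m v, fun u hu => ?_⟩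
  obtain ⟨t, htu, htv⟩ := hXX u hu v hv
  obtain ⟨i, hi, hd⟩ := hbelow t htv
  have key : ∀ i t, t ∈ X u → t ∈ X v → ρ.par^[i] t = m v → ρ.depth t = ρ.depth (m v) + i →
      m v ∈ X u := by
    intro i
    induction i with
    | zero => exact fun t ht _ h _ => h ▸ ht
    | succ i ih =>
      intro t ht ht' hi hd
      have h1 := hmax u hu
      have h2 := hclosed v hv t ht' (by omega)
      refine ih _ (hclosed u hu t ht (by omega)) h2 hi ?_
      obtain ⟨j, hj, hj'⟩ := hbelow _ h2
      have : t ≠ r := by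
        rintro rfl
        have hr := ρ.depth_root
        omega
      have := ρ.depth_eq t this
      omega
  exact key i t htu htv hi hd

end Rooting

end QBE

namespace QBE

open Function

/-! ### Queries of bounded treewidth and the pebble game -/

/-- Puts the values on a finite set into `m` slots; `e` fills the slots that are left over. -/
theorem exists_tuple {V C : Type} {m : ℕ} (s : Finset V) (hs : s.card ≤ m) (f : V → C) (e : C) :
    ∃ c : Fin m → C, (∀ v ∈ s, ∃ i, c i = f v) ∧ ∀ i, c i = e ∨ ∃ v ∈ s, c i = f v := by
  refine ⟨fun i => if hi : i.1 < s.toList.length then f s.toList[i.1] else e, fun v hv => ?_,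
    fun i => ?_⟩
  · obtain ⟨i, hi, h⟩ := List.getElem_of_mem (Finset.mem_toList.2 hv)
    have hi' : i < s.card := by rwa [Finset.length_toList] at hi
    exact ⟨⟨i, hi'.trans_le hs⟩, by simp only [hi, dif_pos, h]⟩
  · by_cases hi : i.1 < s.toList.length
    · exact Or.inr ⟨s.toList[i.1], Finset.mem_toList.1 (List.getElem_mem hi),
        by simp only [hi, dif_pos]⟩
    · exact Or.inl (dif_neg hi)

theorem adom_finite {σ : Schema} {C : Type} {D : Set (Atom σ C)} (hD : D.Finite) :
    (adom D).Finite := by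
  have : adom D = ⋃ A ∈ D, Set.range A.args := by
    ext c; simp [adom]
  rw [this]
  exact hD.biUnion fun A _ => Set.finite_range _

theorem mem_adom {σ : Schema} {C : Type} {D : Set (Atom σ C)} {A : Atom σ C} (hA : A ∈ D)
    (i : Fin (σ.arity A.rel)) : A.args i ∈ adom D := ⟨A, hA, i, rfl⟩

theorem Atom.adom_nonempty {σ : Schema} {C : Type} {D : Set (Atom σ C)} {A : Atom σ C}
    (hA : A ∈ D) : ∃ c, c ∈ adom D := ⟨_, mem_adom hA ⟨0, σ.arity_pos _⟩⟩

variable {σ : Schema} {n : ℕ}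

/-- The existential variables of an atom form a clique, so their subtrees of nodes meet pairwise; by
the Helly property these have a node in common. -/
theorem CQ.exists_bag (q : CQ σ n) (T : TreeDecomposition q.gaifman) {A : Atom σ ℕ}
    (hA : A ∈ q.atoms) :
    ∃ t, ∀ v : q.exVars, (∃ i, A.args i = v) → v ∈ T.bag t := by
  classical
  obtain ⟨r⟩ := T.isTree.connected.nonempty
  obtain ⟨ρ⟩ := exists_rooting T.isTree r
  have hfin : {v : q.exVars | ∃ i, A.args i = v}.Finite :=
    Set.Finite.preimage (f := Subtype.val) (s := Set.range A.args)
      Subtype.val_injective.injOn (Set.finite_range A.args)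
  by_cases hne : hfin.toFinset.Nonempty
  · obtain ⟨t, ht⟩ := ρ.helly hfin.toFinset hne (fun v => {t | v ∈ T.bag t})
      (fun v => (T.vertex_connected v).preconnected) (fun u hu v hv => by
        rw [Set.Finite.mem_toFinset] at hu hv
        by_cases huv : u = v
        · subst huv
          obtain ⟨t⟩ := (T.vertex_connected u).nonempty
          exact ⟨t, t.2, t.2⟩
        · exact T.edge_covered u v ⟨huv, A, hA, hu, hv⟩)
    exact ⟨t, fun v hv => ht v (hfin.mem_toFinset.2 hv)⟩
  · refine ⟨r, fun v hv => (hne ⟨v, hfin.mem_toFinset.2 hv⟩).elim⟩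

/-- The atom `A` has at most `k + 1` elements that are not among those of `a`. -/
def CoveredAtom {C : Type} (k : ℕ) (P : Set (Atom σ C)) (a : Fin n → C) (A : Atom σ C) : Prop :=
  A ∈ P ∧ ∃ c : Fin (k + 1) → C, (∀ i, c i ∈ adom P) ∧
    ∀ i, (∃ j, A.args i = c j) ∨ ∃ j, A.args i = a j

/-- There is a covered atom, and all members of `a` occur in covered atoms. -/
def Covered {C : Type} (k : ℕ) (P : Set (Atom σ C)) (a : Fin n → C) : Prop :=
  (∃ A, CoveredAtom k P a A) ∧ ∀ j, ∃ A, CoveredAtom k P a A ∧ ∃ i, A.args i = a j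

theorem CQ.mem_exVars_or (q : CQ σ n) {A : Atom σ ℕ} (hA : A ∈ q.atoms)
    (i : Fin (σ.arity A.rel)) : A.args i ∈ q.exVars ∨ ∃ j, q.head j = A.args i := by
  by_cases h : A.args i ∈ Set.range q.head
  · exact Or.inr h
  · exact Or.inl ⟨mem_adom hA i, h⟩

/-- The atoms of `q` are mapped to covered atoms: the existential variables of an atom lie in one
bag, and their images are the at most `k + 1` elements outside of `a`. -/
theorem covered_of_eval {C : Type} {k : ℕ} {P : Set (Atom σ C)} {a : Fin n → C} {q : CQ σ n}
    (hq : q ∈ TW k) (ha : a ∈ q.eval P) : Covered k P a := by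
  obtain ⟨T, hT⟩ := hq
  obtain ⟨h, hh, rfl⟩ := ha
  have key : ∀ A ∈ q.atoms, CoveredAtom k P (fun i => h (q.head i)) (A.map h) := by
    intro A hA
    refine ⟨hh A hA, ?_⟩
    obtain ⟨t, ht⟩ := q.exists_bag T hA
    obtain ⟨e, he⟩ := Atom.adom_nonempty (hh A hA)
    obtain ⟨c, hc, hc'⟩ := exists_tuple (T.bag t) (hT t) (fun v => h v) e
    refine ⟨c, fun i => ?_, fun i => ?_⟩
    · rcases hc' i with h1 | ⟨v, -, h1⟩
      · rwa [h1]
      · obtain ⟨B, hB, j, hj⟩ := v.2.1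
        rw [h1, ← hj]
        exact mem_adom (hh B hB) j
    · rcases q.mem_exVars_or hA i with h1 | ⟨j, hj⟩
      · obtain ⟨j, hj⟩ := hc ⟨_, h1⟩ (ht ⟨_, h1⟩ ⟨i, rfl⟩)
        exact Or.inl ⟨j, hj.symm⟩
      · exact Or.inr ⟨j, congrArg h hj.symm⟩
  obtain ⟨A, hA⟩ := q.atoms_nonempty
  refine ⟨⟨_, key A hA⟩, fun j => ?_⟩
  obtain ⟨A, hA, i, hi⟩ := q.head_mem j
  exact ⟨_, key A hA, i, congrArg h hi⟩

/-- The spoiler descends the tree decomposition with his pebbles on the images of the bag. The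
pebbles on variables shared by a node and its parent stay in place, so the answer for a variable is
the same on its whole subtree of nodes. Each atom has its existential variables in one bag and its
other variables in the head, so the position at that bag shows that the answers map the atom into
`D`. -/
theorem eval_of_pebbleWin {C C' : Type} {k : ℕ} {P : Set (Atom σ C)} {a : Fin n → C}
    {D : Set (Atom σ C')} {b : Fin n → C'} {q : CQ σ n} (hq : q ∈ TW k) (ha : a ∈ q.eval P)
    (hw : PebbleWin (k + 1) P a D b) : b ∈ q.eval D := by
  classical
  obtain ⟨T, hT⟩ := hq
  obtain ⟨h, hh, rfl⟩ := ha
  obtain ⟨W, hW, hW₀, hW₁⟩ := hw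
  obtain ⟨A₀, hA₀⟩ := q.atoms_nonempty
  obtain ⟨e, he⟩ := Atom.adom_nonempty (hh A₀ hA₀)
  obtain ⟨r⟩ := T.isTree.connected.nonempty
  obtain ⟨ρ⟩ := exists_rooting T.isTree r
  -- A state is a position together with a record of which pebble stands for which variable; it is
  -- good for `J` if the members of `J` have distinct pebbles, on their images under `h`.
  let S := (q.exVars → Fin (k + 1)) × ((Fin (k + 1) → C) × (Fin (k + 1) → C'))
  let good : Finset q.exVars → S → Prop := fun J s =>
    Set.InjOn s.1 J ∧ (∀ v ∈ J, s.2.1 (s.1 v) = h v) ∧ s.2 ∈ W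
  have hex : ∀ v : q.exVars, h v ∈ adom P := by
    rintro ⟨_, ⟨B, hB, j, rfl⟩, -⟩
    exact mem_adom (hh B hB) j
  have hmono : ∀ {J J' s}, J ⊆ J' → good J' s → good J s := fun hJ hs =>
    ⟨hs.1.mono (by simpa using hJ), fun v hv => hs.2.1 v (hJ hv), hs.2.2⟩
  have hadd : ∀ J s v, good J s → (insert v J).card ≤ k + 1 → ∃ s', good (insert v J) s' ∧
      ∀ u ∈ J, s'.2.2 (s'.1 u) = s.2.2 (s.1 u) := by
    intro J s v hs hJ
    by_cases hv : v ∈ J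
    · exact ⟨s, by rwa [Finset.insert_eq_of_mem hv], fun _ _ => rfl⟩
    rw [Finset.card_insert_of_notMem hv] at hJ
    -- At most `k` of the `k + 1` pebbles are in use for `J`, so one is free for `v`.
    obtain ⟨i, hi⟩ : ∃ i, i ∉ J.image s.1 := by
      by_contra! hi
      have h1 : (Finset.univ : Finset (Fin (k + 1))) ⊆ J.image s.1 := fun i _ => hi i
      have h2 := (Finset.card_le_card h1).trans Finset.card_image_le
      simp at h2
      omega
    have hne : ∀ u ∈ J, s.1 u ≠ i := fun u hu h1 => hi (Finset.mem_image.2 ⟨u, hu, h1⟩)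
    have hnv : ∀ u ∈ J, u ≠ v := fun u hu h1 => hv (h1 ▸ hu)
    obtain ⟨d, -, hd⟩ := hW₁ s.2 hs.2.2 i (h v) (hex v)
    refine ⟨⟨update s.1 v i, update s.2.1 i (h v), update s.2.2 i d⟩, ⟨?_, ?_, hd⟩, ?_⟩
    · intro u hu w hw huw
      simp only [Finset.coe_insert, Set.mem_insert_iff, Finset.mem_coe] at hu hw
      dsimp only at huw
      rcases hu with rfl | hu <;> rcases hw with rfl | hw
      · rfl
      · rw [update_self, update_of_ne (hnv w hw)] at huw
        exact (hne w hw huw.symm).elim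
      · rw [update_self, update_of_ne (hnv u hu)] at huw
        exact (hne u hu huw).elim
      · rw [update_of_ne (hnv u hu), update_of_ne (hnv w hw)] at huw
        exact hs.1 hu hw huw
    · intro u hu
      rcases Finset.mem_insert.1 hu with rfl | hu
      · simp
      · simp [update_of_ne (hnv u hu), update_of_ne (hne u hu), hs.2.1 u hu]
    · intro u hu
      simp [update_of_ne (hnv u hu), update_of_ne (hne u hu)]
  have hunion : ∀ J' J s, good J s → (J ∪ J').card ≤ k + 1 → ∃ s', good (J ∪ J') s' ∧
      ∀ u ∈ J, s'.2.2 (s'.1 u) = s.2.2 (s.1 u) := by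
    intro J'
    induction J' using Finset.induction_on with
    | empty => exact fun J s hs _ => ⟨s, by simpa using hs, fun _ _ => rfl⟩
    | insert v J' _ ih =>
      intro J s hs hJ
      rw [Finset.union_insert] at hJ ⊢
      obtain ⟨s', hs', h1⟩ := ih J s hs
        ((Finset.card_le_card (Finset.subset_insert _ _)).trans hJ)
      obtain ⟨s'', hs'', h2⟩ := hadd _ s' v hs' hJ
      exact ⟨s'', hs'', fun u hu => (h2 u (Finset.mem_union_left _ hu)).trans (h1 u hu)⟩
  obtain ⟨F, hF, hcon⟩ := ρ.exists_states (S := S) (inv := fun t s => good (T.bag t) s)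
    (con := fun t s s' => ∀ u ∈ T.bag (ρ.par t) ∩ T.bag t, s'.2.2 (s'.1 u) = s.2.2 (s.1 u))
    (by
      -- In the first round all pebbles go to an arbitrary element `e`; then they are moved one by
      -- one to the bag of the root.
      obtain ⟨d, -, hd⟩ := hW₀ (fun _ => e) fun _ => he
      obtain ⟨s, hs, -⟩ := hunion (T.bag r) ∅ ⟨fun _ => 0, _, d⟩
        ⟨by simp, by simp, hd⟩ (by simpa using hT r)
      exact ⟨s, by simpa using hs⟩)
    -- On the way to a child, the pebbles of the variables that it does not share with its parent
    -- are released and used again.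
    (fun t ht s hs => by
      have h1 : T.bag (ρ.par t) ∩ T.bag t ∪ T.bag t = T.bag t :=
        Finset.union_eq_right.2 Finset.inter_subset_right
      obtain ⟨s', hs', h2⟩ := hunion (T.bag t) _ s (hmono Finset.inter_subset_left hs)
        (h1.symm ▸ hT t)
      exact ⟨s', by rwa [h1] at hs', h2⟩)
  let val : T.node → q.exVars → C' := fun t v => (F t).2.2 ((F t).1 v)
  have hval : ∀ v t t', v ∈ T.bag t → v ∈ T.bag t' → val t v = val t' v := by
    intro v t t' ht ht'
    obtain ⟨w⟩ := (T.vertex_connected v).preconnected ⟨t, ht⟩ ⟨t', ht'⟩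
    suffices ∀ (x y : {t | v ∈ T.bag t}), (T.tree.induce {t | v ∈ T.bag t}).Walk x y →
        val x v = val y v from this _ _ w
    intro x y w
    induction w with
    | nil => rfl
    | @cons x z y hxz w ih =>
      rw [← ih]
      rcases ρ.adj_par x.1 z.1 hxz with ⟨h1, h2⟩ | ⟨h1, h2⟩
      · rw [h2]
        exact hcon _ h1 v (Finset.mem_inter.2 ⟨h2 ▸ z.2, x.2⟩)
      · rw [h2]
        exact (hcon _ h1 v (Finset.mem_inter.2 ⟨h2 ▸ x.2, z.2⟩)).symm
  have hnode : ∀ v, ∃ t, v ∈ T.bag t := fun v =>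
    let ⟨t⟩ := (T.vertex_connected v).nonempty
    ⟨t.1, t.2⟩
  choose node hnode using hnode
  -- The last case concerns numbers that are not variables of `q`; their value is immaterial.
  let g : ℕ → C' := fun x => if hx : x ∈ q.exVars then val (node ⟨x, hx⟩) ⟨x, hx⟩ else
    if hj : ∃ j, q.head j = x then b hj.choose else (F r).2.2 0
  have hg : ∀ v t, v ∈ T.bag t → g v.1 = (F t).2.2 ((F t).1 v) := fun v t ht => by
    simp only [g, v.2, dif_pos]
    exact hval _ _ _ (hnode v) ht
  have hg' : ∀ j, g (q.head j) = b j := fun j => by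
    have h1 : q.head j ∉ q.exVars := fun h1 => h1.2 ⟨j, rfl⟩
    have h2 : ∃ j', q.head j' = q.head j := ⟨j, rfl⟩
    simp only [g, h1, h2, dif_pos, dif_neg, not_false_eq_true]
    -- A variable may occur several times in the head; the chosen occurrence does not matter because
    -- positions in `W` include the well-defined assignment of `b` to the distinguished tuple.
    exact (hW _ (hF r).2.2).1 (Sum.inr h2.choose) (Sum.inr j) (congrArg h h2.choose_spec)
  refine ⟨g, fun A hA => ?_, funext fun j => (hg' j).symm⟩
  obtain ⟨t, ht⟩ := q.exists_bag T hA
  -- At the node `t` every entry of `A` is either under a pebble or among the distinguished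
  -- elements.
  have hpos : ∀ i, ∃ p : Fin (k + 1) ⊕ Fin n,
      Sum.elim (F t).2.1 (fun i => h (q.head i)) p = h (A.args i) ∧
      Sum.elim (F t).2.2 b p = g (A.args i) := by
    intro i
    rcases q.mem_exVars_or hA i with h1 | ⟨j, hj⟩
    · have h2 := ht ⟨_, h1⟩ ⟨i, rfl⟩
      exact ⟨Sum.inl ((F t).1 ⟨_, h1⟩), (hF t).2.1 _ h2, (hg ⟨_, h1⟩ t h2).symm⟩
    · exact ⟨Sum.inr j, congrArg h hj, by rw [← hj, hg' j]; rfl⟩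
  choose p hp hp' using hpos
  have h1 := (hW _ (hF t).2.2).2 A.rel p
  simp only [hp, hp'] at h1
  exact h1 (hh A hA)

end QBE

namespace QBE

open Function

/-! ### The tree of lists of bounded length -/

/-- The tree on the lists of length at most `M`, rooted in the empty list. -/
def listTree (α : Type) (M : ℕ) : SimpleGraph {l : List α // l.length ≤ M} where
  Adj s t := (∃ x, s.1 = x :: t.1) ∨ ∃ x, t.1 = x :: s.1
  symm := ⟨fun _ _ h => h.symm⟩
  loopless := ⟨fun s h => by
    rcases h with ⟨x, h⟩ | ⟨x, h⟩ <;> simpa using congrArg List.length h⟩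

theorem listTree_reachable {α : Type} {M : ℕ} : ∀ (l : List α) (hl : l.length ≤ M),
    (listTree α M).Reachable ⟨l, hl⟩ ⟨[], Nat.zero_le _⟩
  | [], _ => SimpleGraph.Reachable.refl _
  | x :: l, hl => by
    have hl' : l.length ≤ M := (Nat.le_succ _).trans hl
    have : (listTree α M).Adj ⟨x :: l, hl⟩ ⟨l, hl'⟩ := Or.inl ⟨x, rfl⟩
    exact this.reachable.trans (listTree_reachable l hl')

/-- Every edge is a bridge: once the edge between `s = x :: t` and `t` is deleted, a walk that
starts in `s` only meets lists with `s` as a suffix, and `t` is too short for that. -/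
theorem listTree_isTree (α : Type) (M : ℕ) : (listTree α M).IsTree := by
  have : Nonempty {l : List α // l.length ≤ M} := ⟨⟨[], Nat.zero_le _⟩⟩
  refine ⟨⟨fun s t => (listTree_reachable s.1 s.2).trans (listTree_reachable t.1 t.2).symm⟩, ?_⟩
  rw [SimpleGraph.isAcyclic_iff_forall_adj_isBridge]
  have key : ∀ s t : {l : List α // l.length ≤ M}, (∃ x, s.1 = x :: t.1) →
      ¬((listTree α M).deleteEdges {s(s, t)}).Reachable s t := by
    rintro s t ⟨x, hx⟩ ⟨w⟩
    have hsuf : ∀ u v (w : ((listTree α M).deleteEdges {s(s, t)}).Walk u v),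
        s.1 <:+ u.1 → s.1 <:+ v.1 := by
      intro u v w
      induction w with
      | nil => exact fun h => h
      | @cons u z v h w ih =>
        intro hu
        refine ih ?_
        rw [SimpleGraph.deleteEdges_adj] at h
        rcases h.1 with ⟨y, hy⟩ | ⟨y, hy⟩
        · rw [hy, List.suffix_cons_iff] at hu
          rcases hu with hu | hu
          · rw [hx, List.cons.injEq] at hu
            have h1 : u = s := Subtype.ext (by rw [hy, hx, hu.1, hu.2])
            have h2 : z = t := Subtype.ext hu.2.symm
            exact (h.2 (by rw [h1, h2]; rfl)).elim
          · exact hu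
        · rw [hy]
          exact hu.trans (List.suffix_cons _ _)
    have := (hsuf s t w (List.suffix_refl _)).length_le
    rw [hx] at this
    simp at this
  intro s t hst
  rw [SimpleGraph.isBridge_iff]
  rcases hst with h | h
  · exact key s t h
  · intro h1
    refine key t s h ?_
    rw [Sym2.eq_swap]
    exact h1.symm

/-! ### Unravelling a database -/

section Unravel

variable {ι E : Type}

/-- The elements of the last tuple. -/
def current : List (ι → E) → Set E
  | [] => ∅
  | x :: _ => Set.range x

open Classical in
/-- The initial segment in which the element `e` of the last tuple was introduced. -/
noncomputable def origin : List (ι → E) → E → List (ι → E)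
  | [], _ => []
  | x :: l, e => if e ∈ current l then origin l e else x :: l

theorem length_origin_le : ∀ (l : List (ι → E)) (e : E), (origin l e).length ≤ l.length
  | [], _ => le_rfl
  | x :: l, e => by
    unfold origin
    split_ifs
    · exact (length_origin_le l e).trans (Nat.le_succ _)
    · exact le_rfl

/-- The origin serves as a canonical name for the histories through which `e` has stayed under a
pebble: it belongs to them itself, and this makes the nodes of a variable connected. -/
theorem origin_spec : ∀ (l : List (ι → E)) (e : E), e ∈ current l →
    e ∈ current (origin l e) ∧ origin (origin l e) e = origin l e
  | [], _, h => h.elim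
  | x :: l, e, h => by
    by_cases he : e ∈ current l
    · have : origin (x :: l) e = origin l e := if_pos he
      rw [this]
      exact origin_spec l e he
    · have : origin (x :: l) e = x :: l := if_neg he
      rw [this]
      exact ⟨h, this⟩

variable {n : ℕ} (a : Fin n → E)

open Classical in
/-- The variable that stands for the element `e` at the node `l`. -/
noncomputable def variableAt (l : List (ι → E)) (e : E) : Option (List (ι → E)) × E :=
  if e ∈ Set.range a then (none, e) else (some (origin l e), e)

theorem variableAt_snd (l : List (ι → E)) (e : E) : (variableAt a l e).2 = e := by
  unfold variableAt; split_ifs <;> rfl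

theorem variableAt_head (l : List (ι → E)) (j : Fin n) : variableAt a l (a j) = (none, a j) :=
  if_pos ⟨j, rfl⟩

/-- An element that was present before the last placement keeps its variable. This is what makes the
answers of a homomorphism consistent from one round to the next. -/
theorem variableAt_cons {l : List (ι → E)} {e : E} (he : e ∈ current l) (x : ι → E) :
    variableAt a (x :: l) e = variableAt a l e := by
  simp [variableAt, origin, he]

end Unravel

instance {σ : Schema} {E : Type} [Finite E] : Finite (Atom σ E) :=
  Finite.of_injective (fun A : Atom σ E => (⟨A.rel, A.args⟩ : Σ R, Fin (σ.arity R) → E))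
    fun A B h => by
      cases A; cases B
      simpa using h

section

variable {σ : Schema} {n k : ℕ} {C : Type} {P : Set (Atom σ C)}

/-- The atoms of the unravelling, at all nodes. -/
def unravelAtoms (k M : ℕ) (P : Set (Atom σ C)) (a : Fin n → adom P)
    (ν : Option (List (Fin (k + 1) → adom P)) × adom P → ℕ) : Set (Atom σ ℕ) :=
  {B | ∃ l : List (Fin (k + 1) → adom P), l.length ≤ M ∧ ∃ A : Atom σ (adom P),
    A.map Subtype.val ∈ P ∧ (∀ i, A.args i ∈ current l ∨ A.args i ∈ Set.range a) ∧
    B = A.map fun e => ν (variableAt a l e)}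

theorem unravelAtoms_finite [Finite (adom P)] (M : ℕ) (a : Fin n → adom P)
    (ν : Option (List (Fin (k + 1) → adom P)) × adom P → ℕ) :
    (unravelAtoms k M P a ν).Finite := by
  have h1 : {l : List (Fin (k + 1) → adom P) | l.length ≤ M}.Finite := List.finite_length_le _ _
  refine ((h1.prod (Set.finite_univ (α := Atom σ (adom P)))).image
    fun p => p.2.map fun e => ν (variableAt a p.1 e)).subset ?_
  rintro B ⟨l, hl, A, -, -, rfl⟩
  exact ⟨(l, A), ⟨hl, trivial⟩, rfl⟩

/-- The unravelling of a database as a query. -/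
def unravel (k M : ℕ) (P : Set (Atom σ C)) [Finite (adom P)] (a : Fin n → adom P)
    (ν : Option (List (Fin (k + 1) → adom P)) × adom P → ℕ)
    (h₀ : (unravelAtoms k M P a ν).Nonempty)
    (h₁ : ∀ j, ν (none, a j) ∈ adom (unravelAtoms k M P a ν)) : CQ σ n where
  atoms := unravelAtoms k M P a ν
  atoms_finite := unravelAtoms_finite M a ν
  atoms_nonempty := h₀
  head j := ν (none, a j)
  head_mem := h₁

variable [Finite (adom P)] {M : ℕ} {a : Fin n → adom P}
  {ν : Option (List (Fin (k + 1) → adom P)) × adom P → ℕ}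
  {h₀ : (unravelAtoms k M P a ν).Nonempty}
  {h₁ : ∀ j, ν (none, a j) ∈ adom (unravelAtoms k M P a ν)}

/-- The names with `none` belong to the head, so an existential variable must come from a pebble. -/
theorem unravel_exVars (v : (unravel k M P a ν h₀ h₁).exVars) {l : List (Fin (k + 1) → adom P)}
    {e : adom P} (hv : ν (variableAt a l e) = v) (he : e ∈ current l ∨ e ∈ Set.range a) :
    e ∈ current l ∧ ν (some (origin l e), e) = v := by
  have h : e ∉ Set.range a := by
    rintro ⟨j, rfl⟩
    rw [variableAt_head] at hv
    exact v.2.2 ⟨j, hv⟩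
  refine ⟨he.resolve_right h, ?_⟩
  rw [← hv, variableAt, if_neg h]

/-- The tree of histories is the decomposition, and the bag of a history holds the variables of its
last `k + 1` pebbled elements. As `ν` is injective, a variable determines its element and its
origin; the nodes that carry it are connected since each can be shortened, one placement at a time,
to the origin. -/
theorem unravel_mem_TW (hν : Injective ν) : unravel k M P a ν h₀ h₁ ∈ TW k := by
  classical
  let q := unravel k M P a ν h₀ h₁
  let bag : List (Fin (k + 1) → adom P) → Set q.exVars := fun l =>
    {v | ∃ e ∈ current l, ν (some (origin l e), e) = v}
  have hbag : ∀ l, ∃ B : Finset q.exVars, B.card ≤ k + 1 ∧ ∀ v, v ∈ B ↔ v ∈ bag l := by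
    intro l
    cases l with
    | nil =>
      refine ⟨∅, by simp, fun v => ⟨by simp, ?_⟩⟩
      rintro ⟨e, he, -⟩
      exact he.elim
    | cons x l =>
      let S : Finset ℕ := Finset.univ.image fun i => ν (some (origin (x :: l) (x i)), x i)
      refine ⟨S.subtype (· ∈ q.exVars), ?_, fun v => ?_⟩
      · rw [Finset.card_subtype]
        refine (Finset.card_filter_le _ _).trans (Finset.card_image_le.trans ?_)
        simp
      · rw [Finset.mem_subtype]
        simp only [S, Finset.mem_image, Finset.mem_univ, true_and]
        constructor
        · rintro ⟨i, hi⟩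
          exact ⟨x i, ⟨i, rfl⟩, hi⟩
        · rintro ⟨_, ⟨i, rfl⟩, hi⟩
          exact ⟨i, hi⟩
  choose B hB hB' using hbag
  have hmem : ∀ (v : q.exVars), ∃ l e, l.length ≤ M ∧ e ∈ current l ∧
      ν (some (origin l e), e) = v := by
    rintro ⟨_, ⟨A', ⟨l, hl, A, hA, hA', rfl⟩, i, rfl⟩, hv⟩
    obtain ⟨h2, h3⟩ := unravel_exVars (h₀ := h₀) (h₁ := h₁) ⟨_, ⟨_, ⟨l, hl, A, hA, hA', rfl⟩, i, rfl⟩, hv⟩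
      (l := l) (e := A.args i) rfl (hA' i)
    exact ⟨l, _, hl, h2, h3⟩
  refine ⟨⟨{l : List (Fin (k + 1) → adom P) // l.length ≤ M}, List.finite_length_le _ _,
    listTree _ M, listTree_isTree _ M, fun t => B t.1, fun v => ?_, fun u v huv => ?_⟩,
    fun t => hB _⟩
  · obtain ⟨l, e, hl, he, hv⟩ := hmem v
    have hiff : ∀ t, v ∈ B t ↔ e ∈ current t ∧ origin t e = origin l e := by
      intro t
      rw [hB']
      constructor
      · rintro ⟨e', he', h'⟩
        have h2 := hν (h'.trans hv.symm)
        simp only [Prod.mk.injEq, Option.some.injEq] at h2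
        obtain ⟨h2, rfl⟩ := h2
        exact ⟨he', h2⟩
      · rintro ⟨h2, h3⟩
        exact ⟨e, h2, by rw [h3, hv]⟩
    have hs := origin_spec l e he
    have hsl : (origin l e).length ≤ M := (length_origin_le l e).trans hl
    have hs' : v ∈ B (origin l e) := (hiff _).2 hs
    have key : ∀ t (ht : t.length ≤ M) (hv : v ∈ B t),
        ((listTree (Fin (k + 1) → adom P) M).induce
          {t : {l : List (Fin (k + 1) → adom P) // l.length ≤ M} | v ∈ B t.1}).Reachable
          ⟨⟨t, ht⟩, hv⟩ ⟨⟨origin l e, hsl⟩, hs'⟩ := by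
      intro t
      induction t with
      | nil => exact fun ht hv => (((hiff _).1 hv).1).elim
      | cons x t ih =>
        intro ht hv
        obtain ⟨h2, h3⟩ := (hiff _).1 hv
        -- If `e` was present one placement earlier, the shorter history carries `v` as well;
        -- otherwise the history is the origin already.
        by_cases he' : e ∈ current t
        · have h4 : origin (x :: t) e = origin t e := if_pos he'
          have hv' : v ∈ B t := (hiff _).2 ⟨he', h4 ▸ h3⟩
          refine SimpleGraph.Reachable.trans (SimpleGraph.Adj.reachable ?_)
            (ih ((Nat.le_succ _).trans ht) hv')
          exact Or.inl ⟨x, rfl⟩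
        · have h4 : origin (x :: t) e = x :: t := if_neg he'
          have h5 : (⟨⟨x :: t, ht⟩, hv⟩ : {t : {l : List (Fin (k + 1) → adom P) //
              l.length ≤ M} | v ∈ B t.1}) = ⟨⟨origin l e, hsl⟩, hs'⟩ :=
            Subtype.ext (Subtype.ext (h4.symm.trans h3))
          rw [h5]
    have : Nonempty {t : {l : List (Fin (k + 1) → adom P) // l.length ≤ M} | v ∈ B t.1} :=
      ⟨⟨⟨_, hsl⟩, hs'⟩⟩
    exact ⟨fun s t => (key s.1.1 s.1.2 s.2).trans (key t.1.1 t.1.2 t.2).symm⟩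
  · obtain ⟨-, A', ⟨l, hl, A, hA, hA', rfl⟩, ⟨i, hi⟩, ⟨j, hj⟩⟩ := huv
    have h2 := unravel_exVars u hi (hA' i)
    have h3 := unravel_exVars v hj (hA' j)
    exact ⟨⟨l, hl⟩, (hB' _ _).2 ⟨_, h2⟩, (hB' _ _).2 ⟨_, h3⟩⟩

theorem eval_unravel (hν : Injective ν) :
    (fun j => (a j : C)) ∈ (unravel k M P a ν h₀ h₁).eval P := by
  obtain ⟨B, hB⟩ := h₀
  obtain ⟨A, hA⟩ : ∃ A, A ∈ P := by
    obtain ⟨_, _, A, hA, -⟩ := hB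
    exact ⟨_, hA⟩
  obtain ⟨e, -⟩ := Atom.adom_nonempty hA
  -- Every variable is sent to the element it stands for; `e` is a dummy value for numbers that name
  -- no variable.
  refine ⟨extend ν (fun v => v.2.1) fun _ => e, ?_, funext fun j => ?_⟩
  · rintro _ ⟨l, hl, A, hA, -, rfl⟩
    convert hA using 1
    simp [Atom.map, hν.extend_apply, variableAt_snd]
  · exact (hν.extend_apply (fun v => v.2.1) (fun _ => e) (none, a j)).symm

/-- A homomorphism of the unravelling is a strategy: after the history `l` a pebble on `e` is
answered by the value of the variable of `e` at `l`. This works while the history has length at most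
`M`; the first placement takes one unit, which leaves room for `m` moves. -/
theorem stage_of_eval_unravel {C' : Type} {D : Set (Atom σ C')} {b : Fin n → C'}
    (hb : b ∈ (unravel k M P a ν h₀ h₁).eval D) {m : ℕ} (hm : m + 1 ≤ M)
    (c : Fin (k + 1) → C) (hc : ∀ i, c i ∈ adom P) :
    ∃ d, (c, d) ∈ stage (k + 1) P (fun j => (a j : C)) D b m := by
  classical
  obtain ⟨g, hg, rfl⟩ := hb
  obtain ⟨B, hB⟩ := id h₀
  obtain ⟨d₀, hd₀⟩ := Atom.adom_nonempty (hg B hB)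
  have hgD : ∀ v ∈ adom (unravelAtoms k M P a ν), g v ∈ adom D := by
    rintro _ ⟨A, hA, i, rfl⟩
    exact mem_adom (hg A hA) i
  -- A pebbled element need not occur in an atom of the unravelling at its node. Its variable may
  -- then have a value outside of `D`, which is replaced by `d₀`.
  let G : List (Fin (k + 1) → adom P) → adom P → C' := fun l e =>
    if g (ν (variableAt a l e)) ∈ adom D then g (ν (variableAt a l e)) else d₀
  have hGD : ∀ l e, G l e ∈ adom D := fun l e => by
    simp only [G]; split_ifs with h <;> assumption
  have hG : ∀ l e, ν (variableAt a l e) ∈ adom (unravelAtoms k M P a ν) →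
      G l e = g (ν (variableAt a l e)) := fun l e h => if_pos (hgD _ h)
  have hpos : ∀ x l, (x :: l).length ≤ M → ((fun i => ((x i : adom P) : C)),
      fun i => G (x :: l) (x i)) ∈ stage (k + 1) P (fun j => (a j : C)) D
        (fun j => g ((unravel k M P a ν h₀ h₁).head j)) 0 := by
    intro x l hl
    have hs : ∀ p : Fin (k + 1) ⊕ Fin n, Sum.elim (fun i => ((x i : adom P) : C))
        (fun j => (a j : C)) p = (Sum.elim x a p : adom P) := by
      rintro (i | j) <;> rfl
    have ht : ∀ p : Fin (k + 1) ⊕ Fin n, Sum.elim (fun i => G (x :: l) (x i))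
        (fun j => g ((unravel k M P a ν h₀ h₁).head j)) p = G (x :: l) (Sum.elim x a p) := by
      rintro (i | j)
      · rfl
      · have : variableAt a (x :: l) (a j) = (none, a j) := variableAt_head ..
        have h2 : G (x :: l) (a j) = g (ν (variableAt a (x :: l) (a j))) :=
          hG _ _ (by rw [this]; exact h₁ j)
        rw [this] at h2
        exact h2.symm
    refine ⟨fun i => (x i).2, fun i => hGD _ _, fun p p' h => ?_, fun R f hR => ?_⟩
    · rw [hs, hs] at h
      dsimp only
      rw [ht, ht, Subtype.ext h]
    · dsimp only at hR ⊢
      simp only [hs] at hR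
      simp only [ht]
      have hA : (⟨R, fun i => Sum.elim x a (f i)⟩ : Atom σ (adom P)).map (fun e =>
          ν (variableAt a (x :: l) e)) ∈ unravelAtoms k M P a ν := by
        refine ⟨x :: l, hl, ⟨R, fun i => Sum.elim x a (f i)⟩, hR, fun i => ?_, rfl⟩
        dsimp only
        rcases f i with i | j
        · exact Or.inl ⟨i, rfl⟩
        · exact Or.inr ⟨j, rfl⟩
      have h2 := hg _ hA
      convert h2 using 1
      simp only [Atom.map, Atom.mk.injEq, heq_eq_eq, true_and]
      funext i
      exact hG _ _ (mem_adom hA i)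
  have key : ∀ m x l, (x :: l).length + m ≤ M → ((fun i => ((x i : adom P) : C)),
      fun i => G (x :: l) (x i)) ∈ stage (k + 1) P (fun j => (a j : C)) D
        (fun j => g ((unravel k M P a ν h₀ h₁).head j)) m := by
    intro m
    induction m with
    | zero => exact fun x l hl => hpos x l hl
    | succ m ih =>
      intro x l hl
      refine ⟨ih x l (by omega), fun i c hc => ?_⟩
      have h2 := ih (update x i ⟨c, hc⟩) (x :: l) (by simp at hl ⊢; omega)
      refine ⟨_, hGD (update x i ⟨c, hc⟩ :: x :: l) ⟨c, hc⟩, ?_⟩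
      convert h2 using 2
      · funext j
        by_cases hj : j = i
        · subst hj; simp
        · simp [hj]
      · funext j
        by_cases hj : j = i
        · subst hj; simp
        -- The pebbles that did not move keep their variables, hence their answers.
        · have : variableAt a (update x i ⟨c, hc⟩ :: x :: l) (x j) = variableAt a (x :: l) (x j) :=
            variableAt_cons a (show x j ∈ Set.range x from ⟨j, rfl⟩) _
          simp [hj, G, this]
  exact ⟨_, key m (fun i => ⟨c i, hc i⟩) [] (by simp; omega)⟩

end

/-- The query is an unravelling deep enough for the stages of all games from `P` to `D` with
parameter `a` to have become stationary; thus one query serves for all `b`. -/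
theorem exists_query {σ : Schema} {n k : ℕ} {C C' : Type} {P : Set (Atom σ C)} {a : Fin n → C}
    {D : Set (Atom σ C')} (hP : P.Finite) (hD : D.Finite) (hcov : Covered k P a) :
    ∃ q : CQ σ n, q ∈ TW k ∧ a ∈ q.eval P ∧ ∀ b ∈ q.eval D, PebbleWin (k + 1) P a D b := by
  have hfin := adom_finite hP
  have : Finite (adom P) := hfin
  have ha : ∀ j, a j ∈ adom P := fun j => by
    obtain ⟨A, hA, i, hi⟩ := hcov.2 j
    exact hi ▸ mem_adom hA.1 i
  obtain ⟨ν, hν⟩ := exists_injective_nat (Option (List (Fin (k + 1) → adom P)) × adom P)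
  have hX := finite_positions (k := k + 1) hfin (adom_finite hD)
  -- No stage has more than `N` members. The depth `N + 1` used below provides for the first
  -- placement and `N` moves.
  set N := ((Set.univ.pi fun _ : Fin (k + 1) => adom P) ×ˢ
      (Set.univ.pi fun _ : Fin (k + 1) => adom D)).ncard with hN
  let a' : Fin n → adom P := fun j => ⟨a j, ha j⟩
  -- A covered atom occurs in the unravelling after the single placement of the pebbles on `c`;
  -- hence there is an atom, and the head occurs in atoms.
  have hatom : ∀ A, CoveredAtom k P a A → ∃ A' : Atom σ (adom P), A'.map Subtype.val = A ∧
      ∃ l, A'.map (fun e => ν (variableAt a' l e)) ∈ unravelAtoms k (N + 1) P a' ν := by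
    rintro A ⟨hA, c, hc, hA'⟩
    refine ⟨⟨A.rel, fun i => ⟨A.args i, mem_adom hA i⟩⟩, rfl, [fun i => ⟨c i, hc i⟩],
      [fun i => ⟨c i, hc i⟩], ?_, ⟨A.rel, fun i => ⟨A.args i, mem_adom hA i⟩⟩,
      hA, fun i => ?_, rfl⟩
    · simp
    · rcases hA' i with ⟨j, hj⟩ | ⟨j, hj⟩
      · exact Or.inl ⟨j, Subtype.ext hj.symm⟩
      · exact Or.inr ⟨j, Subtype.ext hj.symm⟩
  have h₀ : (unravelAtoms k (N + 1) P a' ν).Nonempty := by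
    obtain ⟨A, hA⟩ := hcov.1
    obtain ⟨A', -, l, hl⟩ := hatom A hA
    exact ⟨_, hl⟩
  have h₁ : ∀ j, ν (none, a' j) ∈ adom (unravelAtoms k (N + 1) P a' ν) := by
    intro j
    obtain ⟨A, hA, i, hi⟩ := hcov.2 j
    obtain ⟨A', rfl, l, hl⟩ := hatom A hA
    have : A'.args i = a' j := Subtype.ext hi
    exact ⟨_, hl, i, by rw [← variableAt_head a' l j, ← this]; rfl⟩
  refine ⟨unravel k (N + 1) P a' ν h₀ h₁, unravel_mem_TW hν, eval_unravel hν, fun b hb => ?_⟩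
  refine pebbleWin_of_stage (stage_stationary (hX.subset stage_zero_subset) (N := N)
    (Set.ncard_le_ncard stage_zero_subset hX)) fun c hc => stage_of_eval_unravel hb le_rfl c hc

end QBE

namespace QBE

open Function

namespace Poly

variable {α β γ : Type} [Data α] [Data β] [Data γ]

@[fun_prop]
theorem vcons {f g : α → V} (hf : Poly f) (hg : Poly g) : Poly fun a => V.cons (f a) (g a) :=
  (of_enc (f := fun p : V × V => V.cons p.1 p.2) (fun _ => rfl)
    (PolyBound.size.mono fun p => by simp)).comp (hf.pair hg)

/-- Folds in which the size of the accumulator grows by a multiple of the size of the entry. -/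
theorem foldl_of_size_le {l : α → List β} {c₀ : α → γ} {g : α → γ → β → γ} (K : ℕ) (hl : Poly l)
    (h₀ : Poly c₀) (hg : Poly fun p : α × (β × γ) => g p.1 p.2.2 p.2.1)
    (hb : ∀ a c b, Data.size (g a c b) ≤ Data.size c + K * (Data.size b + 1)) :
    Poly fun a => (l a).foldl (g a) (c₀ a) := by
  have key : ∀ a (l' : List β), Data.size (l'.foldl (g a) (c₀ a)) ≤
      Data.size (c₀ a) + K * Data.size l' := fun a l' => by
    induction l' using List.reverseRecOn with
    | nil => simp
    | append_singleton l' b ih =>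
      rw [List.foldl_append, List.foldl_cons, List.foldl_nil]
      refine (hb a _ b).trans ?_
      have h1 := size_append l' [b]
      simp only [size_list_cons, size_list_nil] at h1
      have h2 : Data.size (l' ++ [b]) = Data.size l' + (Data.size b + 1) := by omega
      rw [h2, Nat.mul_add K (Data.size l')]
      omega
  refine foldl hl h₀ hg (h₀.size.add ((PolyBound.const K).mul hl.size)) fun a l₁ l₂ h =>
    (key a l₁).trans ?_
  rw [h]
  exact Nat.add_le_add_left (Nat.mul_le_mul_left _
    (size_le_of_sublist (List.sublist_append_left _ _))) _

end Poly

/-! ### The algorithm on lists -/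

/-- Remove repetitions. -/
def distinct {α : Type} [DecidableEq α] (l : List α) : List α :=
  l.foldl (fun acc a => if a ∈ acc then acc else a :: acc) []

theorem distinct_spec {α : Type} [DecidableEq α] (l : List α) :
    (distinct l).Nodup ∧ ∀ a, a ∈ distinct l ↔ a ∈ l := by
  unfold distinct
  induction l using List.reverseRecOn with
  | nil => simp
  | append_singleton l b ih =>
    rw [List.foldl_append, List.foldl_cons, List.foldl_nil]
    generalize List.foldl _ _ l = d at *
    split_ifs with h
    · refine ⟨ih.1, fun a => ?_⟩
      rw [List.mem_append, ih.2, List.mem_singleton]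
      exact ⟨Or.inl, fun h' => h'.elim (fun h' => h') fun h' => h' ▸ (ih.2 b).1 h⟩
    · refine ⟨List.nodup_cons.2 ⟨h, ih.1⟩, fun a => ?_⟩
      rw [List.mem_append, List.mem_cons, ih.2, List.mem_singleton, or_comm]

theorem distinct_map {α β : Type} [DecidableEq α] [DecidableEq β] {f : α → β}
    (hf : Injective f) (l : List α) : distinct (l.map f) = (distinct l).map f := by
  unfold distinct
  induction l using List.reverseRecOn with
  | nil => rfl
  | append_singleton l b ih =>
    rw [List.map_append, List.foldl_append, List.foldl_append, ih]
    simp only [List.map_cons, List.map_nil, List.foldl_cons, List.foldl_nil,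
      List.mem_map_of_injective hf]
    split_ifs <;> rfl

@[fun_prop]
theorem Poly.distinct {α β : Type} [Data α] [Data β] [InjData β] [DecidableEq β] {l : α → List β}
    (hl : Poly l) : Poly fun a => QBE.distinct (l a) :=
  foldl_of_size_le 1 (g := fun _ acc a => if a ∈ acc then acc else a :: acc) hl (const [])
    (iteProp (by fun_prop) (by fun_prop) (by fun_prop)) fun a c b => by
      split_ifs
      · omega
      · simp; omega

/-- The codes of atoms: the relation symbol, and the list of the entries. -/
abbrev VAtom := V × List V

/-- The list of the elements of a database. -/
def elems (P : List VAtom) : List V := P.flatMap fun A => A.2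

@[fun_prop]
theorem Poly.elems {α : Type} [Data α] {P : α → List VAtom} (hP : Poly P) :
    Poly fun a => QBE.elems (P a) := by
  unfold QBE.elems; fun_prop

/-- Is the relation with the list `z` of pairs a partial homomorphism? -/
def isPHom (P D : List VAtom) (z : List (V × V)) : Bool :=
  (z.all fun p => z.all fun q => !decide (p.1 = q.1) || decide (p.2 = q.2)) &&
  P.all fun A => !(A.2.all fun x => z.any fun p => decide (p.1 = x)) ||
    D.any fun B => decide (B.1 = A.1) && (A.2.zip B.2).all fun p => decide (p ∈ z)

@[fun_prop]
theorem Poly.isPHom {α : Type} [Data α] {P D : α → List VAtom} {z : α → List (V × V)}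
    (hP : Poly P) (hD : Poly D) (hz : Poly z) : Poly fun a => QBE.isPHom (P a) (D a) (z a) := by
  have : Poly fun x : List VAtom × List VAtom × List (V × V) => QBE.isPHom x.1 x.2.1 x.2.2 := by
    unfold QBE.isPHom; fun_prop
  exact this.comp (hP.pair (hD.pair hz))

/-- The positions in which the duplicator is not lost. -/
def positions (k : ℕ) (P D : List VAtom) (a b : List V) : List (List (V × V)) :=
  (tuples k ((elems P).flatMap fun e => (elems D).map fun d => (e, d))).filter
    fun z => isPHom P D (z ++ a.zip b)

@[fun_prop]
theorem Poly.positions {α : Type} [Data α] (k : ℕ) {P D : α → List VAtom} {a b : α → List V}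
    (hP : Poly P) (hD : Poly D) (ha : Poly a) (hb : Poly b) :
    Poly fun x => QBE.positions k (P x) (D x) (a x) (b x) := by
  unfold QBE.positions; fun_prop

/-- The positions from which the duplicator can answer every move by a position of `W`. -/
def refineStep (k : ℕ) (P D : List VAtom) (W : List (List (V × V))) : List (List (V × V)) :=
  W.filter fun z => (List.range k).all fun i => (elems P).all fun e => (elems D).any fun d =>
    decide (z.set i (e, d) ∈ W)

@[fun_prop]
theorem Poly.refineStep {α : Type} [Data α] (k : ℕ) {P D : α → List VAtom}
    {W : α → List (List (V × V))} (hP : Poly P) (hD : Poly D) (hW : Poly W) :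
    Poly fun x => QBE.refineStep k (P x) (D x) (W x) := by
  have : Poly fun x : List VAtom × List VAtom × List (List (V × V)) =>
      QBE.refineStep k x.1 x.2.1 x.2.2 := by
    unfold QBE.refineStep
    refine filter (by fun_prop) (Poly.forall_lt (fun i => ?_) k)
    fun_prop
  exact this.comp (hP.pair (hD.pair hW))

/-- The result of the iteration of `refineStep`. -/
def winning (k : ℕ) (P D : List VAtom) (a b : List V) : List (List (V × V)) :=
  -- The list folded over is only a counter: it has at least as many entries as there are positions,
  -- enough for the iteration to become stationary.
  (positions k P D a b).foldl (fun W _ => refineStep k P D W) (positions k P D a b)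

@[fun_prop]
theorem Poly.winning {α : Type} [Data α] (k : ℕ) {P D : α → List VAtom} {a b : α → List V}
    (hP : Poly P) (hD : Poly D) (ha : Poly a) (hb : Poly b) :
    Poly fun x => QBE.winning k (P x) (D x) (a x) (b x) := by
  have h := Poly.positions k hP hD ha hb
  refine foldl (g := fun x W _ => QBE.refineStep k (P x) (D x) W) h h (by fun_prop) h.size ?_
  rintro x l₁ - -
  refine size_le_of_sublist ?_
  induction l₁ using List.reverseRecOn with
  | nil => exact List.Sublist.refl _
  | append_singleton l b ih =>
    rw [List.foldl_append]
    exact (List.filter_sublist).trans ih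

/-- Does the duplicator win? -/
def wins (k : ℕ) (P D : List VAtom) (a b : List V) : Bool :=
  (tuples k (elems P)).all fun c => (winning k P D a b).any fun z =>
    decide (z.map (fun p => p.1) = c)

@[fun_prop]
theorem Poly.wins {α : Type} [Data α] (k : ℕ) {P D : α → List VAtom} {a b : α → List V}
    (hP : Poly P) (hD : Poly D) (ha : Poly a) (hb : Poly b) :
    Poly fun x => QBE.wins k (P x) (D x) (a x) (b x) := by
  unfold QBE.wins; fun_prop

/-- Has the atom at most `k` elements outside of `a`? -/
def isCoveredAtom (k : ℕ) (P : List VAtom) (a : List V) (A : VAtom) : Bool :=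
  (tuples k (elems P)).any fun c => A.2.all fun x => decide (x ∈ c) || decide (x ∈ a)

@[fun_prop]
theorem Poly.isCoveredAtom {α : Type} [Data α] (k : ℕ) {P : α → List VAtom} {a : α → List V}
    {A : α → VAtom} (hP : Poly P) (ha : Poly a) (hA : Poly A) :
    Poly fun x => QBE.isCoveredAtom k (P x) (a x) (A x) := by
  unfold QBE.isCoveredAtom; fun_prop

/-- Is there a covered atom, and are all members of `a` in covered atoms? -/
def isCovered (k : ℕ) (P : List VAtom) (a : List V) : Bool :=
  (P.any fun A => isCoveredAtom k P a A) &&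
    a.all fun x => P.any fun A => decide (x ∈ A.2) && isCoveredAtom k P a A

@[fun_prop]
theorem Poly.isCovered {α : Type} [Data α] (k : ℕ) {P : α → List VAtom} {a : α → List V}
    (hP : Poly P) (ha : Poly a) : Poly fun x => QBE.isCovered k (P x) (a x) := by
  unfold QBE.isCovered; fun_prop

/-- The product of one more copy of `D` with `P`. -/
def prodStep (D P : List VAtom) : List VAtom :=
  P.flatMap fun A => (D.filter fun B => decide (B.1 = A.1)).map fun B =>
    (A.1, B.2.zipWith V.cons A.2)

@[fun_prop]
theorem Poly.prodStep {α : Type} [Data α] {D P : α → List VAtom} (hD : Poly D) (hP : Poly P) :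
    Poly fun x => QBE.prodStep (D x) (P x) := by
  unfold QBE.prodStep; fun_prop

end QBE

namespace QBE

open Function

/-! ### Correctness of the algorithm on lists -/

/-- The code of a natural number. -/
def natCode (m : ℕ) : V := Data.enc m.bits

theorem natCode_injective : Injective natCode := fun a b h => by
  have h1 : a.bits = b.bits := InjData.inj h
  exact Nat.digits.injective 2 (by rw [Nat.digits_two_eq_bits, Nat.digits_two_eq_bits, h1])

variable {σ : Schema} {C C' : Type}

/-- The code of an atom, given codes of the elements. -/
def atomCode (ι : C → V) (A : Atom σ C) : VAtom :=
  (natCode A.rel, List.ofFn fun i => ι (A.args i))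

/-- `L` lists the codes of the members of `P`. -/
def Codes (ι : C → V) (P : Set (Atom σ C)) (L : List VAtom) : Prop :=
  ∀ x, x ∈ L ↔ ∃ A ∈ P, x = atomCode ι A

theorem Codes.mem_elems {ι : C → V} {P : Set (Atom σ C)} {L : List VAtom} (h : Codes ι P L)
    {x : V} : x ∈ elems L ↔ ∃ c ∈ adom P, x = ι c := by
  simp only [elems, List.mem_flatMap]
  constructor
  · rintro ⟨A, hA, hx⟩
    obtain ⟨A, hA', rfl⟩ := (h _).1 hA
    obtain ⟨i, rfl⟩ := (List.mem_ofFn' _ _).1 hx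
    exact ⟨_, mem_adom hA' i, rfl⟩
  · rintro ⟨_, ⟨A, hA, i, rfl⟩, rfl⟩
    exact ⟨_, (h _).2 ⟨A, hA, rfl⟩, (List.mem_ofFn' _ _).2 ⟨i, rfl⟩⟩

theorem exists_ofFn {α β : Type} {k : ℕ} {l : List β} {p : α → Prop} {ι : α → β}
    (hl : l.length = k) (h : ∀ b ∈ l, ∃ a, p a ∧ b = ι a) :
    ∃ f : Fin k → α, (∀ i, p (f i)) ∧ l = List.ofFn fun i => ι (f i) := by
  subst hl
  choose f hf using fun i : Fin l.length => h l[i] (List.getElem_mem i.2)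
  refine ⟨f, fun i => (hf i).1, ?_⟩
  conv_lhs => rw [← List.ofFn_getElem (xs := l)]
  exact congrArg List.ofFn (funext fun i => (hf i).2)

theorem Codes.mem_tuples {k : ℕ} {ι : C → V} {P : Set (Atom σ C)} {L : List VAtom}
    (h : Codes ι P L) {t : List V} : t ∈ tuples k (elems L) ↔
      ∃ c : Fin k → C, (∀ i, c i ∈ adom P) ∧ t = List.ofFn fun i => ι (c i) := by
  rw [QBE.mem_tuples]
  constructor
  · rintro ⟨hl, ht⟩
    exact exists_ofFn hl fun b hb => h.mem_elems.1 (ht b hb)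
  · rintro ⟨c, hc, rfl⟩
    refine ⟨by simp, fun b hb => ?_⟩
    obtain ⟨i, rfl⟩ := (List.mem_ofFn' _ _).1 hb
    exact h.mem_elems.2 ⟨_, hc i, rfl⟩

variable {ι : C → V} {ι' : C' → V} {P : Set (Atom σ C)} {D : Set (Atom σ C')}
  {LP LD : List VAtom}

theorem zip_ofFn {α β : Type} {m : ℕ} (f : Fin m → α) (g : Fin m → β) :
    (List.ofFn f).zip (List.ofFn g) = List.ofFn fun i => (f i, g i) :=
  List.ext_getElem (by simp) fun i _ _ => by simp

/-- Once `z` is known to be functional, an atom of `D` with the same symbol as `A` all of whose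
pairs with the entries of `A` lie in `z` must be the image of `A`. The test therefore runs through
pairs of atoms and need not search for tuples of pebbles. -/
theorem isPHom_iff (hι : Injective ι) (hι' : Injective ι') (hP : Codes ι P LP)
    (hD : Codes ι' D LD) {X : Type} {s : X → C} {t : X → C'} {z : List (V × V)}
    (hz : ∀ p, p ∈ z ↔ ∃ x, p = (ι (s x), ι' (t x))) :
    isPHom LP LD z = true ↔ IsPartialHom P D s t := by
  have h1 : (∀ p ∈ z, ∀ q ∈ z, ¬ p.1 = q.1 ∨ p.2 = q.2) ↔ ∀ i j, s i = s j → t i = t j := by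
    constructor
    · intro h i j hij
      rcases h _ ((hz _).2 ⟨i, rfl⟩) _ ((hz _).2 ⟨j, rfl⟩) with h | h
      · exact (h (congrArg ι hij)).elim
      · exact hι' h
    · intro h p hp q hq
      obtain ⟨i, rfl⟩ := (hz _).1 hp
      obtain ⟨j, rfl⟩ := (hz _).1 hq
      by_cases hij : s i = s j
      · exact Or.inr (congrArg ι' (h i j hij))
      · exact Or.inl fun h' => hij (hι h')
  simp only [isPHom, Bool.and_eq_true, List.all_eq_true, Bool.or_eq_true, Bool.not_eq_true',
    decide_eq_false_iff_not, decide_eq_true_eq, List.any_eq_true]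
  rw [h1]
  refine and_congr_right fun hw => ⟨fun h R f hR => ?_, fun h A hA => ?_⟩
  · rcases h _ ((hP _).2 ⟨_, hR, rfl⟩) with h | ⟨B, hB, hB1, hB2⟩
    · refine (Bool.eq_false_iff.1 h ?_).elim
      rw [List.all_eq_true]
      intro x hx
      obtain ⟨i, rfl⟩ := (List.mem_ofFn' _ _).1 hx
      rw [List.any_eq_true]
      exact ⟨_, (hz _).2 ⟨f i, rfl⟩, decide_eq_true rfl⟩
    · obtain ⟨⟨R', args⟩, hA', rfl⟩ := (hD _).1 hB
      obtain rfl : R' = R := Fin.ext (natCode_injective hB1)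
      convert hA' using 2
      funext i
      obtain ⟨x, hx⟩ := (hz (ι (s (f i)), ι' (args i))).1 (hB2 _ (by
        simp only [atomCode, zip_ofFn]
        exact (List.mem_ofFn' _ _).2 ⟨i, rfl⟩))
      rw [Prod.mk.injEq] at hx
      rw [hι' hx.2]
      exact hw _ _ (hι hx.1)
  · obtain ⟨⟨R, args⟩, hA', rfl⟩ := (hP _).1 hA
    by_cases hall : ∀ i, ∃ x, args i = s x
    · choose f hf using hall
      obtain rfl : args = fun i => s (f i) := funext hf
      refine Or.inr ⟨_, (hD _).2 ⟨_, h R f hA', rfl⟩, rfl, fun p hp => ?_⟩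
      simp only [atomCode, zip_ofFn] at hp
      obtain ⟨i, rfl⟩ := (List.mem_ofFn' _ _).1 hp
      exact (hz _).2 ⟨f i, rfl⟩
    · push Not at hall
      obtain ⟨i, hi⟩ := hall
      refine Or.inl (Bool.eq_false_iff.2 fun h' => ?_)
      rw [List.all_eq_true] at h'
      have h2 := h' (ι (args i)) ((List.mem_ofFn' _ _).2 ⟨i, rfl⟩)
      rw [List.any_eq_true] at h2
      obtain ⟨p, hp, hp'⟩ := h2
      obtain ⟨x, rfl⟩ := (hz _).1 hp
      exact hi x (hι (of_decide_eq_true hp')).symm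

variable {n k : ℕ} {a : Fin n → C} {b : Fin n → C'}

/-- The code of a position. -/
def posCode (ι : C → V) (ι' : C' → V) {k : ℕ} (p : (Fin k → C) × (Fin k → C')) : List (V × V) :=
  List.ofFn fun i => (ι (p.1 i), ι' (p.2 i))

theorem posCode_injective (hι : Injective ι) (hι' : Injective ι') :
    Injective (posCode ι ι' (k := k)) := fun p q h => by
  have h' := List.ofFn_injective h
  refine Prod.ext (funext fun i => hι ?_) (funext fun i => hι' ?_)
  · exact congrArg Prod.fst (congrFun h' i)
  · exact congrArg Prod.snd (congrFun h' i)

theorem posCode_set {p : (Fin k → C) × (Fin k → C')} (i : Fin k) (c : C) (d : C') :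
    (posCode ι ι' p).set i (ι c, ι' d) = posCode ι ι' (update p.1 i c, update p.2 i d) := by
  refine List.ext_getElem (by simp [posCode]) fun j hj _ => ?_
  simp only [posCode, List.getElem_set, List.getElem_ofFn]
  simp only [posCode, List.length_set, List.length_ofFn] at hj
  split_ifs with h
  · obtain rfl : i = ⟨j, hj⟩ := Fin.ext h
    simp
  · have : (⟨j, hj⟩ : Fin k) ≠ i := fun h' => h (congrArg Fin.val h').symm
    simp [this]

theorem mem_positions (hι : Injective ι) (hι' : Injective ι') (hP : Codes ι P LP)
    (hD : Codes ι' D LD) {z : List (V × V)} :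
    z ∈ positions k LP LD (List.ofFn fun j => ι (a j)) (List.ofFn fun j => ι' (b j)) ↔
      ∃ p ∈ stage k P a D b 0, z = posCode ι ι' p := by
  have hph : ∀ p : (Fin k → C) × (Fin k → C'), isPHom LP LD (posCode ι ι' p ++
      (List.ofFn fun j => ι (a j)).zip (List.ofFn fun j => ι' (b j))) = true ↔
        IsPartialHom P D (Sum.elim p.1 a) (Sum.elim p.2 b) := fun p =>
    isPHom_iff hι hι' hP hD fun q => by
      simp [zip_ofFn, posCode, List.mem_ofFn, eq_comm]
  rw [positions, List.mem_filter, QBE.mem_tuples]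
  constructor
  · rintro ⟨⟨hl, hz⟩, hpz⟩
    obtain ⟨p, hp, rfl⟩ := exists_ofFn (p := fun p : C × C' => p.1 ∈ adom P ∧ p.2 ∈ adom D)
      (ι := fun p => (ι p.1, ι' p.2)) hl fun x hx => by
        have := hz x hx
        simp only [List.mem_flatMap, List.mem_map] at this
        obtain ⟨e, he, d, hd, rfl⟩ := this
        obtain ⟨e, he', rfl⟩ := hP.mem_elems.1 he
        obtain ⟨d, hd', rfl⟩ := hD.mem_elems.1 hd
        exact ⟨(e, d), ⟨he', hd'⟩, rfl⟩
    exact ⟨(fun i => (p i).1, fun i => (p i).2), ⟨fun i => (hp i).1, fun i => (hp i).2,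
      (hph (fun i => (p i).1, fun i => (p i).2)).1 hpz⟩, rfl⟩
  · rintro ⟨p, ⟨h1, h2, h3⟩, rfl⟩
    refine ⟨⟨by simp [posCode], fun x hx => ?_⟩, (hph p).2 h3⟩
    obtain ⟨i, rfl⟩ := (List.mem_ofFn' _ _).1 hx
    simp only [List.mem_flatMap, List.mem_map]
    exact ⟨_, hP.mem_elems.2 ⟨_, h1 i, rfl⟩, _, hD.mem_elems.2 ⟨_, h2 i, rfl⟩, rfl⟩

theorem mem_refineStep (hι : Injective ι) (hι' : Injective ι') (hP : Codes ι P LP)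
    (hD : Codes ι' D LD) {W : List (List (V × V))} {m : ℕ}
    (hW : ∀ z, z ∈ W ↔ ∃ p ∈ stage k P a D b m, z = posCode ι ι' p) (z : List (V × V)) :
    z ∈ refineStep k LP LD W ↔ ∃ p ∈ stage k P a D b (m + 1), z = posCode ι ι' p := by
  have hset : ∀ (p : (Fin k → C) × (Fin k → C')) (i : Fin k) c d,
      (posCode ι ι' p).set i (ι c, ι' d) ∈ W ↔
        (update p.1 i c, update p.2 i d) ∈ stage k P a D b m := fun p i c d => by
    rw [posCode_set, hW]
    constructor
    · rintro ⟨q, hq, h⟩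
      rwa [posCode_injective hι hι' h]
    · exact fun h => ⟨_, h, rfl⟩
  simp only [refineStep, List.mem_filter, List.all_eq_true, List.any_eq_true, List.mem_range,
    decide_eq_true_eq]
  constructor
  · rintro ⟨hz, h⟩
    obtain ⟨p, hp, rfl⟩ := (hW _).1 hz
    refine ⟨p, ⟨hp, fun i c hc => ?_⟩, rfl⟩
    obtain ⟨d, hd, h'⟩ := h i i.2 _ (hP.mem_elems.2 ⟨c, hc, rfl⟩)
    obtain ⟨d, hd', rfl⟩ := hD.mem_elems.1 hd
    exact ⟨d, hd', (hset _ _ _ _).1 h'⟩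
  · rintro ⟨p, ⟨hp, h⟩, rfl⟩
    refine ⟨(hW _).2 ⟨p, hp, rfl⟩, fun i hi e he => ?_⟩
    obtain ⟨c, hc, rfl⟩ := hP.mem_elems.1 he
    obtain ⟨d, hd, h'⟩ := h ⟨i, hi⟩ c hc
    exact ⟨_, hD.mem_elems.2 ⟨d, hd, rfl⟩, (hset p ⟨i, hi⟩ _ _).2 h'⟩

theorem wins_iff (hι : Injective ι) (hι' : Injective ι') (hP : Codes ι P LP)
    (hD : Codes ι' D LD) :
    wins k LP LD (List.ofFn fun j => ι (a j)) (List.ofFn fun j => ι' (b j)) = true ↔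
      PebbleWin k P a D b := by
  set W₀ := positions k LP LD (List.ofFn fun j => ι (a j)) (List.ofFn fun j => ι' (b j)) with hW₀
  have h0 : ∀ z, z ∈ W₀ ↔ ∃ p ∈ stage k P a D b 0, z = posCode ι ι' p :=
    fun z => mem_positions hι hι' hP hD
  have hsub : posCode ι ι' '' stage k P a D b 0 ⊆ (W₀.toFinset : Set (List (V × V))) := by
    rintro _ ⟨p, hp, rfl⟩
    simpa using (h0 _).2 ⟨p, hp, rfl⟩
  have hfin : (stage k P a D b 0).Finite :=
    ((W₀.toFinset.finite_toSet).subset hsub).of_finite_image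
      (posCode_injective hι hι').injOn
  -- The list may contain repetitions, which only leads to superfluous rounds.
  have hcard : (stage k P a D b 0).ncard ≤ W₀.length := by
    rw [← Set.ncard_image_of_injective _ (posCode_injective hι hι')]
    refine (Set.ncard_le_ncard hsub (Finset.finite_toSet _)).trans ?_
    rw [Set.ncard_coe_finset]
    exact List.toFinset_card_le _
  have hiter : ∀ (l : List (List (V × V))) z, z ∈ l.foldl (fun W _ => refineStep k LP LD W) W₀ ↔
      ∃ p ∈ stage k P a D b l.length, z = posCode ι ι' p := fun l => by
    induction l using List.reverseRecOn with
    | nil => exact h0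
    | append_singleton l x ih =>
      rw [List.foldl_append, List.length_append]
      exact mem_refineStep hι hι' hP hD ih
  rw [pebbleWin_iff_stage hfin hcard]
  simp only [wins, List.all_eq_true, List.any_eq_true, decide_eq_true_eq]
  constructor
  · intro h c hc
    obtain ⟨z, hz, hz'⟩ := h _ (hP.mem_tuples.2 ⟨c, hc, rfl⟩)
    obtain ⟨p, hp, rfl⟩ := (hiter _ z).1 hz
    refine ⟨p.2, ?_⟩
    rw [posCode, List.map_ofFn] at hz'
    obtain rfl : p.1 = c := funext fun i => hι (congrFun (List.ofFn_injective hz') i)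
    exact hp
  · intro h t ht
    obtain ⟨c, hc, rfl⟩ := hP.mem_tuples.1 ht
    obtain ⟨d, hd⟩ := h c hc
    refine ⟨_, (hiter _ _).2 ⟨(c, d), hd, rfl⟩, ?_⟩
    rw [posCode, List.map_ofFn]
    rfl

theorem isCovered_iff (hι : Injective ι) (hP : Codes ι P LP) :
    isCovered (k + 1) LP (List.ofFn fun j => ι (a j)) = true ↔ Covered k P a := by
  have h1 : ∀ A : Atom σ C, A ∈ P → (isCoveredAtom (k + 1) LP (List.ofFn fun j => ι (a j))
      (atomCode ι A) = true ↔ CoveredAtom k P a A) := by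
    intro A hA
    simp only [isCoveredAtom, List.any_eq_true, List.all_eq_true, Bool.or_eq_true,
      decide_eq_true_eq, atomCode]
    constructor
    · rintro ⟨t, ht, h⟩
      obtain ⟨c, hc, rfl⟩ := hP.mem_tuples.1 ht
      refine ⟨hA, c, hc, fun i => ?_⟩
      refine (h _ ((List.mem_ofFn' _ _).2 ⟨i, rfl⟩)).imp (fun h' => ?_) fun h' => ?_ <;>
      · obtain ⟨j, hj⟩ := (List.mem_ofFn' _ _).1 h'
        exact ⟨j, (hι hj).symm⟩
    · rintro ⟨-, c, hc, h⟩
      refine ⟨_, hP.mem_tuples.2 ⟨c, hc, rfl⟩, fun x hx => ?_⟩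
      obtain ⟨i, rfl⟩ := (List.mem_ofFn' _ _).1 hx
      refine (h i).imp ?_ ?_ <;>
      · rintro ⟨j, hj⟩
        exact (List.mem_ofFn' _ _).2 ⟨j, congrArg ι hj.symm⟩
  simp only [isCovered, Bool.and_eq_true, List.any_eq_true, List.all_eq_true, decide_eq_true_eq]
  refine and_congr ⟨?_, ?_⟩ ⟨fun h j => ?_, fun h x hx => ?_⟩
  · rintro ⟨_, hA, h⟩
    obtain ⟨A, hA', rfl⟩ := (hP _).1 hA
    exact ⟨A, (h1 A hA').1 h⟩
  · rintro ⟨A, hA⟩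
    exact ⟨_, (hP _).2 ⟨A, hA.1, rfl⟩, (h1 A hA.1).2 hA⟩
  · obtain ⟨_, hA, hx, h'⟩ := h _ ((List.mem_ofFn' _ _).2 ⟨j, rfl⟩)
    obtain ⟨A, hA', rfl⟩ := (hP _).1 hA
    obtain ⟨i, hi⟩ := (List.mem_ofFn' _ _).1 hx
    exact ⟨A, (h1 A hA').1 h', i, hι hi⟩
  · obtain ⟨j, rfl⟩ := (List.mem_ofFn' _ _).1 hx
    obtain ⟨A, hA, i, hi⟩ := h j
    exact ⟨_, (hP _).2 ⟨A, hA.1, rfl⟩, (List.mem_ofFn' _ _).2 ⟨i, congrArg ι hi⟩,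
      (h1 A hA.1).2 hA⟩

/-! ### Products -/

/-- The code of a family of natural numbers, for a list of indices. -/
def famCode {T : Type} (l : List T) (f : T → ℕ) : V :=
  l.foldl (fun v s => V.cons (natCode (f s)) v) .nil

theorem famCode_append {T : Type} (l : List T) (s : T) (f : T → ℕ) :
    famCode (l ++ [s]) f = V.cons (natCode (f s)) (famCode l f) := by
  simp [famCode]

theorem famCode_eq_iff {T : Type} {l : List T} {f g : T → ℕ} :
    famCode l f = famCode l g ↔ ∀ s ∈ l, f s = g s := by
  induction l using List.reverseRecOn with
  | nil => simp [famCode]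
  | append_singleton l s ih =>
    rw [famCode_append, famCode_append, V.cons.injEq, ih, natCode_injective.eq_iff]
    simp only [List.mem_append, List.mem_singleton]
    constructor
    · rintro ⟨h1, h2⟩ t (ht | rfl)
      exacts [h2 t ht, h1]
    · exact fun h => ⟨h s (Or.inr rfl), fun t ht => h t (Or.inl ht)⟩

/-- The iteration starts from the product of no factors, which has one element and one atom for each
symbol. Since `l` has no repetitions, the factor added last has a fresh index, so `F` can be
redefined there without a change to the earlier factors. -/
theorem mem_foldl_prodStep {T : Type} [DecidableEq T] {D : Set (Atom σ ℕ)} {LD : List VAtom}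
    (hD : Codes natCode D LD) {rels : List VAtom} (hrels : ∀ x, x ∈ rels ↔
      ∃ R : Fin σ.numRel, x = (natCode R, List.ofFn fun _ : Fin (σ.arity R) => V.nil))
    {l : List T} (hl : l.Nodup) (x : VAtom) :
    x ∈ l.foldl (fun P _ => prodStep LD P) rels ↔ ∃ (R : Fin σ.numRel)
      (F : T → Fin (σ.arity R) → ℕ), (∀ s ∈ l, (⟨R, F s⟩ : Atom σ ℕ) ∈ D) ∧
      x = (natCode R, List.ofFn fun i => famCode l fun s => F s i) := by
  induction l using List.reverseRecOn generalizing x with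
  | nil =>
    rw [List.foldl_nil, hrels]
    exact ⟨fun ⟨R, h⟩ => ⟨R, fun _ _ => 0, by simp, h⟩, fun ⟨R, F, _, h⟩ => ⟨R, h⟩⟩
  | append_singleton l s ih =>
    rw [List.nodup_append] at hl
    have hs : ∀ t ∈ l, t ≠ s := fun t ht h => hl.2.2 t ht s (by simp) h
    have hzw : ∀ (m : ℕ) (f g : Fin m → V), (List.ofFn f).zipWith V.cons (List.ofFn g) =
        List.ofFn fun i => V.cons (f i) (g i) := fun m f g =>
      List.ext_getElem (by simp) fun i _ _ => by simp
    simp only [List.foldl_append, List.foldl_cons, List.foldl_nil, prodStep, List.mem_flatMap,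
      List.mem_map, List.mem_filter, decide_eq_true_eq]
    constructor
    · rintro ⟨A, hA, B, ⟨hB, hBA⟩, rfl⟩
      obtain ⟨R, F, hF, rfl⟩ := (ih hl.1 A).1 hA
      obtain ⟨⟨R', args⟩, hB', rfl⟩ := (hD _).1 hB
      obtain rfl : R' = R := Fin.ext (natCode_injective hBA)
      refine ⟨R', update F s args, fun t ht => ?_, ?_⟩
      · rcases List.mem_append.1 ht with ht | ht
        · rw [update_of_ne (hs t ht)]
          exact hF t ht
        · obtain rfl := List.mem_singleton.1 ht
          rwa [update_self]
      · simp only [atomCode, hzw, famCode_append, update_self]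
        congr 2
        funext i
        rw [famCode_eq_iff.2]
        exact fun t ht => by rw [update_of_ne (hs t ht)]
    · rintro ⟨R, F, hF, rfl⟩
      refine ⟨_, (ih hl.1 _).2 ⟨R, F, fun t ht => hF t (by simp [ht]), rfl⟩,
        _, ⟨(hD _).2 ⟨_, hF s (by simp), rfl⟩, rfl⟩, ?_⟩
      simp only [atomCode, hzw, famCode_append]

theorem foldl_zipWith_cons {T : Type} {n : ℕ} (l : List T) (F : T → Fin n → ℕ) :
    (l.map fun s => List.ofFn fun i => natCode (F s i)).foldl
      (fun acc t => t.zipWith V.cons acc) (List.ofFn fun _ : Fin n => V.nil) =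
      List.ofFn fun i => famCode l fun s => F s i := by
  induction l using List.reverseRecOn with
  | nil => rfl
  | append_singleton l s ih =>
    rw [List.map_append, List.foldl_append, ih]
    simp only [List.map_cons, List.map_nil, List.foldl_cons, List.foldl_nil, famCode_append]
    exact List.ext_getElem (by simp) fun i _ _ => by simp

end QBE

namespace QBE

open Function

/-! ### Explanations and products -/

/-- Atoms of the product have families of elements of `D` as entries, and there are finitely many
such families. -/
theorem prodDB_finite {σ : Schema} {C X : Type} [Finite X] {D : Set (Atom σ C)} (hD : D.Finite) :
    (prodDB fun _ : X => D).Finite := by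
  have hE : (Set.univ.pi fun _ : X => adom D).Finite := Set.Finite.pi fun _ => adom_finite hD
  have := hE.to_subtype
  refine (Set.finite_range fun A : Atom σ (Set.univ.pi fun _ : X => adom D) =>
    A.map Subtype.val).subset ?_
  rintro ⟨R, args⟩ hA
  exact ⟨⟨R, fun i => ⟨args i, fun x _ => mem_adom (hA x) i⟩⟩, rfl⟩

namespace CQ

variable {σ : Schema} {n : ℕ} {C : Type}

/-- This is the universal property of the product, used in both directions. -/
theorem prodTuple_mem_eval {X : Type} {q : CQ σ n} {D : Set (Atom σ C)} {a : X → Fin n → C} :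
    prodTuple a ∈ q.eval (prodDB fun _ : X => D) ↔ ∀ x, a x ∈ q.eval D := by
  constructor
  · rintro ⟨h, hh, e⟩ x
    exact ⟨fun v => h v x, fun A hA => hh A hA x, funext fun i => congrFun (congrFun e i) x⟩
  · intro h
    choose h hh e using h
    exact ⟨fun v x => h x v, fun A hA x => hh x A hA, funext fun i => funext fun x =>
      congrFun (e x) i⟩

theorem mem_adom_of_mem_eval {q : CQ σ n} {D : Set (Atom σ C)} {b : Fin n → C}
    (hb : b ∈ q.eval D) (i : Fin n) : b i ∈ adom D := by
  obtain ⟨h, hh, rfl⟩ := hb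
  obtain ⟨A, hA, j, hj⟩ := q.head_mem i
  exact ⟨_, hh A hA, j, congrArg h hj⟩

end CQ

namespace Instance

variable (I : Instance)

theorem D_finite : I.D.Finite := List.finite_toSet I.db

instance : Finite I.pos := (List.finite_toSet I.posList).to_subtype

/-- The product of the copies of the database. -/
def prod : Set (Atom I.schema (I.pos → ℕ)) := prodDB fun _ => I.D

/-- The tuple of the product. -/
def tuple : Fin I.n → I.pos → ℕ := prodTuple fun a => a.1

variable {I} {k : ℕ}

/-- An explanation holds at the tuple of the product, hence at all tuples for which the duplicator
wins; so none of these is a negative example. -/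
theorem covered_of_isTWExplanation {q : CQ I.schema I.n}
    (h : IsTWExplanation k I.D I.pos I.neg q) :
    Covered k I.prod I.tuple ∧ I.pebbleTuples k ∩ I.neg = ∅ := by
  have hq : I.tuple ∈ q.eval I.prod := CQ.prodTuple_mem_eval.2 fun a => h.2.1 a.2
  refine ⟨covered_of_eval h.1 hq, Set.eq_empty_of_forall_notMem fun b hb => ?_⟩
  have : b ∈ q.eval I.D ∩ I.neg := ⟨eval_of_pebbleWin h.1 hq hb.1.2, hb.2⟩
  rwa [h.2.2] at this

/-- The unravelling of the product has the smallest answer among all queries in `TW(k)` that return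
the positive examples. -/
theorem exists_isTWExplanation (hc : Covered k I.prod I.tuple)
    (h : I.pebbleTuples k ∩ I.neg = ∅) :
    ∃ q, IsTWExplanation k I.D I.pos I.neg q ∧ q.eval I.D = I.pebbleTuples k := by
  obtain ⟨q, hq, ha, hw⟩ := exists_query (prodDB_finite I.D_finite) I.D_finite hc
  have he : q.eval I.D = I.pebbleTuples k := Set.Subset.antisymm
    (fun b hb => ⟨CQ.mem_adom_of_mem_eval hb, hw b hb⟩)
    fun b hb => eval_of_pebbleWin hq ha hb.2
  exact ⟨q, ⟨hq, fun a ha' => CQ.prodTuple_mem_eval.1 ha ⟨a, ha'⟩, by rw [he, h]⟩, he⟩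

end Instance

/-! ### The answer, computed from lists -/

/-- The code of a tuple of natural numbers. -/
def tupleCode {n : ℕ} (a : Fin n → ℕ) : List V := List.ofFn fun i => natCode (a i)

theorem tupleCode_injective {n : ℕ} : Injective (tupleCode (n := n)) := fun _ _ h =>
  funext fun i => natCode_injective (congrFun (List.ofFn_injective h) i)

/-- The data of an instance: the relation symbols (as atoms with trivial entries), the database,
the arity in unary, and the positive and negative examples. -/
abbrev Input := List VAtom × List VAtom × List V × List (List V) × List (List V)

namespace Input

/-- The product of the copies of the database. -/
def prod (x : Input) : List VAtom :=
  (distinct x.2.2.2.1).foldl (fun P _ => prodStep x.2.1 P) x.1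

/-- The tuple of the product. -/
def tuple (x : Input) : List V :=
  (distinct x.2.2.2.1).foldl (fun acc t => t.zipWith V.cons acc) x.2.2.1

/-- The tuples for which the duplicator wins. -/
def pebbleTuples (k : ℕ) (x : Input) : List (List V) :=
  -- The removal of repeated elements keeps the list of tuples free of repetitions.
  (tuples x.2.2.1.length (distinct (elems x.2.1))).filter fun b =>
    wins (k + 1) x.prod x.2.1 x.tuple b

/-- Is there an explanation? -/
def explainable (k : ℕ) (x : Input) : Bool :=
  isCovered (k + 1) x.prod x.tuple &&
    (x.pebbleTuples k).all fun b => !decide (b ∈ x.2.2.2.2)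

end Input

namespace Instance

/-- The data of an instance. -/
def toInput (I : Instance) : Input :=
  (List.ofFn fun R => (natCode R, List.ofFn fun _ : Fin (I.schema.arity R) => V.nil),
    I.db.map (atomCode natCode), List.replicate I.n V.nil, I.posList.map tupleCode,
    I.negList.map tupleCode)

variable (I : Instance)

/-- The codes of the elements of the product. -/
noncomputable def elemCode (f : I.pos → ℕ) : V :=
  -- The extension by `0` outside of `S⁺` is never read.
  open Classical in famCode (distinct I.posList) fun s => if h : s ∈ I.pos then f ⟨s, h⟩ else 0

variable {I}

theorem mem_distinct_posList {s : Fin I.n → ℕ} : s ∈ distinct I.posList ↔ s ∈ I.pos :=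
  (distinct_spec _).2 s

theorem elemCode_injective : Injective I.elemCode := fun f g h => by
  funext ⟨s, hs⟩
  have := famCode_eq_iff.1 h s (mem_distinct_posList.2 hs)
  simpa only [dif_pos hs] using this

theorem elemCode_eq {F : (Fin I.n → ℕ) → ℕ} :
    I.elemCode (fun s => F s.1) = famCode (distinct I.posList) F :=
  famCode_eq_iff.2 fun s hs => by rw [dif_pos (mem_distinct_posList.1 hs)]

theorem codes_db : Codes natCode I.D I.toInput.2.1 := fun x => by
  simp [toInput, D, eq_comm]

theorem codes_prod : Codes I.elemCode I.prod I.toInput.prod := fun x => by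
  have : I.toInput.prod =
      (distinct I.posList).foldl (fun P _ => prodStep I.toInput.2.1 P) I.toInput.1 := by
    rw [Input.prod]
    simp only [toInput]
    rw [distinct_map tupleCode_injective, List.foldl_map]
  have hrels : ∀ y, y ∈ I.toInput.1 ↔ ∃ R : Fin I.schema.numRel,
      y = (natCode R, List.ofFn fun _ : Fin (I.schema.arity R) => V.nil) := fun y =>
    (List.mem_ofFn' _ _).trans (exists_congr fun _ => eq_comm)
  rw [this, mem_foldl_prodStep codes_db hrels (distinct_spec _).1]
  constructor
  · rintro ⟨R, F, hF, rfl⟩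
    refine ⟨⟨R, fun i s => F s.1 i⟩, fun s => hF s.1 (mem_distinct_posList.2 s.2), ?_⟩
    simp only [atomCode]
    congr 2
    exact funext fun i => (elemCode_eq (F := fun s => F s i)).symm
  · rintro ⟨⟨R, args⟩, hA, rfl⟩
    classical
    refine ⟨R, fun s i => if h : s ∈ I.pos then args i ⟨s, h⟩ else 0, fun s hs => ?_, ?_⟩
    · have hs := mem_distinct_posList.1 hs
      simp only [dif_pos hs]
      exact hA ⟨s, hs⟩
    · simp only [atomCode, elemCode]

theorem toInput_tuple : I.toInput.tuple = List.ofFn fun j => I.elemCode (I.tuple j) := by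
  have h := foldl_zipWith_cons (distinct I.posList) (fun s => s)
  rw [Input.tuple]
  simp only [toInput]
  rw [distinct_map tupleCode_injective]
  simp only [List.ofFn_const] at h
  refine h.trans (congrArg List.ofFn (funext fun j => ?_))
  exact (elemCode_eq (F := fun s => s j)).symm

theorem mem_toInput_pebbleTuples {k : ℕ} {t : List V} :
    t ∈ I.toInput.pebbleTuples k ↔ ∃ b ∈ I.pebbleTuples k, t = tupleCode b := by
  have hw : ∀ b : Fin I.n → ℕ, wins (k + 1) I.toInput.prod I.toInput.2.1 I.toInput.tuple
      (tupleCode b) = true ↔ PebbleWin (k + 1) I.prod I.tuple I.D b := fun b => by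
    rw [toInput_tuple]
    exact wins_iff elemCode_injective natCode_injective codes_prod codes_db
  have hn : I.toInput.2.2.1.length = I.n := by simp [toInput]
  rw [Input.pebbleTuples, List.mem_filter, mem_tuples, hn]
  constructor
  · rintro ⟨⟨hl, ht⟩, h⟩
    obtain ⟨b, hb, rfl⟩ := exists_ofFn (p := (· ∈ adom I.D)) (ι := natCode) hl fun x hx =>
      codes_db.mem_elems.1 (((distinct_spec _).2 x).1 (ht x hx))
    exact ⟨b, ⟨hb, (hw b).1 h⟩, rfl⟩
  · rintro ⟨b, hb, rfl⟩
    refine ⟨⟨by simp [tupleCode], fun x hx => ((distinct_spec _).2 x).2 ?_⟩, (hw b).2 hb.2⟩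
    obtain ⟨i, rfl⟩ := (List.mem_ofFn' _ _).1 hx
    exact codes_db.mem_elems.2 ⟨_, hb.1 i, rfl⟩

theorem explainable_iff {k : ℕ} : I.toInput.explainable k = true ↔
    Covered k I.prod I.tuple ∧ I.pebbleTuples k ∩ I.neg = ∅ := by
  rw [Input.explainable, Bool.and_eq_true, toInput_tuple,
    isCovered_iff elemCode_injective codes_prod, List.all_eq_true]
  refine and_congr_right fun _ => ⟨fun h => ?_, fun h t ht => ?_⟩
  · refine Set.eq_empty_of_forall_notMem fun b hb => ?_
    have := h _ (mem_toInput_pebbleTuples.2 ⟨b, hb.1, rfl⟩)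
    simp only [Bool.not_eq_true', decide_eq_false_iff_not] at this
    exact this (List.mem_map_of_mem hb.2)
  · obtain ⟨b, hb, rfl⟩ := mem_toInput_pebbleTuples.1 ht
    simp only [Bool.not_eq_true', decide_eq_false_iff_not]
    intro h'
    obtain ⟨c, hc, hcb⟩ := List.mem_map.1 h'
    obtain rfl := tupleCode_injective hcb
    have : c ∈ I.pebbleTuples k ∩ I.neg := ⟨hb, hc⟩
    rwa [h] at this

/-- The lists of tuples that the algorithm may output. -/
theorem exists_list (k : ℕ) : ∃ L : List (Fin I.n → ℕ), L.Nodup ∧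
    {b | b ∈ L} = I.pebbleTuples k ∧ I.toInput.pebbleTuples k = L.map tupleCode := by
  have : ∃ L : List (Fin I.n → ℕ), L.map tupleCode = I.toInput.pebbleTuples k := by
    refine Set.mem_range.1 ?_
    rw [Set.range_list_map]
    intro t ht
    obtain ⟨b, -, rfl⟩ := mem_toInput_pebbleTuples.1 ht
    exact ⟨b, rfl⟩
  obtain ⟨L, hL⟩ := this
  have hmem : ∀ b, b ∈ L ↔ b ∈ I.pebbleTuples k := fun b => by
    rw [← List.mem_map_of_injective tupleCode_injective, hL, mem_toInput_pebbleTuples]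
    constructor
    · rintro ⟨c, hc, h⟩
      rwa [tupleCode_injective h]
    · exact fun h => ⟨b, h, rfl⟩
  refine ⟨L, List.Nodup.of_map tupleCode (hL ▸ ?_), Set.ext hmem, hL.symm⟩
  exact (nodup_tuples (distinct_spec _).1 _).filter _

end Instance

end QBE

namespace QBE

open Function

/-! ### Parsing the input -/

instance : Data Sym :=
  ⟨fun s => Data.enc (List.replicate (match s with
    | .zero => 0 | .one => 1 | .comma => 2 | .lpar => 3 | .rpar => 4) V.nil), fun s =>
    (Data.enc (List.replicate (match s with
    | .zero => 0 | .one => 1 | .comma => 2 | .lpar => 3 | .rpar => 4) V.nil)).len,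
    fun _ => le_rfl⟩

instance : InjData Sym :=
  ⟨fun s s' h => by
    have h := congrArg List.length (InjData.inj (α := List V) h)
    cases s <;> cases s' <;> first | rfl | simp at h, fun _ => rfl⟩

theorem size_sym_le (s : Sym) : Data.size s ≤ 9 := by cases s <;> simp [Data.size]

theorem enc_map_enc {α : Type} [Data α] (l : List α) : Data.enc (l.map Data.enc) = Data.enc l := by
  induction l with
  | nil => rfl
  | cons a l ih => simp [ih]

/-- The state of the parser: the bits read since the last end mark, and the values in the lists
that are still open (in reverse order). -/
abbrev ParserState := List Bool × List (List V)

/-- One step of the parser. -/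
def parseStep (c : ParserState) (s : Sym) : ParserState :=
  if s = .zero then (false :: c.1, c.2)
  else if s = .one then (true :: c.1, c.2)
  else if s = .comma then ([], (Data.enc c.1.reverse :: c.2.headD []) :: c.2.tail)
  else if s = .lpar then (c.1, [] :: c.2)
  -- A right parenthesis closes the innermost open list and makes it an entry of the list around it.
  else (c.1, (Data.enc (c.2.headD []).reverse :: c.2.tail.headD []) :: c.2.tail.tail)

theorem size_parseStep (c : ParserState) (s : Sym) :
    Data.size (parseStep c s) ≤ Data.size c + 4 * (Data.size s + 1) := by
  obtain ⟨b, stk⟩ := c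
  have h1 : ∀ b : List Bool, (Data.enc b.reverse).len = Data.size b := fun b => by
    rw [← InjData.size_eq, size_reverse]
  have h2 : ∀ b : List V, (Data.enc b.reverse).len = Data.size b := fun b => by
    rw [← InjData.size_eq, size_reverse]
  have ht := size_bool_le true
  have hf := size_bool_le false
  unfold parseStep
  split_ifs
  · simp; omega
  · simp; omega
  · rcases stk with _ | ⟨f, stk⟩ <;> simp [h1] <;> omega
  · simp; omega
  · rcases stk with _ | ⟨f, _ | ⟨f', stk⟩⟩ <;> simp [h2] <;> omega

/-- The values in the list that is open after all of the word has been read. -/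
def parse (w : List Sym) : List V := ((w.foldl parseStep ([], [[]])).2.headD []).reverse

@[fun_prop]
theorem Poly.parse {α : Type} [Data α] {w : α → List Sym} (hw : Poly w) :
    Poly fun a => QBE.parse (w a) := by
  have : Poly fun w : List Sym => w.foldl parseStep ([], [[]]) :=
    foldl_of_size_le 4 (g := fun _ c s => parseStep c s) id (const _)
      (iteProp (by fun_prop) (by fun_prop) (iteProp (by fun_prop) (by fun_prop)
        (iteProp (by fun_prop) (by fun_prop) (iteProp (by fun_prop) (by fun_prop) (by fun_prop)))))
      fun _ => size_parseStep
  unfold QBE.parse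
  fun_prop

/-- The word `w` writes the list `vs` of values. -/
def Writes (w : List Sym) (vs : List V) : Prop :=
  ∀ f stk, w.foldl parseStep ([], f :: stk) = ([], (vs.reverse ++ f) :: stk)

theorem Writes.parse {w : List Sym} {vs : List V} (h : Writes w vs) : parse w = vs := by
  rw [QBE.parse, h]
  simp

theorem Writes.nil : Writes [] [] := fun _ _ => rfl

theorem Writes.append {w w' : List Sym} {vs vs' : List V} (h : Writes w vs) (h' : Writes w' vs') :
    Writes (w ++ w') (vs ++ vs') := fun f stk => by
  rw [List.foldl_append, h, h']
  simp

theorem Writes.flatMap {α : Type} {f : α → List Sym} {g : α → List V}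
    (h : ∀ a, Writes (f a) (g a)) (l : List α) : Writes (l.flatMap f) (l.flatMap g) := by
  induction l with
  | nil => exact .nil
  | cons a l ih => exact (h a).append ih

theorem writes_encList {α : Type} {f : α → List Sym} {g : α → List V}
    (h : ∀ a, Writes (f a) (g a)) (l : List α) :
    Writes (encList f l) [Data.enc (l.flatMap g)] := fun fr stk => by
  rw [encList, List.foldl_cons, List.foldl_append]
  have : parseStep ([], fr :: stk) .lpar = ([], [] :: fr :: stk) := rfl
  rw [this, Writes.flatMap h]
  simp [parseStep]

theorem writes_bits (l : List Bool) :
    Writes (l.map (fun b => cond b Sym.one Sym.zero) ++ [Sym.comma]) [Data.enc l] := fun f stk => by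
  have : ∀ c : List Bool, (l.map (fun b => cond b Sym.one Sym.zero)).foldl parseStep
      (c, f :: stk) = (l.reverse ++ c, f :: stk) := by
    induction l with
    | nil => exact fun _ => rfl
    | cons b l ih =>
      intro c
      rw [List.map_cons, List.foldl_cons]
      cases b
      · exact (ih (false :: c)).trans (by simp)
      · exact (ih (true :: c)).trans (by simp)
  rw [List.foldl_append, this]
  simp [parseStep]

theorem writes_encNat (m : ℕ) : Writes (encNat m) [natCode m] := writes_bits _

theorem writes_encArity (m : ℕ) : Writes (encArity m) [Data.enc (List.replicate m true)] := by
  simpa [encArity] using writes_bits (List.replicate m true)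

theorem writes_encTuple {n : ℕ} (a : Fin n → ℕ) : Writes (encTuple a) [Data.enc (tupleCode a)] := by
  have := writes_encList writes_encNat (List.ofFn a)
  rwa [← List.map_eq_flatMap, List.map_ofFn] at this

theorem writes_encAtom {σ : Schema} (A : Atom σ ℕ) :
    Writes (encAtom A) [natCode A.rel, Data.enc (tupleCode A.args)] :=
  (writes_encNat _).append (writes_encTuple _)

theorem parse_encode (I : Instance) : parse I.encode =
    [Data.enc (List.ofFn fun R => List.replicate (I.schema.arity R) true),
      Data.enc (I.db.flatMap fun A => [natCode A.rel, Data.enc (tupleCode A.args)]),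
      Data.enc (List.replicate I.n true),
      Data.enc (I.posList.map tupleCode), Data.enc (I.negList.map tupleCode)] := by
  have h := ((((writes_encList writes_encArity (List.ofFn I.schema.arity)).append
    (writes_encList writes_encAtom I.db)).append (writes_encArity I.n)).append
    (writes_encList writes_encTuple I.posList)).append (writes_encList writes_encTuple I.negList)
  rw [Instance.encode, h.parse]
  have e : ∀ {α β : Type} [Data β] (f : α → β) (l : List α),
      Data.enc (l.flatMap fun a => [Data.enc (f a)]) = Data.enc (l.map f) := fun f l => by
    rw [← List.map_eq_flatMap]
    exact (congrArg Data.enc (List.map_map ..).symm).trans (enc_map_enc (l.map f))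
  simp only [e, List.cons_append, List.nil_append, List.map_ofFn]
  rfl

end QBE

namespace QBE

open Function

/-! ### The data of an instance are computed from its code -/

/-- One step of `pairUp`; the first component holds an entry that waits for its partner. -/
def pairUpStep (c : List V × List (V × V)) (v : V) : List V × List (V × V) :=
  if c.1 = [] then ([v], c.2) else ([], (c.1.headD V.nil, v) :: c.2)

/-- Pair up consecutive entries. -/
def pairUp (l : List V) : List (V × V) := (l.foldl pairUpStep ([], [])).2.reverse

@[fun_prop]
theorem Poly.pairUp {α : Type} [Data α] {l : α → List V} (hl : Poly l) :
    Poly fun a => QBE.pairUp (l a) := by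
  have : Poly fun l : List V => l.foldl pairUpStep ([], []) :=
    foldl_of_size_le 4 (g := fun _ c v => pairUpStep c v) id (const _)
      (iteProp (by fun_prop) (by fun_prop) (by fun_prop)) fun _ c v => by
        obtain ⟨_ | ⟨u, c⟩, acc⟩ := c <;> simp [pairUpStep] <;> omega
  unfold QBE.pairUp
  fun_prop

/-- The input word has an atom as two consecutive values without a bracket around them, so the
parsed list must be regrouped. -/
theorem pairUp_flatMap {α : Type} (f g : α → V) (l : List α) :
    pairUp (l.flatMap fun a => [f a, g a]) = l.map fun a => (f a, g a) := by
  have : ∀ acc, (l.flatMap fun a => [f a, g a]).foldl pairUpStep ([], acc) =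
      ([], (l.map fun a => (f a, g a)).reverse ++ acc) := by
    induction l with
    | nil => exact fun _ => rfl
    | cons a l ih =>
      intro acc
      simp only [List.flatMap_cons, List.foldl_append, List.foldl_cons, List.foldl_nil]
      have : pairUpStep (pairUpStep ([], acc) (f a)) (g a) = ([], (f a, g a) :: acc) := rfl
      rw [this, ih]
      simp
  rw [pairUp, this]
  simp

/-- The successor, on binary representations. -/
def succBits : List Bool → List Bool
  | [] => [true]
  | false :: l => true :: l
  | true :: l => false :: succBits l

theorem succBits_bits (m : ℕ) : succBits m.bits = (m + 1).bits := by
  induction m using Nat.binaryRec' with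
  | zero => simp [succBits]
  | bit b m hm ih =>
    rw [Nat.bits_append_bit _ _ hm]
    cases b
    · simp only [succBits]
      rw [show Nat.bit false m + 1 = 2 * m + 1 by simp [Nat.bit], Nat.bit1_bits]
    · simp only [succBits, ih]
      rw [show Nat.bit true m + 1 = 2 * (m + 1) by simp [Nat.bit]; ring,
        Nat.bit0_bits _ (Nat.succ_ne_zero m)]

theorem size_bits_le (m : ℕ) : Data.size m.bits ≤ 4 * m + 1 := by
  refine (size_le_of_forall fun b _ => size_bool_le b).trans ?_
  have : m.bits.length ≤ m := by
    rw [Nat.size_eq_bits_len]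
    exact Nat.size_le.2 Nat.lt_two_pow_self
  omega

@[fun_prop]
theorem Poly.succBits {α : Type} [Data α] {l : α → List Bool} (hl : Poly l) :
    Poly fun a => QBE.succBits (l a) := by
  -- A fold with a carry bit and the output in reverse order; `fin` appends the carry that is left
  -- at the end.
  let g : Bool × List Bool → Bool → Bool × List Bool := fun c b =>
    if c.1 then (b, (!b) :: c.2) else (false, b :: c.2)
  let fin : Bool × List Bool → List Bool := fun c => (if c.1 then true :: c.2 else c.2).reverse
  have h1 : ∀ l acc : List Bool, fin (l.foldl g (false, acc)) = acc.reverse ++ l := fun l => by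
    induction l with
    | nil => intro acc; simp [fin]
    | cons b l ih =>
      intro acc
      have : g (false, acc) b = (false, b :: acc) := rfl
      rw [List.foldl_cons, this, ih]
      simp
  have h2 : ∀ l acc : List Bool, fin (l.foldl g (true, acc)) = acc.reverse ++ QBE.succBits l :=
    fun l => by
      induction l with
      | nil => intro acc; simp [fin, QBE.succBits]
      | cons b l ih =>
        intro acc
        have : g (true, acc) b = (b, (!b) :: acc) := rfl
        rw [List.foldl_cons, this]
        cases b
        · rw [h1]
          simp [QBE.succBits]
        · rw [ih]
          simp [QBE.succBits]
  have h3 : Poly fun l : List Bool => l.foldl g (true, []) :=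
    foldl_of_size_le 4 (g := fun _ c b => g c b) id (const _) (by fun_prop) fun _ c b => by
      have := size_bool_le c.1
      obtain ⟨_ | _, c⟩ := c <;> cases b <;> simp [g, Data.size] <;> omega
  have h4 : Poly fin := by fun_prop
  exact (h4.comp (h3.comp hl)).of_eq fun a => h2 (l a) []

/-- The relation symbols, as atoms with trivial entries, from the list of their arities. -/
def symbolsStep (c : List Bool × List VAtom) (u : List Bool) : List Bool × List VAtom :=
  (succBits c.1, (Data.enc c.1, u.map fun _ => V.nil) :: c.2)

/-- A relation symbol is its place in the list of arities; the first component is a binary counter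
for these places. -/
theorem foldl_symbolsStep (m : ℕ) (ar : Fin m → List Bool) :
    (List.ofFn ar).foldl symbolsStep ([], []) =
      (m.bits, (List.ofFn fun R : Fin m => (natCode R, (ar R).map fun _ => V.nil)).reverse) := by
  induction m with
  | zero => simp
  | succ m ih =>
    rw [List.ofFn_succ_last, List.foldl_append, ih]
    simp only [List.foldl_cons, List.foldl_nil, symbolsStep, succBits_bits, List.ofFn_succ_last,
      List.reverse_append]
    rfl

theorem size_map_nil_le (u : List Bool) : Data.size (u.map fun _ => V.nil) ≤ Data.size u := by
  induction u with
  | nil => simp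
  | cons b u ih =>
    have : 1 ≤ Data.size b := by cases b <;> simp [Data.size]
    rw [List.map_cons, size_list_cons, size_list_cons, size_V, V.len_nil]
    omega

@[fun_prop]
theorem Poly.symbols {α : Type} [Data α] {l : α → List (List Bool)} (hl : Poly l) :
    Poly fun a => (l a).foldl symbolsStep ([], []) := by
  have h4 := (PolyBound.const 4).mul hl.size
  refine foldl (g := fun _ => symbolsStep) (t := fun a => (4 * Data.size (l a) + 1) +
    (Data.size (l a) * ((4 * Data.size (l a) + 1) + Data.size (l a) + 2) + 1) + 1) hl
    (const _) ?_ ?_ ?_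
  · have : Poly fun p : List Bool × List VAtom × List Bool => (QBE.succBits p.1,
      (Data.enc p.1, p.2.2.map fun _ => V.nil) :: p.2.1) := by fun_prop
    unfold symbolsStep
    fun_prop
  · exact ((h4.add (.const 1)).add ((hl.size.mul (((h4.add (.const 1)).add hl.size).add
      (.const 2))).add (.const 1))).add (.const 1)
  · intro a l₁ l₂ h
    have hlen : l₁.length ≤ Data.size (l a) := by
      have := length_lt_size (l a)
      have := congrArg List.length h
      rw [List.length_append] at this
      omega
    obtain ⟨m, ar, rfl⟩ : ∃ m, ∃ ar : Fin m → List Bool, l₁ = List.ofFn ar :=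
      ⟨_, fun i => l₁[i], (List.ofFn_getElem (xs := l₁)).symm⟩
    rw [List.length_ofFn] at hlen
    rw [foldl_symbolsStep]
    simp only [size_pair, size_reverse]
    have h1 := size_bits_le m
    have h2 := size_le_of_forall (l := List.ofFn fun R : Fin m =>
      (natCode R, (ar R).map fun _ => V.nil)) (B := (4 * Data.size (l a) + 1) +
        Data.size (l a) + 1) fun x hx => by
      obtain ⟨R, rfl⟩ := (List.mem_ofFn' _ _).1 hx
      have h1 : (natCode R).len ≤ _ := (InjData.size_eq _).symm.trans_le (size_bits_le R)
      have h2 := (size_map_nil_le (ar R)).trans (size_le_of_mem (l := l a) (by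
        rw [h]
        exact List.mem_append_left _ ((List.mem_ofFn' _ _).2 ⟨R, rfl⟩)))
      have := R.2
      simp only [size_pair, size_V]
      omega
    have h3 := Nat.mul_le_mul_right (4 * Data.size (l a) + 1 + Data.size (l a) + 2) hlen
    rw [List.length_ofFn] at h2
    have h4 : 4 * Data.size (l a) + 1 + Data.size (l a) + 1 + 1 =
      4 * Data.size (l a) + 1 + Data.size (l a) + 2 := rfl
    rw [h4] at h2
    omega

/-! ### Instances as data -/

/-- The size of an instance is exponential in the length of its encoding. -/
instance : Data Instance :=
  ⟨fun I => Data.enc I.encode,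
    fun I => 2 ^ (I.encode.length * I.encode.length) + (I.encode.length * 10 + 1), fun I => by
    refine le_trans ?_ (Nat.le_add_left _ _)
    rw [← InjData.size_eq]
    exact size_le_of_forall fun s _ => size_sym_le s⟩

namespace Instance

@[fun_prop]
theorem poly_encode : Poly Instance.encode :=
  .of_enc (fun _ => rfl) (PolyBound.size.mono fun I => by
    refine le_trans ?_ (Nat.le_add_left _ _)
    exact size_le_of_forall fun s _ => size_sym_le s)

theorem poly_symbols : Poly fun I : Instance => I.toInput.1 := by
  have h : Poly fun I : Instance =>
      List.ofFn fun R => List.replicate (I.schema.arity R) true :=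
    .of_enc_comp (g := fun I => (parse I.encode).headD .nil) (by fun_prop) fun I => by
      rw [parse_encode]; rfl
  have h' : Poly fun I : Instance => ((List.ofFn fun R => List.replicate (I.schema.arity R)
      true).foldl symbolsStep ([], [])).2.reverse := by fun_prop
  refine h'.of_eq fun I => ?_
  rw [foldl_symbolsStep]
  simp [toInput]

theorem poly_db : Poly fun I : Instance => I.toInput.2.1 := by
  have h : Poly fun I : Instance =>
      I.db.flatMap fun A => [natCode A.rel, Data.enc (tupleCode A.args)] :=
    .of_enc_comp (g := fun I => (parse I.encode).tail.headD .nil) (by fun_prop) fun I => by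
      rw [parse_encode]; rfl
  refine .of_enc_comp (g := fun I => Data.enc (pairUp (I.db.flatMap fun A =>
    [natCode A.rel, Data.enc (tupleCode A.args)]))) (by fun_prop) fun I => ?_
  rw [pairUp_flatMap, ← enc_map_enc, ← enc_map_enc (List.map _ I.db), toInput, List.map_map,
    List.map_map]
  rfl

theorem poly_arity : Poly fun I : Instance => I.toInput.2.2.1 := by
  have h : Poly fun I : Instance => List.replicate I.n true :=
    .of_enc_comp (g := fun I => (parse I.encode).tail.tail.headD .nil) (by fun_prop) fun I => by
      rw [parse_encode]; rfl
  have h' : Poly fun I : Instance => (List.replicate I.n true).map fun _ => V.nil := by fun_prop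
  exact h'.of_eq fun I => by simp [toInput]

theorem poly_posList : Poly fun I : Instance => I.toInput.2.2.2.1 :=
  .of_enc_comp (g := fun I => (parse I.encode).tail.tail.tail.headD .nil) (by fun_prop)
    fun I => by rw [parse_encode]; rfl

theorem poly_negList : Poly fun I : Instance => I.toInput.2.2.2.2 :=
  .of_enc_comp (g := fun I => (parse I.encode).tail.tail.tail.tail.headD .nil) (by fun_prop)
    fun I => by rw [parse_encode]; rfl

/-! ### Bounds by the length of the encoding -/

theorem length_le_flatMap {α : Type} {f : α → List Sym} {g : α → ℕ} (h : ∀ a, g a ≤ (f a).length)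
    (l : List α) : (l.map g).sum ≤ (l.flatMap f).length := by
  induction l with
  | nil => simp
  | cons a l ih =>
    have := h a
    rw [List.map_cons, List.sum_cons, List.flatMap_cons, List.length_append]
    omega

theorem length_le_encList {α : Type} {f : α → List Sym} (h : ∀ a, 1 ≤ (f a).length)
    (l : List α) : l.length ≤ (encList f l).length := by
  have := length_le_flatMap h l
  simp only [List.map_const', List.sum_replicate, smul_eq_mul, mul_one] at this
  rw [encList, List.length_cons, List.length_append]
  omega

theorem length_encTuple {n : ℕ} (a : Fin n → ℕ) : n ≤ (encTuple a).length := by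
  have := length_le_encList (f := encNat) (fun m => by simp [encNat]) (List.ofFn a)
  rwa [List.length_ofFn] at this

theorem n_le (I : Instance) : I.n ≤ I.encode.length := by
  simp [encode, encArity]; omega

theorem length_db_le (I : Instance) : I.db.length ≤ I.encode.length := by
  have := length_le_encList (f := encAtom (σ := I.schema))
    (fun A => by simp [encAtom, encNat]; omega) I.db
  simp [encode]; omega

theorem length_posList_le (I : Instance) : I.posList.length ≤ I.encode.length := by
  have := length_le_encList (f := encTuple (n := I.n)) (fun A => by simp [encTuple, encList])
    I.posList
  simp [encode]; omega

theorem length_elems_le (I : Instance) : (elems I.toInput.2.1).length ≤ I.encode.length := by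
  have := length_le_flatMap (f := encAtom (σ := I.schema)) (g := fun A => I.schema.arity A.rel)
    (fun A => by
      have := length_encTuple A.args
      simp [encAtom]; omega) I.db
  have h : (elems I.toInput.2.1).length = (I.db.map fun A => I.schema.arity A.rel).sum := by
    simp [elems, toInput, List.length_flatMap, atomCode, comp_def]
  rw [h]
  simp only [encode, encList, List.length_append, List.length_cons]
  omega

theorem length_distinct_le {α : Type} [DecidableEq α] (l : List α) :
    (distinct l).length ≤ l.length :=
  ((distinct_spec l).1.subperm fun a h => ((distinct_spec l).2 a).1 h).length_le

/-- Powers whose base and exponent are bounded by the length of the encoding. -/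
theorem polyBound_pow {b e : Instance → ℕ} (hb : ∀ I, b I ≤ I.encode.length)
    (he : ∀ I, e I ≤ I.encode.length) : PolyBound fun I => (b I + 1) ^ e I :=
  PolyBound.size.mono fun I => by
    refine le_trans ?_ (Nat.le_add_right _ _)
    rw [pow_mul]
    -- Base `2 ^ ℓ` and exponent `ℓ` give `2 ^ (ℓ * ℓ)`, the leading term of the size assigned to
    -- instances.
    have h1 : b I + 1 ≤ 2 ^ I.encode.length := (Nat.succ_le_succ (hb I)).trans Nat.lt_two_pow_self
    exact (Nat.pow_le_pow_left h1 _).trans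
      (Nat.pow_le_pow_right (Nat.two_pow_pos _) (he I))

end Instance

/-! ### Growth of the iterated product -/

theorem length_prodStep_le (D P : List VAtom) :
    (prodStep D P).length ≤ P.length * D.length := by
  rw [prodStep, List.length_flatMap]
  refine (List.sum_le_card_nsmul _ D.length fun x hx => ?_).trans (by simp)
  obtain ⟨A, -, rfl⟩ := List.mem_map.1 hx
  rw [List.length_map]
  exact List.length_filter_le _ _

theorem size_zipWith_cons_le (l l' : List V) :
    Data.size (l.zipWith V.cons l') ≤ Data.size l + Data.size l' := by
  induction l generalizing l' with
  | nil => simp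
  | cons v l ih =>
    cases l' with
    | nil => simp
    | cons v' l' =>
      have := ih l'
      simp; omega

theorem size_le_of_mem_prodStep {D P : List VAtom} {B : ℕ} (h : ∀ A ∈ P, Data.size A ≤ B)
    {A : VAtom} (hA : A ∈ prodStep D P) : Data.size A ≤ Data.size D + B := by
  simp only [prodStep, List.mem_flatMap, List.mem_map, List.mem_filter] at hA
  obtain ⟨A, hA, B, ⟨hB, -⟩, rfl⟩ := hA
  have h1 := h A hA
  have h2 := size_le_of_mem hB
  have h3 := size_zipWith_cons_le B.2 A.2
  simp only [size_pair] at *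
  omega

/-- A factor multiplies the number of atoms but only adds to the size of each atom; the exponential
growth is confined to the length of the list. -/
theorem foldl_prodStep_bounds {T : Type} (D P : List VAtom) (l : List T) :
    (l.foldl (fun P _ => prodStep D P) P).length ≤ P.length * D.length ^ l.length ∧
      ∀ A ∈ l.foldl (fun P _ => prodStep D P) P,
        Data.size A ≤ l.length * Data.size D + Data.size P := by
  induction l using List.reverseRecOn with
  | nil => exact ⟨by simp, fun A h => by simpa using size_le_of_mem h⟩
  | append_singleton l s ih =>
    rw [List.foldl_append, List.foldl_cons, List.foldl_nil, List.length_append,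
      List.length_singleton]
    refine ⟨(length_prodStep_le _ _).trans ?_, fun A hA => ?_⟩
    · rw [pow_succ, ← mul_assoc]
      exact Nat.mul_le_mul_right _ ih.1
    · have := size_le_of_mem_prodStep ih.2 hA
      rw [Nat.add_mul]
      omega

namespace Instance

theorem poly_prod : Poly fun I : Instance => I.toInput.prod := by
  have hl : Poly fun I : Instance => distinct I.toInput.2.2.2.1 := .distinct poly_posList
  have hlen : ∀ I : Instance, (distinct I.toInput.2.2.2.1).length ≤ I.encode.length := fun I =>
    (length_distinct_le _).trans (by simpa [toInput] using I.length_posList_le)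
  have hpow : PolyBound fun I : Instance =>
      (I.toInput.2.1.length + 1) ^ (distinct I.toInput.2.2.2.1).length :=
    polyBound_pow (fun I => by simpa [toInput] using I.length_db_le) hlen
  have hd := poly_db.size
  have hs := poly_symbols.size
  unfold Input.prod
  refine .foldl (g := fun I P _ => prodStep I.toInput.2.1 P)
    (t := fun I => Data.size I.toInput.1 *
      (I.toInput.2.1.length + 1) ^ (distinct I.toInput.2.2.2.1).length *
      (Data.size (distinct I.toInput.2.2.2.1) * Data.size I.toInput.2.1 +
        Data.size I.toInput.1 + 1) + 1) hl poly_symbols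
    (.prodStep (poly_db.comp .fst) (by fun_prop))
    (((hs.mul hpow).mul (((hl.size.mul hd).add hs).add (.const 1))).add (.const 1))
    fun I l₁ l₂ h => ?_
  obtain ⟨h1, h2⟩ := foldl_prodStep_bounds I.toInput.2.1 I.toInput.1 l₁
  have h3 : l₁.length ≤ (distinct I.toInput.2.2.2.1).length := by rw [h]; simp
  refine (size_le_of_forall h2).trans (Nat.succ_le_succ (Nat.mul_le_mul (h1.trans
    (Nat.mul_le_mul (length_lt_size _).le ?_)) ?_))
  · exact (Nat.pow_le_pow_left (Nat.le_succ _) _).trans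
      (Nat.pow_le_pow_right (Nat.succ_pos _) h3)
  · have := Nat.mul_le_mul_right (Data.size I.toInput.2.1) (h3.trans (length_lt_size _).le)
    omega

theorem poly_tuple : Poly fun I : Instance => I.toInput.tuple := by
  unfold Input.tuple
  exact .foldl_of_size_le 1 (g := fun (_ : Instance) (acc t : List V) => t.zipWith V.cons acc)
    (.distinct poly_posList) poly_arity (by fun_prop) fun _ acc t => by
      have := size_zipWith_cons_le t acc
      omega

theorem poly_pebbleTuples (k : ℕ) : Poly fun I : Instance => I.toInput.pebbleTuples k := by
  unfold Input.pebbleTuples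
  refine .filter (.tuples_length (.distinct poly_db.elems) poly_arity ?_)
    (.wins _ (poly_prod.comp .fst) (poly_db.comp .fst) (poly_tuple.comp .fst) .snd)
  refine polyBound_pow (fun I => (length_distinct_le _).trans I.length_elems_le) fun I => ?_
  simpa [toInput] using I.n_le

theorem poly_explainable (k : ℕ) : Poly fun I : Instance => I.toInput.explainable k := by
  unfold Input.explainable
  exact .and (.isCovered _ poly_prod poly_tuple)
    (.all (c := fun I b => !decide (b ∈ I.toInput.2.2.2.2)) (poly_pebbleTuples k)
      (.not (.mem .snd (poly_negList.comp .fst))))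

end Instance

end QBE

namespace QBE

open Function

/-! ### The answer as a word -/

/-- The word for a list of tuples, given by their binary representations. -/
def outputWord (L : List (List (List Bool))) : List Sym :=
  .one :: .lpar :: ((L.flatMap fun t => .lpar :: ((t.flatMap fun l =>
    (l.map fun b => if b then Sym.one else Sym.zero) ++ [.comma]) ++ [.rpar])) ++ [.rpar])

@[fun_prop]
theorem Poly.outputWord {α : Type} [Data α] {L : α → List (List (List Bool))} (hL : Poly L) :
    Poly fun a => QBE.outputWord (L a) := by
  unfold QBE.outputWord
  fun_prop

theorem encOutput_some {n : ℕ} (L : List (Fin n → ℕ)) :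
    encOutput (some L) = outputWord (L.map fun b => (List.ofFn b).map Nat.bits) := by
  have h : encNat = fun m : ℕ =>
      (m.bits.map fun b => if b then Sym.one else Sym.zero) ++ [.comma] := funext fun m => by
    simp [encNat, Bool.cond_eq_ite]
  have h' : encTuple (n := n) = fun b => .lpar :: ((((List.ofFn b).map Nat.bits).flatMap fun l =>
      (l.map fun b => if b then Sym.one else Sym.zero) ++ [.comma]) ++ [.rpar]) := funext fun b => by
    simp only [encTuple, encList, h, List.flatMap_map]
  simp only [encOutput, encList, outputWord, h', List.flatMap_map]

namespace Instance

/-- The output for an instance. -/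
noncomputable def output (k : ℕ) (I : Instance) : Option (List (Fin I.n → ℕ)) :=
  if I.toInput.explainable k then some (exists_list (I := I) k).choose else none

theorem poly_encOutput (k : ℕ) : Poly fun I : Instance => encOutput (I.output k) := by
  -- The list is obtained by choice, but its code is that of the computed list of tuples, and only
  -- codes matter for computability.
  have h : Poly fun I : Instance =>
      (exists_list (I := I) k).choose.map fun b => (List.ofFn b).map Nat.bits := by
    refine Poly.of_enc_comp (Poly.enc.comp (poly_pebbleTuples k)) fun I => ?_
    refine Eq.trans ?_ (congrArg Data.enc (exists_list (I := I) k).choose_spec.2.2).symm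
    generalize (exists_list (I := I) k).choose = L
    rw [← enc_map_enc, List.map_map, ← enc_map_enc (List.map tupleCode _), List.map_map]
    refine congrArg Data.enc (List.map_congr_left fun b _ => ?_)
    simp only [comp_apply]
    rw [← enc_map_enc, List.map_map, List.map_ofFn]
    rfl
  refine ((poly_explainable k).ite h.outputWord (.const [.zero])).of_eq fun I => ?_
  unfold output
  split_ifs
  · exact (encOutput_some _).symm
  · rfl

theorem output_isSome_iff {k : ℕ} {I : Instance} :
    (I.output k).isSome ↔ ∃ q, IsTWExplanation k I.D I.pos I.neg q := by
  have : (I.output k).isSome ↔ I.toInput.explainable k = true := by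
    unfold output
    split_ifs <;> simp_all
  rw [this, explainable_iff]
  exact ⟨fun h => (exists_isTWExplanation h.1 h.2).imp fun _ hq => hq.1,
    fun ⟨q, hq⟩ => covered_of_isTWExplanation hq⟩

theorem output_eq_some {k : ℕ} {I : Instance} {L : List (Fin I.n → ℕ)}
    (h : I.output k = some L) : L.Nodup ∧
      (∃ q, IsTWExplanation k I.D I.pos I.neg q ∧ {b | b ∈ L} = q.eval I.D) ∧
      {b | b ∈ L} = I.pebbleTuples k := by
  unfold output at h
  split_ifs at h with h'
  obtain rfl := Option.some_injective _ h
  obtain ⟨h1, h2, -⟩ := (exists_list (I := I) k).choose_spec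
  obtain ⟨q, hq, hq'⟩ := exists_isTWExplanation (explainable_iff.1 h').1 (explainable_iff.1 h').2
  exact ⟨h1, ⟨q, hq, h2.trans hq'.symm⟩, h2⟩

end Instance

/-! ### Input and output of the programs -/

namespace Prog

/-- Replace the word on `main` by its code. -/
def readWord : Prog :=
  .seq (loop .main Option.isSome <| pop .main fun o => push .buf (o.getD .zero)) <|
  .seq (push .main .zero) <|
  loop .buf Option.isSome <| pop .buf fun o =>
    .seq (pushWord .main (Data.enc (o.getD .zero)).word) (push .main .one)

/-- Remove the code of a member of the list from `main`, and push this member on `buf`. -/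
def readSym : List Sym → Prog
  | [] => skip
  -- The code of a symbol is a list of leaves whose length is the number of the symbol: each leaf
  -- shows as a one and a zero, and a last zero ends the list.
  | x :: l => pop .main fun o => if o = some .one then pop .main fun _ => readSym l
      else push .buf x

/-- Replace the code of a word on `main` by this word on `out`. -/
def writeWord : Prog :=
  .seq (loop .main (fun o => o = some .one) <| pop .main fun _ =>
    readSym [.zero, .one, .comma, .lpar, .rpar]) <|
  .seq (pop .main fun _ => skip) (flush .out)

end Prog

open Prog

theorem runs_readWord (w : List Sym) : Runs readWord (st w [] [] [] [] [])
    (st (Data.enc w).word [] [] [] [] []) (2 * w.length + 2) := by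
  have h1 : ∀ w b, Runs (loop .main Option.isSome <| pop .main fun o => push .buf (o.getD .zero))
      (st w [] [] b [] []) (st [] [] [] (w.reverse ++ b) [] []) (w.length + 1) := fun w => by
    induction w with
    | nil => exact fun b => (Runs.done rfl).mono (by simp)
    | cons x w ih =>
      intro b
      refine (Runs.step rfl (Runs.pop (Runs.push rfl)) (T' := w.length + 1) ?_).mono
        (by simp; omega)
      simpa using ih (x :: b)
  have h2 : ∀ w v : List Sym, Runs (loop .buf Option.isSome <| pop .buf fun o =>
      .seq (pushWord .main (Data.enc (o.getD .zero)).word) (push .main .one))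
      (st (Data.enc v).word [] [] w [] []) (st (Data.enc (w.reverse ++ v)).word [] [] [] [] [])
      (w.length + 1) := fun w => by
    induction w with
    | nil => exact fun v => (Runs.done rfl).mono (by simp)
    | cons x w ih =>
      intro v
      refine (Runs.step (s' := st (Data.enc (x :: v)).word [] [] w [] []) (T := 0 + 0)
        (T' := w.length + 1) rfl (Runs.pop ?_) ?_).mono (by simp; omega)
      · rw [update_st_buf]
        refine ((runs_pushWord (Data.enc v).word [] [] [] (Data.enc x).word w []).seq
          (Runs.push ?_))
        simp [V.word]
      · simpa using ih (x :: v)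
  have h3 : Runs (push .main .zero) (st [] [] [] (w.reverse ++ []) [] [])
      (st (Data.enc ([] : List Sym)).word [] [] (w.reverse ++ []) [] []) 0 :=
    Runs.push (by simp [V.word])
  have h4 := (h1 w []).seq (h3.seq (h2 (w.reverse ++ []) []))
  simp only [List.append_nil, List.reverse_reverse, List.length_reverse] at h4
  exact h4.mono (by omega)

theorem runs_readSym (x : Sym) (m b : List Sym) :
    Runs (readSym [.zero, .one, .comma, .lpar, .rpar]) (st ((Data.enc x).word ++ m) [] [] b [] [])
      (st m [] [] (x :: b) [] []) 0 := by
  cases x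
  · exact Runs.pop (Runs.push (by simp; rfl))
  · exact Runs.pop (Runs.pop (Runs.pop (Runs.push (by simp; rfl))))
  · exact Runs.pop (Runs.pop (Runs.pop (Runs.pop (Runs.pop (Runs.push (by simp; rfl))))))
  · exact Runs.pop (Runs.pop (Runs.pop (Runs.pop (Runs.pop (Runs.pop (Runs.pop
      (Runs.push (by simp; rfl))))))))
  · exact Runs.pop (Runs.pop (Runs.pop (Runs.pop (Runs.pop (Runs.pop (Runs.pop (Runs.pop
      (Runs.pop (Runs.push (by simp; rfl))))))))))

theorem runs_writeWord (w : List Sym) : Runs writeWord (st (Data.enc w).word [] [] [] [] [])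
    (st [] [] [] [] [] w) (2 * w.length + 2) := by
  have h1 : ∀ w b : List Sym, Runs (loop .main (fun o => o = some .one) <| pop .main fun _ =>
      readSym [.zero, .one, .comma, .lpar, .rpar]) (st (Data.enc w).word [] [] b [] [])
      (st [.zero] [] [] (w.reverse ++ b) [] []) (w.length + 1) := fun w => by
    induction w with
    | nil => exact fun b => (Runs.done rfl).mono (by simp)
    | cons x w ih =>
      intro b
      refine (Runs.step rfl (Runs.pop ?_) (T := 0) (T' := w.length + 1)
        (s' := st (Data.enc w).word [] [] (x :: b) [] []) ?_).mono (by simp; omega)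
      · simpa [V.word] using runs_readSym x (Data.enc w).word b
      · simpa using ih (x :: b)
  refine ((h1 w []).seq ((Runs.pop Runs.skip).seq (runs_flush (k := .out) (b := w.reverse)
    (by decide) ?_ ?_))).mono (by simp; omega)
  · simp
  · simp

theorem Poly.exists_machine {f : Instance → List Sym} (hf : Poly f) :
    ∃ (M : Turing.TM2ComputableAux Sym Sym) (p : Polynomial ℕ), ∀ I : Instance,
      OutputsWithin M I.encode (f I) (2 ^ p.eval I.encode.length) := by
  have hs := hf.size
  obtain ⟨⟨q, T, hq, hT⟩, -⟩ := hf
  have he : PolyBound fun I : Instance => I.encode.length :=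
    Instance.poly_encode.size.mono fun I => (length_lt_size _).le
  -- The total cost: reading the word, the computation, writing the result, and the first step of
  -- the machine.
  obtain ⟨c, hc⟩ := ((((PolyBound.const 2).mul he).add (.const 2)).add
    (hT.add (((PolyBound.const 2).mul hs).add (.const 2)))).add (.const 1)
  refine ⟨(Prog.seq readWord (.seq q writeWord)).machine,
    -- With `n` the length of the input, `size I + 2` is `2 ^ (n * n) + 10 * n + 3`, at most `2 ^ (n
    -- * n + 10 * n + 3)`; the factor `c` is the exponent of the polynomial bound.
    .C c * (.X ^ 2 + .C 10 * .X + .C 3), fun I => ?_⟩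
  have h1 : ∀ w : List Sym, st w [] [] [] [] [] = update (fun _ => []) Reg.main w := fun w => by
    funext k; cases k <;> rfl
  have h2 : ∀ w : List Sym, st [] [] [] [] [] w = update (fun _ => []) Reg.out w := fun w => by
    funext k; cases k <;> rfl
  have hq' := hq I [] [] []
  rw [List.append_nil, List.append_nil] at hq'
  obtain ⟨t, ht, hr⟩ := (runs_readWord I.encode).seq (hq'.seq (runs_writeWord (f I)))
  rw [h1, h2] at hr
  refine Prog.machine_outputsWithin hr (le_trans ?_ ((hc I).trans ?_))
  · have := length_lt_size (f I)
    dsimp only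
    omega
  · set n := I.encode.length with hn
    have h3 : (Polynomial.C c * (Polynomial.X ^ 2 + Polynomial.C 10 * Polynomial.X +
        Polynomial.C 3)).eval n = (n * n + (10 * n + 3)) * c := by
      simp
      ring
    rw [h3, pow_mul]
    refine Nat.pow_le_pow_left ?_ c
    have h4 : Data.size I + 2 = 2 ^ (n * n) + (10 * n + 3) := by
      change 2 ^ (n * n) + (n * 10 + 1) + 2 = _
      ring
    rw [h4, pow_add]
    have h5 : 10 * n + 3 + 1 ≤ 2 ^ (10 * n + 3) := Nat.lt_two_pow_self
    have h6 := Nat.mul_le_mul_left (2 ^ (n * n)) h5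
    have h7 := Nat.mul_le_mul_right (10 * n + 3) (Nat.one_le_two_pow (n := n * n))
    rw [Nat.mul_add] at h6
    omega

end QBE

/-- For fixed `k ≥ 1` there is a machine and a polynomial `p` (both depend on `k` only) such that
on every instance the machine halts within `2 ^ p(length of the input)` steps, with an output that
says whether there is a `TW(k)`-explanation, and if so lists `q(D)` for a `TW(k)`-explanation `q`;
this set consists of the tuples `b` over `D` with `∏_{a ∈ S⁺} (D, a) →_{k+1} (D, b)`. -/
theorem theorem7 (k : ℕ) (hk : 1 ≤ k) :
    ∃ (M : Turing.TM2ComputableAux QBE.Sym QBE.Sym) (p : Polynomial ℕ),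
      ∀ I : QBE.Instance, ∃ out : Option (List (Fin I.n → ℕ)),
        QBE.OutputsWithin M I.encode (QBE.encOutput out) (2 ^ p.eval I.encode.length) ∧
        (out.isSome ↔ ∃ q, QBE.IsTWExplanation k I.D I.pos I.neg q) ∧
        ∀ L, out = some L →
          L.Nodup ∧
          (∃ q, QBE.IsTWExplanation k I.D I.pos I.neg q ∧ {b | b ∈ L} = q.eval I.D) ∧
          {b | b ∈ L} = I.pebbleTuples k := by
  obtain ⟨M, p, h⟩ := (QBE.Instance.poly_encOutput k).exists_machine
  exact ⟨M, p, fun I => ⟨I.output k, h I, QBE.Instance.output_isSome_iff,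
    fun _ => QBE.Instance.output_eq_some⟩⟩
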